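/- **Setting.** Let $X_\natural\in\mathbb R^{d\times d}$ be positive semidefinite of rank $r\ge 1$, with singular values $\sigma_1\ge\dots\ge\sigma_r>0$ and condition number $\kappa=\sigma_1/\sigma_r$, and let $k\ge r$. Let $A_1,\dots,A_m\in\mathbb R^{d\times d}$ and $s\in\mathbb R^m$. Put $\mathrm{sign}(x)=-1$ for $x<0$ and $\mathrm{sign}(x)=1$ for $x\ge 0$, and $$D(X)=\frac1m\sum_{i=1}^m \mathrm{sign}\big(\langle A_i,X\rangle-s_i\big)A_i .$$ The pair $\{(A_i,s_i)\}_{i=1}^m$ satisfies the *restricted direction preserving property* $(k',\delta)$-RDPP with scaling function $\psi:\mathbb R^{d\times d}\to\mathbb R$ if $\big\|D(X)-\psi(X)\,X/\|X\|_F\big\|\le\delta$ for every nonzero symmetric $X$ of rank at most $k'$. Here $\|\cdot\|$ is the spectral norm and $\|\cdot\|_F$ the Frobenius norm. Given $F_0\in\mathbb R^{d\times k}$ and stepsizes $\eta_t$, let $$F_{t+1}=F_t-\eta_t\,D(F_tF_t^\top-X_\natural)F_t,\qquad t=0,1,2,\dots$$ **Theorem.** For every $c_1>0$ there is $\tilde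 c_0>0$, depending only on $c_1$, such that for every $\epsilon\in(0,1)$ there are constants $c_3,c_4,c_5,c_6>0$ and $c_7\in(0,1)$, depending only on $\epsilon$ and $c_1$, for which the following holds for all $d,m,r,k,X_\natural,A,s,F_0,(\eta_t)$ as above. Suppose that (i) $\|F_0F_0^\top-c^*X_\natural\|\le c_0\sigma_r/\kappa$ for some $c^*\in[\epsilon,1/\epsilon]$, where $c_0=\tilde c_0\,\epsilon$; (ii) for some $c_2$ with $c_1<c_2\le 0.01$ and $c_2c^*\le 1$, and for all $t\ge0$, $$c_1\frac{\sigma_r}{\sigma_1^2}\,\|F_tF_t^\top-X_\natural\|_F\ \le\ \eta_t\ \le\ c_2\frac{\sigma_r}{\sigma_1^2}\,\|F_tF_t^\top-X_\natural\|_F ;$$ (iii) $\{(A_i,s_i)\}_{i=1}^m$ satisfies $(r+k,\delta)$-RDPP with some $\delta\le \dfrac{c_3}{\kappa^3\sqrt k}$ and some scaling function $\psi$ with values in $\big[\sqrt{1/(2\pi)},\sqrt{2/\pi}\big]$. Let $\mathcal T=\lceil c_4\kappa^2\log\kappa\rceil$. Then $$\|F_{t+\mathcal T}F_{t+\mathcal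 T}^\top-X_\natural\|\le c_5\,\sigma_1\,\frac{\kappa}{\kappa^3+t}\qquad\text{for all integers } t\ge0,$$ and if moreover $k=r$, then $$\|F_{t+\mathcal T}F_{t+\mathcal T}^\top-X_\natural\|\le \frac{c_6\sigma_r}{\kappa}\Big(1-\frac{c_7}{\kappa^2}\Big)^t\qquad\text{for all integers } t\ge0.$$ -/

import Mathlib

noncomputable section

namespace RobustMatrixRecovery

/-- The sign convention used by the subgradient method: `sign 0 = 1`. -/
def sgn (x : ℝ) : ℝ := if x < 0 then -1 else 1

/-- The trace inner product `⟨A, X⟩ = ∑ᵢⱼ Aᵢⱼ Xᵢⱼ`. -/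
def frobInner {d : ℕ} (A X : Matrix (Fin d) (Fin d) ℝ) : ℝ :=
  ∑ i, ∑ j, A i j * X i j

/-- The Frobenius norm. -/
def frobNorm {d : ℕ} (X : Matrix (Fin d) (Fin d) ℝ) : ℝ :=
  √(∑ i, ∑ j, X i j ^ 2)

/-- The spectral norm (operator norm with respect to the Euclidean norm). -/
def specNorm {d : ℕ} (X : Matrix (Fin d) (Fin d) ℝ) : ℝ :=
  ‖Matrix.toEuclideanCLM (n := Fin d) (𝕜 := ℝ) X‖

/-- The `i`-th largest singular value, numbered from `i = 1`. -/
def sigma {d : ℕ} (X : Matrix (Fin d) (Fin d) ℝ) (i : ℕ) : ℝ :=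
  (Matrix.toEuclideanLin X).singularValues (i - 1)

/-- The condition number `σ₁ / σᵣ` of a matrix of rank `r`. -/
def condNumber {d : ℕ} (X : Matrix (Fin d) (Fin d) ℝ) (r : ℕ) : ℝ :=
  sigma X 1 / sigma X r

/-- `D(X) = (1/m) ∑ᵢ sign(⟨Aᵢ, X⟩ - sᵢ) Aᵢ`. -/
def subgradD {d m : ℕ} (A : Fin m → Matrix (Fin d) (Fin d) ℝ) (s : Fin m → ℝ)
    (X : Matrix (Fin d) (Fin d) ℝ) : Matrix (Fin d) (Fin d) ℝ :=
  (1 / (m : ℝ)) • ∑ i, sgn (frobInner (A i) X - s i) • A i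

/-- The restricted direction preserving property with parameters `(k', δ)` and scaling
function `ψ`. It is required for `X ≠ 0` only, as `X / ‖X‖_F` has no meaning at `X = 0`. -/
def RDPP {d m : ℕ} (A : Fin m → Matrix (Fin d) (Fin d) ℝ) (s : Fin m → ℝ)
    (k' : ℕ) (δ : ℝ) (ψ : Matrix (Fin d) (Fin d) ℝ → ℝ) : Prop :=
  ∀ X : Matrix (Fin d) (Fin d) ℝ, X.IsSymm → X.rank ≤ k' → X ≠ 0 →
    specNorm (subgradD A s X - (ψ X / frobNorm X) • X) ≤ δ

/-- The subgradient method `F_{t+1} = F_t - η_t D(F_t F_tᵀ - X♮) F_t`. -/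
def iterates {d k m : ℕ} (A : Fin m → Matrix (Fin d) (Fin d) ℝ) (s : Fin m → ℝ)
    (Xnat : Matrix (Fin d) (Fin d) ℝ) (η : ℕ → ℝ) (F₀ : Matrix (Fin d) (Fin k) ℝ) :
    ℕ → Matrix (Fin d) (Fin k) ℝ
  | 0 => F₀
  | t + 1 =>
    let F := iterates A s Xnat η F₀ t
    F - η t • (subgradD A s (F * F.transpose - Xnat) * F)

/-- The residual `F_t F_tᵀ - X♮` of the `t`-th iterate. -/
def residual {d k m : ℕ} (A : Fin m → Matrix (Fin d) (Fin d) ℝ) (s : Fin m → ℝ)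
    (Xnat : Matrix (Fin d) (Fin d) ℝ) (η : ℕ → ℝ) (F₀ : Matrix (Fin d) (Fin k) ℝ) (t : ℕ) :
    Matrix (Fin d) (Fin d) ℝ :=
  iterates A s Xnat η F₀ t * (iterates A s Xnat η F₀ t).transpose - Xnat

/-- The burn-in time `c₄ κ² log κ`, rounded up to an integer. -/
def burnIn (c₄ κ : ℝ) : ℕ := ⌈c₄ * κ ^ 2 * Real.log κ⌉₊

end RobustMatrixRecovery

end

/-! Divide by σ₁ and write `X` for the scaled ground truth, μ = σᵣ/σ₁ = 1/κ and R = F Fᵀ - X. By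
RDPP and the stepsize rule, each step is a gradient step F - a (R + E) F, with a between αμ and
μ/100 and ‖E‖ ≤ ρ μ³ ‖R‖ (`exists_normalized_step`). Everything else is perturbed gradient descent
on F Fᵀ ≈ X, where X = U D Uᵀ, D = Dh², and P = 1 - U Uᵀ.

Near X two numbers suffice, q = ‖Uᵀ R‖ and τ = ‖P F‖², because ‖R‖ ≤ 2q + τ. Up to small coupling, q
contracts by 1 - aμ/2, while τ obeys τ' ≤ τ - (a/4) τ², a discrete Riccati inequality with solution
of order 1/t (`local_phase`). If k = r, then τ ≤ 2q²/μ, so τ is slaved to q and the rate is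
geometric (`norm_residual_le_of_local_phase_square`).

The start is only close to c* X, with c* of constant order, so a warm phase must lead into this
basin. It follows the whitened Gram matrix J = G Gᵀ, G = Di Uᵀ F, which begins near c* · 1 and
evolves as J' = B J Bᵀ + Ω with B = 1 - a (J - 1) D. Positivity of J alone brings ‖J - 1‖ down to
about 1 (`norm_congr_sub_one_le`), but no further, since J could be nearly singular. The inverse V
of J excludes this: V - 1 contracts to first order, with an error proportional to a² ‖J - 1‖ ‖V - 1‖
(`exists_inverse_congr`). During the O(μ⁻²) steps with J large, V grows by at most a constant factor
K; afterwards it contracts to within O(μ) of 1 in O(μ⁻² log μ⁻¹) further steps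
(`WarmPhase.conclusion`).

Finally the two phases are joined (`exists_convergence_constants`). The prescribed burn-in may be
shorter than the warm phase, so the warm phase is covered by a geometric bound with a large
prefactor, which the burn-in then reduces to order μ². -/

noncomputable section
namespace RobustMatrixRecovery
set_option linter.unusedSectionVars false
open Matrix
open scoped Matrix.Norms.L2Operator

/-! ### Spectral norms through quadratic forms -/

section Norms
variable {m n l : Type*} [Fintype m] [Fintype n] [Fintype l]
  [DecidableEq m] [DecidableEq n] [DecidableEq l]

lemma norm_transpose' (A : Matrix m n ℝ) : ‖Aᵀ‖ = ‖A‖ := by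
  rw [← conjTranspose_eq_transpose_of_trivial, l2_opNorm_conjTranspose]

lemma norm_transpose_mul_self (A : Matrix m n ℝ) : ‖Aᵀ * A‖ = ‖A‖ ^ 2 := by
  rw [← conjTranspose_eq_transpose_of_trivial, l2_opNorm_conjTranspose_mul_self, sq]

lemma norm_mul_transpose_self (A : Matrix m n ℝ) : ‖A * Aᵀ‖ = ‖A‖ ^ 2 := by
  have := norm_transpose_mul_self Aᵀ
  rwa [transpose_transpose, norm_transpose'] at this

lemma norm_mul_le_of_le {A : Matrix m n ℝ} {B : Matrix n l ℝ} {a b : ℝ}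
    (hA : ‖A‖ ≤ a) (hB : ‖B‖ ≤ b) : ‖A * B‖ ≤ a * b :=
  (l2_opNorm_mul A B).trans
    (mul_le_mul hA hB (norm_nonneg _) ((norm_nonneg _).trans hA))

lemma norm_one_le : ‖(1 : Matrix n n ℝ)‖ ≤ 1 := by
  rw [← diagonal_one, l2_opNorm_diagonal]
  exact (pi_norm_le_iff_of_nonneg zero_le_one).2 (fun i => by simp)

lemma dotProduct_self_eq_norm_sq (x : n → ℝ) : x ⬝ᵥ x = ‖WithLp.toLp 2 x‖ ^ 2 := by
  rw [EuclideanSpace.norm_sq_eq]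
  simp [dotProduct, sq]

lemma dotProduct_mulVec_self_le (A : Matrix m n ℝ) (x : n → ℝ) :
    (A *ᵥ x) ⬝ᵥ (A *ᵥ x) ≤ ‖A‖ ^ 2 * (x ⬝ᵥ x) := by
  rw [dotProduct_self_eq_norm_sq, dotProduct_self_eq_norm_sq, ← mul_pow]
  exact pow_le_pow_left₀ (norm_nonneg _) (l2_opNorm_mulVec A (WithLp.toLp 2 x)) 2

lemma norm_sq_le_of_dotProduct_mulVec_self_le (A : Matrix m n ℝ) {c : ℝ} (hc : 0 ≤ c)
    (h : ∀ x : n → ℝ, (A *ᵥ x) ⬝ᵥ (A *ᵥ x) ≤ c * (x ⬝ᵥ x)) : ‖A‖ ^ 2 ≤ c := by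
  have : ‖A‖ ≤ √c := by
    rw [l2_opNorm_def]
    refine ContinuousLinearMap.opNorm_le_bound _ (Real.sqrt_nonneg _) (fun x => ?_)
    have h1 := h (WithLp.ofLp x)
    rw [dotProduct_self_eq_norm_sq, dotProduct_self_eq_norm_sq] at h1
    refine le_of_sq_le_sq ?_ (by positivity)
    rw [mul_pow, Real.sq_sqrt hc]
    exact h1
  calc ‖A‖ ^ 2 ≤ √c ^ 2 := pow_le_pow_left₀ (norm_nonneg _) this 2
    _ = c := Real.sq_sqrt hc

lemma dotProduct_sq_le (x y : n → ℝ) : (x ⬝ᵥ y) ^ 2 ≤ (x ⬝ᵥ x) * (y ⬝ᵥ y) := by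
  have := Finset.sum_mul_sq_le_sq_mul_sq Finset.univ x y
  simpa [dotProduct, sq] using this

lemma dotProduct_self_nonneg' (x : n → ℝ) : 0 ≤ x ⬝ᵥ x :=
  Finset.sum_nonneg fun i _ => mul_self_nonneg (x i)

lemma abs_dotProduct_mulVec_le (A : Matrix n n ℝ) (x : n → ℝ) :
    |x ⬝ᵥ (A *ᵥ x)| ≤ ‖A‖ * (x ⬝ᵥ x) := by
  refine abs_le_of_sq_le_sq ?_ (mul_nonneg (norm_nonneg _) (dotProduct_self_nonneg' x))
  calc _ ≤ (x ⬝ᵥ x) * ((A *ᵥ x) ⬝ᵥ (A *ᵥ x)) := dotProduct_sq_le _ _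
    _ ≤ (x ⬝ᵥ x) * (‖A‖ ^ 2 * (x ⬝ᵥ x)) :=
      mul_le_mul_of_nonneg_left (dotProduct_mulVec_self_le A x) (dotProduct_self_nonneg' x)
    _ = _ := by ring

/-- A symmetric matrix is bounded by the supremum of its quadratic form. -/
lemma norm_le_of_abs_dotProduct_mulVec_le (A : Matrix n n ℝ) (hA : A.IsSymm) {c : ℝ} (hc : 0 ≤ c)
    (h : ∀ x : n → ℝ, |x ⬝ᵥ (A *ᵥ x)| ≤ c * (x ⬝ᵥ x)) : ‖A‖ ≤ c := by
  -- Polarization: compare the form at x + y and at x - y.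
  have key : ∀ x y : n → ℝ, 2 * (y ⬝ᵥ (A *ᵥ x)) ≤ c * (x ⬝ᵥ x + y ⬝ᵥ y) := by
    intro x y
    have h1 := (abs_le.1 (h (x + y))).2
    have h2 := (abs_le.1 (h (x - y))).1
    have h3 : x ⬝ᵥ (A *ᵥ y) = y ⬝ᵥ (A *ᵥ x) := by
      rw [dotProduct_mulVec, ← mulVec_transpose, hA.eq, dotProduct_comm]
    have h4 : x ⬝ᵥ y = y ⬝ᵥ x := dotProduct_comm _ _
    simp only [mulVec_add, mulVec_sub, add_dotProduct, sub_dotProduct, dotProduct_add,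
      dotProduct_sub] at h1 h2
    nlinarith
  have h5 : ∀ x : n → ℝ, (A *ᵥ x) ⬝ᵥ (A *ᵥ x) ≤ c ^ 2 * (x ⬝ᵥ x) := by
    intro x
    rcases hc.eq_or_lt with rfl | hc'
    · have := key x (A *ᵥ x)
      simp at this ⊢
      linarith
    -- Scaling x by c makes the two terms on the right balance, so the bound has the sharp constant.
    · have := key (c • x) (A *ᵥ x)
      simp only [mulVec_smul, dotProduct_smul, smul_dotProduct, smul_eq_mul] at this
      have h7 : c * (A *ᵥ x ⬝ᵥ A *ᵥ x) ≤ c * (c ^ 2 * (x ⬝ᵥ x)) := by nlinarith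
      exact le_of_mul_le_mul_left h7 hc'
  exact le_of_sq_le_sq (norm_sq_le_of_dotProduct_mulVec_self_le A (sq_nonneg c) h5) hc

/-- Expanding the square gives a decrease 2a|Fu|² and an increase a²|FᵀFu|²; as a‖F‖² ≤ 1, the
latter costs at most half of the decrease. -/
lemma norm_sub_smul_mul_transpose_mulVec_le (F : Matrix m n ℝ) {a : ℝ} (ha : 0 ≤ a)
    (haF : a * ‖F‖ ^ 2 ≤ 1) (u : n → ℝ) :
    (u - a • (Fᵀ *ᵥ (F *ᵥ u))) ⬝ᵥ (u - a • (Fᵀ *ᵥ (F *ᵥ u))) ≤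
      u ⬝ᵥ u - a * ((F *ᵥ u) ⬝ᵥ (F *ᵥ u)) := by
  have h1 : u ⬝ᵥ (Fᵀ *ᵥ (F *ᵥ u)) = (F *ᵥ u) ⬝ᵥ (F *ᵥ u) := by
    rw [dotProduct_mulVec, vecMul_transpose]
  have h2 := dotProduct_mulVec_self_le Fᵀ (F *ᵥ u)
  rw [norm_transpose'] at h2
  simp only [sub_dotProduct, dotProduct_sub, dotProduct_smul, smul_dotProduct, smul_eq_mul,
    dotProduct_comm (Fᵀ *ᵥ (F *ᵥ u)) u, h1]
  have h3 := dotProduct_self_nonneg' (F *ᵥ u)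
  have h4 : a * (Fᵀ *ᵥ (F *ᵥ u) ⬝ᵥ Fᵀ *ᵥ (F *ᵥ u)) ≤ (F *ᵥ u) ⬝ᵥ (F *ᵥ u) := by
    calc _ ≤ a * (‖F‖ ^ 2 * (F *ᵥ u ⬝ᵥ F *ᵥ u)) := mul_le_mul_of_nonneg_left h2 ha
      _ = (a * ‖F‖ ^ 2) * (F *ᵥ u ⬝ᵥ F *ᵥ u) := by ring
      _ ≤ _ := by nlinarith
  nlinarith

end Norms

/-! ### The component orthogonal to the signal space -/

section Residual

/-- The map x ↦ x - (a/2) x² is increasing up to 1/a, so a Rayleigh quotient ξ may be replaced by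
its upper bound τ. -/
lemma scalar_orthogonal_step {a ξ τ N X b : ℝ} (ha : 0 ≤ a) (hξ : ξ ≤ τ)
    (haτ : a * τ ≤ 1) (hN : 0 < N) (hX : ξ ^ 2 * N ≤ X) :
    ξ * N - a / 2 * X + 3 * a * (b * N) ≤ (τ - a / 2 * τ ^ 2 + 3 * a * b) * N := by
  have h13 : ξ - a / 2 * ξ ^ 2 ≤ τ - a / 2 * τ ^ 2 := by
    have h1 : a * ξ ≤ a * τ := mul_le_mul_of_nonneg_left hξ ha
    nlinarith [mul_nonneg (sub_nonneg.2 hξ) (show 0 ≤ 2 - a * (τ + ξ) by linarith)]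
  have h14 := mul_le_mul_of_nonneg_right h13 hN.le
  have h15 := mul_le_mul_of_nonneg_left hX ha
  linarith

variable {m k : Type*} [Fintype m] [Fintype k] [DecidableEq m] [DecidableEq k]

/-- One step of the component orthogonal to the signal space. -/
lemma norm_sq_orthogonal_step_le (F : Matrix m k ℝ) (P E : Matrix m m ℝ) {a : ℝ} (ha : 0 ≤ a)
    (hP : Pᵀ = P) (hPP : P * P = P) (haF : a * ‖F‖ ^ 2 ≤ 1) :
    ‖P * F - a • (P * F * (Fᵀ * F)) - a • (P * E * F)‖ ^ 2 ≤
      ‖P * F‖ ^ 2 - a / 2 * (‖P * F‖ ^ 2) ^ 2 + 3 * a * ‖E‖ ^ 2 := by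
  have hPle : ‖P‖ ≤ 1 := by
    have := norm_transpose_mul_self P
    rw [hP, hPP] at this
    nlinarith [norm_nonneg P]
  set τ := ‖P * F‖ ^ 2 with hτ
  have hτF : τ ≤ ‖F‖ ^ 2 := by
    have : ‖P * F‖ ≤ 1 * ‖F‖ := norm_mul_le_of_le hPle le_rfl
    exact pow_le_pow_left₀ (norm_nonneg _) (by linarith) 2
  have haτ : a * τ ≤ 1 := (mul_le_mul_of_nonneg_left hτF ha).trans haF
  have hτ0 : 0 ≤ τ := sq_nonneg _
  have hE0 : 0 ≤ 3 * a * ‖E‖ ^ 2 := by positivity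
  rw [← norm_transpose']
  refine norm_sq_le_of_dotProduct_mulVec_self_le _ (by nlinarith) (fun y => ?_)
  have hTr : (P * F - a • (P * F * (Fᵀ * F)) - a • (P * E * F))ᵀ *ᵥ y =
      ((P * F)ᵀ *ᵥ y - a • (Fᵀ *ᵥ (F *ᵥ ((P * F)ᵀ *ᵥ y)))) - a • (Fᵀ *ᵥ (Eᵀ *ᵥ (P *ᵥ y))) := by
    simp only [transpose_sub, transpose_smul, transpose_mul, transpose_transpose, sub_mulVec,
      smul_mulVec, mulVec_mulVec, hP, Matrix.mul_assoc]
  rw [hTr]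
  set u := (P * F)ᵀ *ᵥ y with hu
  set e := Eᵀ *ᵥ (P *ᵥ y) with he
  set w := u - a • (Fᵀ *ᵥ (F *ᵥ u)) with hw
  have h1 : w ⬝ᵥ w ≤ u ⬝ᵥ u - a * ((F *ᵥ u) ⬝ᵥ (F *ᵥ u)) :=
    norm_sub_smul_mul_transpose_mulVec_le F ha haF u
  set X := (F *ᵥ u) ⬝ᵥ (F *ᵥ u) with hX
  have hX0 : 0 ≤ X := dotProduct_self_nonneg' _
  have he2 : e ⬝ᵥ e ≤ ‖E‖ ^ 2 * (y ⬝ᵥ y) := by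
    have h3 := dotProduct_mulVec_self_le Eᵀ (P *ᵥ y)
    have h4 := dotProduct_mulVec_self_le P y
    rw [norm_transpose'] at h3
    have h5 : ‖P‖ ^ 2 ≤ 1 := pow_le_one₀ (norm_nonneg _) hPle
    have h6 := dotProduct_self_nonneg' y
    have h7 : (P *ᵥ y) ⬝ᵥ (P *ᵥ y) ≤ y ⬝ᵥ y := h4.trans (by nlinarith)
    exact h3.trans (mul_le_mul_of_nonneg_left h7 (sq_nonneg _))
  have hcross : w ⬝ᵥ (Fᵀ *ᵥ e) = (F *ᵥ w) ⬝ᵥ e := by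
    rw [dotProduct_mulVec, vecMul_transpose]
  have hFw : F *ᵥ w = F *ᵥ u - a • (Fᵀᵀ *ᵥ (Fᵀ *ᵥ (F *ᵥ u))) := by
    rw [hw, mulVec_sub, mulVec_smul, transpose_transpose]
  have hFw2 : (F *ᵥ w) ⬝ᵥ (F *ᵥ w) ≤ X := by
    rw [hFw]
    have := norm_sub_smul_mul_transpose_mulVec_le Fᵀ ha (by rwa [norm_transpose']) (F *ᵥ u)
    have h9 := mul_nonneg ha (dotProduct_self_nonneg' (Fᵀ *ᵥ (F *ᵥ u)))
    linarith
  -- Young's inequality, weighted so that half of the gain a X survives; with the quadratic error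
  -- term below, the perturbation costs 2 + 1 = 3 times a|e|².
  have hcs : -(2 * ((F *ᵥ w) ⬝ᵥ e)) ≤ X / 2 + 2 * (e ⬝ᵥ e) := by
    have h8 := dotProduct_self_nonneg' (F *ᵥ w + (2 : ℝ) • e)
    simp only [add_dotProduct, dotProduct_add, dotProduct_smul, smul_dotProduct, smul_eq_mul,
      dotProduct_comm e (F *ᵥ w)] at h8
    linarith
  have hFe : a * ((Fᵀ *ᵥ e) ⬝ᵥ (Fᵀ *ᵥ e)) ≤ e ⬝ᵥ e := by
    have h3 := dotProduct_mulVec_self_le Fᵀ e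
    rw [norm_transpose'] at h3
    have h4 := dotProduct_self_nonneg' e
    calc _ ≤ a * (‖F‖ ^ 2 * (e ⬝ᵥ e)) := mul_le_mul_of_nonneg_left h3 ha
      _ = (a * ‖F‖ ^ 2) * (e ⬝ᵥ e) := by ring
      _ ≤ _ := by nlinarith
  have hexp : (w - a • (Fᵀ *ᵥ e)) ⬝ᵥ (w - a • (Fᵀ *ᵥ e)) =
      w ⬝ᵥ w - 2 * a * ((F *ᵥ w) ⬝ᵥ e) + a * (a * ((Fᵀ *ᵥ e) ⬝ᵥ (Fᵀ *ᵥ e))) := by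
    simp only [sub_dotProduct, dotProduct_sub, dotProduct_smul, smul_dotProduct, smul_eq_mul,
      dotProduct_comm (Fᵀ *ᵥ e) w, hcross]
    ring
  have hsum : (w - a • (Fᵀ *ᵥ e)) ⬝ᵥ (w - a • (Fᵀ *ᵥ e)) ≤
      u ⬝ᵥ u - a / 2 * X + 3 * a * (‖E‖ ^ 2 * (y ⬝ᵥ y)) := by
    rw [hexp]
    have := mul_le_mul_of_nonneg_left hcs ha
    have := mul_le_mul_of_nonneg_left hFe ha
    have := mul_le_mul_of_nonneg_left he2 ha
    nlinarith
  refine hsum.trans ?_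
  have hy0 := dotProduct_self_nonneg' y
  have hu0 := dotProduct_self_nonneg' u
  have huτ : u ⬝ᵥ u ≤ τ * (y ⬝ᵥ y) := by
    have := dotProduct_mulVec_self_le (P * F)ᵀ y
    rwa [norm_transpose'] at this
  -- Since u = (P F)ᵀ y, one has |u|² = y · (P F u). Cauchy–Schwarz then turns the gain in |F u|²
  -- into a gain quadratic in the Rayleigh quotient.
  have hyu : (u ⬝ᵥ u) ^ 2 ≤ (y ⬝ᵥ y) * X := by
    have h3 : u ⬝ᵥ u = y ⬝ᵥ ((P * F) *ᵥ u) := by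
      conv_rhs => rw [dotProduct_mulVec, ← mulVec_transpose]
    have h4 := dotProduct_sq_le y ((P * F) *ᵥ u)
    have h5 := dotProduct_mulVec_self_le P (F *ᵥ u)
    rw [mulVec_mulVec] at h5
    have h6 : ‖P‖ ^ 2 ≤ 1 := pow_le_one₀ (norm_nonneg _) hPle
    have h7 : ((P * F) *ᵥ u) ⬝ᵥ ((P * F) *ᵥ u) ≤ X := h5.trans (by nlinarith)
    rw [h3]
    exact h4.trans (mul_le_mul_of_nonneg_left h7 hy0)
  rcases hy0.eq_or_lt with h0 | hpos
  · rw [← h0] at huτ hyu ⊢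
    have : u ⬝ᵥ u = 0 := by nlinarith
    rw [this]
    nlinarith [mul_nonneg ha hX0]
  · set N := y ⬝ᵥ y
    set v := u ⬝ᵥ u
    have h10 : v ^ 2 / N ≤ X := by rw [div_le_iff₀ hpos]; linarith
    obtain ⟨ξ, hξ⟩ : ∃ ξ, ξ = v / N := ⟨_, rfl⟩
    have hv : v = ξ * N := by rw [hξ]; field_simp
    have h11 : ξ ≤ τ := by rw [hξ, div_le_iff₀ hpos]; linarith
    have h12 : ξ ^ 2 * N ≤ X := by
      have : v ^ 2 / N = ξ ^ 2 * N := by rw [hv]; field_simp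
      linarith
    rw [hv]
    exact scalar_orthogonal_step ha h11 haτ hpos h12

end Residual

/-! ### The whitened signal part and its inverse -/

section Signal
variable {ι : Type*} [Fintype ι] [DecidableEq ι]

/-- The anticommutator step `Z - a (D Z + Z D)` is a contraction. -/
lemma norm_sub_anticommutator_le {D Z : Matrix ι ι ℝ} {a μ : ℝ} (ha : 0 ≤ a) (ha2 : 2 * a ≤ 1)
    (hD : ‖1 - D‖ ≤ 1 - μ) :
    ‖Z - a • D * Z - Z * a • D‖ ≤ (1 - 2 * a * μ) * ‖Z‖ := by
  -- The coefficients 1 - 2a, a, a are nonnegative with sum 1, and each factor 1 - D saves μ.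
  have h : Z - a • D * Z - Z * a • D =
      (1 - 2 * a) • Z + a • ((1 - D) * Z) + a • (Z * (1 - D)) := by
    simp only [sub_mul, mul_sub, one_mul, mul_one, smul_mul_assoc, mul_smul_comm]
    module
  have h1 : ‖(1 - D) * Z‖ ≤ (1 - μ) * ‖Z‖ := norm_mul_le_of_le hD le_rfl
  have h2 : ‖Z * (1 - D)‖ ≤ ‖Z‖ * (1 - μ) := norm_mul_le_of_le le_rfl hD
  rw [h]
  refine (norm_add₃_le).trans ?_
  rw [norm_smul, norm_smul, norm_smul, Real.norm_of_nonneg ha, Real.norm_of_nonneg (by linarith)]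
  nlinarith [mul_le_mul_of_nonneg_left h1 ha, mul_le_mul_of_nonneg_left h2 ha]

lemma dotProduct_congr_mulVec {m : Type*} [Fintype m] (B : Matrix ι m ℝ) (J : Matrix m m ℝ)
    (x : ι → ℝ) : x ⬝ᵥ ((B * J * Bᵀ) *ᵥ x) = (Bᵀ *ᵥ x) ⬝ᵥ (J *ᵥ (Bᵀ *ᵥ x)) := by
  rw [← mulVec_mulVec, ← mulVec_mulVec, dotProduct_mulVec x B, ← mulVec_transpose]

/-- One step of the upper bound on the whitened signal part. -/
lemma norm_congr_sub_one_le {D Dh Y : Matrix ι ι ℝ} {a μ : ℝ} (ha : 0 ≤ a) (ha2 : 2 * a ≤ 1)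
    (hD : ‖1 - D‖ ≤ 1 - μ) (hDh : Dhᵀ = Dh) (hDD : D = Dh * Dh) (hDh1 : ‖Dh‖ ≤ 1)
    (hY : Yᵀ = Y) (hJ : ∀ x : ι → ℝ, 0 ≤ x ⬝ᵥ ((1 + Y) *ᵥ x)) (haY : a * (1 + ‖Y‖) ≤ 2) :
    ‖(1 - Y * a • D) * (1 + Y) * (1 - Y * a • D)ᵀ - 1‖ ≤ max 1 ((1 - 2 * a * μ) * ‖Y‖) := by
  have hDt : Dᵀ = D := by rw [hDD, transpose_mul, hDh]
  have hsymm : ((1 - Y * a • D) * (1 + Y) * (1 - Y * a • D)ᵀ - 1).IsSymm := by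
    simp only [IsSymm, transpose_sub, transpose_mul, transpose_transpose, transpose_one,
      transpose_add, hY, Matrix.mul_assoc]
  refine norm_le_of_abs_dotProduct_mulVec_le _ hsymm (by positivity) (fun x => ?_)
  have hx := dotProduct_self_nonneg' x
  rw [abs_le]
  constructor
  · rw [sub_mulVec, dotProduct_sub, one_mulVec, dotProduct_congr_mulVec]
    -- A congruence keeps 1 + Y positive semidefinite; this is the source of the 1 in the maximum.
    have h1 := hJ ((1 - Y * a • D)ᵀ *ᵥ x)
    have h2 := mul_le_mul_of_nonneg_right (le_max_left 1 ((1 - 2 * a * μ) * ‖Y‖)) hx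
    linarith
  · set K := a • D with hK
    have hKt : Kᵀ = K := by rw [hK, transpose_smul, hDt]
    -- The subtracted term is positive semidefinite because a (1 + ‖Y‖) ≤ 2, so the upper bound sees
    -- only the anticommutator step and no error quadratic in Y.
    have hid : (1 - Y * K) * (1 + Y) * (1 - Y * K)ᵀ - 1 =
        (Y - K * Y - Y * K) - Y * (2 • K - K * K - K * Y * K) * Yᵀ := by
      rw [transpose_sub, transpose_mul, transpose_one, hKt, hY]
      noncomm_ring
    rw [hid, sub_mulVec, dotProduct_sub, dotProduct_congr_mulVec]
    have h1 := (abs_le.1 (abs_dotProduct_mulVec_le (Y - K * Y - Y * K) x)).2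
    have h2 := mul_le_mul_of_nonneg_right
      (norm_sub_anticommutator_le (Z := Y) ha ha2 hD) hx
    have h3 := mul_le_mul_of_nonneg_right (le_max_right 1 ((1 - 2 * a * μ) * ‖Y‖)) hx
    set v := Yᵀ *ᵥ x
    have h4 : 0 ≤ v ⬝ᵥ ((2 • K - K * K - K * Y * K) *ᵥ v) := by
      have e1 : v ⬝ᵥ (K *ᵥ v) = a * ((Dh *ᵥ v) ⬝ᵥ (Dh *ᵥ v)) := by
        rw [hK, hDD, smul_mulVec, dotProduct_smul, smul_eq_mul, ← mulVec_mulVec,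
          dotProduct_mulVec v Dh, ← mulVec_transpose, hDh]
      have e2 : v ⬝ᵥ ((K * K) *ᵥ v) = (K *ᵥ v) ⬝ᵥ (K *ᵥ v) := by
        rw [← mulVec_mulVec, dotProduct_mulVec v K, ← mulVec_transpose, hKt]
      have e3 : v ⬝ᵥ ((K * Y * K) *ᵥ v) = (K *ᵥ v) ⬝ᵥ (Y *ᵥ (K *ᵥ v)) := by
        have := dotProduct_congr_mulVec K Y v
        rwa [hKt] at this
      have e4 := (abs_le.1 (abs_dotProduct_mulVec_le Y (K *ᵥ v))).2
      have e5 : (K *ᵥ v) ⬝ᵥ (K *ᵥ v) ≤ a ^ 2 * ((Dh *ᵥ v) ⬝ᵥ (Dh *ᵥ v)) := by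
        have := dotProduct_mulVec_self_le Dh (Dh *ᵥ v)
        have h8 : ‖Dh‖ ^ 2 ≤ 1 := pow_le_one₀ (norm_nonneg _) hDh1
        have h9 := dotProduct_self_nonneg' (Dh *ᵥ v)
        have h10 : (K *ᵥ v) = a • (Dh *ᵥ (Dh *ᵥ v)) := by
          rw [hK, hDD, smul_mulVec, ← mulVec_mulVec]
        rw [h10, smul_dotProduct, dotProduct_smul, smul_eq_mul, smul_eq_mul, ← mul_assoc, ← sq]
        exact mul_le_mul_of_nonneg_left (by nlinarith) (sq_nonneg a)
      have h9 := dotProduct_self_nonneg' (Dh *ᵥ v)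
      rw [sub_mulVec, sub_mulVec, dotProduct_sub, dotProduct_sub, e2, e3, smul_mulVec,
        dotProduct_smul, e1, nsmul_eq_mul]
      push_cast
      have e6 : (1 + ‖Y‖) * ((K *ᵥ v) ⬝ᵥ (K *ᵥ v)) ≤
          (1 + ‖Y‖) * (a ^ 2 * ((Dh *ᵥ v) ⬝ᵥ (Dh *ᵥ v))) :=
        mul_le_mul_of_nonneg_left e5 (by positivity)
      have e7 : (a * (1 + ‖Y‖)) * (a * ((Dh *ᵥ v) ⬝ᵥ (Dh *ᵥ v))) ≤
          2 * (a * ((Dh *ᵥ v) ⬝ᵥ (Dh *ᵥ v))) :=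
        mul_le_mul_of_nonneg_right haY (by positivity)
      nlinarith
    linarith

lemma exists_inverse_one_sub {M : Matrix ι ι ℝ} {q : ℝ} (hM : ‖M‖ ≤ q) (hq : q < 1) :
    ∃ A : Matrix ι ι ℝ, A * (1 - M) = 1 ∧ (1 - M) * A = 1 ∧ ‖A‖ ≤ 1 / (1 - q) := by
  have : CompleteSpace (Matrix ι ι ℝ) := FiniteDimensional.complete ℝ _
  obtain ⟨u, hu⟩ := isUnit_one_sub_of_norm_lt_one (hM.trans_lt hq)
  refine ⟨((u⁻¹ : (Matrix ι ι ℝ)ˣ) : Matrix ι ι ℝ), by rw [← hu, Units.inv_mul], by rw [← hu, Units.mul_inv], ?_⟩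
  set A : Matrix ι ι ℝ := ((u⁻¹ : (Matrix ι ι ℝ)ˣ) : Matrix ι ι ℝ)
  have h1 : (1 - M) * A = 1 := by rw [← hu, Units.mul_inv]
  have h2 : A = 1 + M * A := by
    rw [sub_mul, one_mul] at h1
    rw [← h1, sub_add_cancel]
  have h3 : ‖A‖ ≤ 1 + q * ‖A‖ := by
    calc ‖A‖ = ‖1 + M * A‖ := congrArg _ h2
      _ ≤ ‖(1 : Matrix ι ι ℝ)‖ + ‖M * A‖ := norm_add_le _ _
      _ ≤ _ := add_le_add norm_one_le (norm_mul_le_of_le hM le_rfl)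
  rw [le_div_iff₀ (by linarith)]
  linarith

/-- One step of the inverse of the whitened signal part. -/
lemma exists_inverse_congr {D Y V : Matrix ι ι ℝ} {a μ q : ℝ} (ha : 0 ≤ a) (ha2 : 2 * a ≤ 1)
    (hD : ‖1 - D‖ ≤ 1 - μ) (hDt : Dᵀ = D) (hD1 : ‖D‖ ≤ 1) (hY : Yᵀ = Y)
    (hVJ : V * (1 + Y) = 1) (hJV : (1 + Y) * V = 1) (haY : a * ‖Y‖ ≤ q) (hq : q < 1) :
    ∃ V' : Matrix ι ι ℝ, V' * ((1 - Y * a • D) * (1 + Y) * (1 - Y * a • D)ᵀ) = 1 ∧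
      ((1 - Y * a • D) * (1 + Y) * (1 - Y * a • D)ᵀ) * V' = 1 ∧
      ‖V' - 1‖ ≤ (1 - 2 * a * μ + a ^ 2 * ‖Y‖ * (2 * (1 / (1 - q)) + (1 / (1 - q)) ^ 2)) *
        ‖V - 1‖ := by
  set K := a • D with hK
  have hKt : Kᵀ = K := by rw [hK, transpose_smul, hDt]
  have hKn : ‖K‖ ≤ a := by
    rw [hK, norm_smul, Real.norm_of_nonneg ha]
    exact mul_le_of_le_one_right ha hD1
  have hKY : ‖K * Y‖ ≤ q := (norm_mul_le_of_le hKn le_rfl).trans haY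
  obtain ⟨A, hA1, hA2, hAn⟩ := exists_inverse_one_sub hKY hq
  have hBt : (1 - Y * K)ᵀ = 1 - K * Y := by
    rw [transpose_sub, transpose_mul, transpose_one, hKt, hY]
  have hAt1 : Aᵀ * (1 - Y * K) = 1 := by
    have := congrArg transpose hA2
    rwa [transpose_mul, ← hBt, transpose_transpose, transpose_one] at this
  have hAt2 : (1 - Y * K) * Aᵀ = 1 := by
    have := congrArg transpose hA1
    rwa [transpose_mul, ← hBt, transpose_transpose, transpose_one] at this
  rw [hBt]
  refine ⟨A * V * Aᵀ, ?_, ?_, ?_⟩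
  · calc A * V * Aᵀ * ((1 - Y * K) * (1 + Y) * (1 - K * Y))
        = A * V * (Aᵀ * (1 - Y * K)) * (1 + Y) * (1 - K * Y) := by noncomm_ring
      _ = A * (V * (1 + Y)) * (1 - K * Y) := by rw [hAt1, mul_one, mul_assoc A]
      _ = 1 := by rw [hVJ, mul_one, hA1]
  · calc (1 - Y * K) * (1 + Y) * (1 - K * Y) * (A * V * Aᵀ)
        = (1 - Y * K) * (1 + Y) * ((1 - K * Y) * A) * V * Aᵀ := by noncomm_ring
      _ = (1 - Y * K) * ((1 + Y) * V) * Aᵀ := by rw [hA2, mul_one, mul_assoc (1 - Y * K)]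
      _ = 1 := by rw [hJV, mul_one, hAt2]
  · have hA : A = 1 + A * (K * Y) := by
      rw [mul_sub, mul_one] at hA1
      rw [← hA1, sub_add_cancel]
    have hAt : Aᵀ = 1 + Y * K * Aᵀ := by
      rw [sub_mul, one_mul] at hAt2
      rw [← hAt2, sub_add_cancel]
    set Z := V - 1 with hZ
    -- The relations Y V = V Y = -Z trade Y for Z, which makes every error term proportional to Z.
    have hYV : Y * V = -Z := by
      rw [add_mul, one_mul] at hJV
      rw [hZ, ← hJV]; abel
    have hVY : V * Y = -Z := by
      rw [mul_add, mul_one] at hVJ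
      rw [hZ, ← hVJ]; abel
    have hAV : A * V = V - A * K * Z := by
      calc A * V = (1 + A * (K * Y)) * V := by rw [← hA]
        _ = V + A * K * (Y * V) := by noncomm_ring
        _ = _ := by rw [hYV]; noncomm_ring
    have hAtm : ∀ W : Matrix ι ι ℝ, W * Aᵀ = W + W * Y * K * Aᵀ := by
      intro W
      calc W * Aᵀ = W * (1 + Y * K * Aᵀ) := by rw [← hAt]
        _ = _ := by noncomm_ring
    have hAm : ∀ W : Matrix ι ι ℝ, A * W = W + A * K * Y * W := by
      intro W
      calc A * W = (1 + A * (K * Y)) * W := by rw [← hA]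
        _ = _ := by noncomm_ring
    -- Beyond first order, each term carries two factors K, one Y and one Z, hence has size a² ‖Y‖
    -- ‖Z‖.
    have hid : A * V * Aᵀ - 1 = (Z - K * Z - Z * K) - A * K * Y * (K * Z)
        - Z * K * Y * K * Aᵀ - A * K * (Z * Y * K * Aᵀ) := by
      have h1 : A * V * Aᵀ = V * Aᵀ - A * K * (Z * Aᵀ) := by rw [hAV]; noncomm_ring
      have h2 : V * Aᵀ = V - Z * K * Aᵀ := by
        rw [hAtm V, hVY]; noncomm_ring
      have h3 : A * K * (Z * Aᵀ) = A * (K * Z) + A * K * (Z * Y * K * Aᵀ) := by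
        rw [hAtm Z]; noncomm_ring
      rw [h1, h2, h3, hAm (K * Z), hAtm (Z * K)]
      have : V = Z + 1 := by rw [hZ]; abel
      rw [this]; abel
    set α := 1 / (1 - q) with hα
    have hα0 : 0 ≤ α := (norm_nonneg _).trans hAn
    have hAtn : ‖Aᵀ‖ ≤ α := by rw [norm_transpose']; exact hAn
    have n1 : ‖Z - K * Z - Z * K‖ ≤ (1 - 2 * a * μ) * ‖Z‖ :=
      norm_sub_anticommutator_le ha ha2 hD
    have n2 : ‖A * K * Y * (K * Z)‖ ≤ α * a * ‖Y‖ * (a * ‖Z‖) :=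
      norm_mul_le_of_le (norm_mul_le_of_le (norm_mul_le_of_le hAn hKn) le_rfl)
        (norm_mul_le_of_le hKn le_rfl)
    have n3 : ‖Z * K * Y * K * Aᵀ‖ ≤ ‖Z‖ * a * ‖Y‖ * a * α :=
      norm_mul_le_of_le (norm_mul_le_of_le (norm_mul_le_of_le (norm_mul_le_of_le le_rfl hKn)
        le_rfl) hKn) hAtn
    have n4 : ‖A * K * (Z * Y * K * Aᵀ)‖ ≤ α * a * (‖Z‖ * ‖Y‖ * a * α) :=
      norm_mul_le_of_le (norm_mul_le_of_le hAn hKn)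
        (norm_mul_le_of_le (norm_mul_le_of_le (norm_mul_le_of_le le_rfl le_rfl) hKn) hAtn)
    rw [hid]
    refine (norm_sub_le _ _).trans ?_
    refine (add_le_add_left (norm_sub_le _ _) _).trans ?_
    refine (add_le_add_left (add_le_add_left (norm_sub_le _ _) _) _).trans ?_
    linarith

/-- The new inverse is V' = (1 + V Ω)⁻¹ V, of norm at most 2‖V‖, and the resolvent identity V' - V =
-V' Ω V gives the quadratic bound. -/
lemma exists_inverse_add {M V Ω : Matrix ι ι ℝ} (hVM : V * M = 1) (hMV : M * V = 1)
    (hΩ : ‖Ω‖ * ‖V‖ ≤ 1 / 2) :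
    ∃ V' : Matrix ι ι ℝ, V' * (M + Ω) = 1 ∧ (M + Ω) * V' = 1 ∧
      ‖V' - V‖ ≤ 2 * ‖Ω‖ * ‖V‖ ^ 2 := by
  have hn : ‖-(V * Ω)‖ ≤ 1 / 2 := by
    rw [norm_neg]
    exact (norm_mul_le_of_le le_rfl le_rfl).trans (by linarith)
  obtain ⟨A, hA1, hA2, hAn⟩ := exists_inverse_one_sub hn (by norm_num)
  rw [sub_neg_eq_add] at hA1 hA2
  have hAn' : ‖A‖ ≤ 2 := by norm_num at hAn; exact hAn
  have h1 : A * V * (M + Ω) = 1 := by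
    calc A * V * (M + Ω) = A * (V * M + V * Ω) := by noncomm_ring
      _ = 1 := by rw [hVM, hA1]
  have hMO : M + Ω = M * (1 + V * Ω) := by
    rw [mul_add, ← mul_assoc, hMV, mul_one, one_mul]
  refine ⟨A * V, h1, ?_, ?_⟩
  · rw [hMO]
    calc M * (1 + V * Ω) * (A * V) = M * ((1 + V * Ω) * A) * V := by noncomm_ring
      _ = 1 := by rw [hA2, mul_one, hMV]
  · have h2 : A * V - V = -(A * V * Ω * V) := by
      have : A * V + A * V * Ω * V = V := by
        calc A * V + A * V * Ω * V = A * (1 + V * Ω) * V := by noncomm_ring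
          _ = V := by rw [hA1, one_mul]
      exact eq_neg_of_add_eq_zero_left (by
        rw [sub_add_eq_add_sub, this, sub_self])
    rw [h2, norm_neg]
    have : ‖A * V * Ω * V‖ ≤ 2 * ‖V‖ * ‖Ω‖ * ‖V‖ :=
      norm_mul_le_of_le (norm_mul_le_of_le (norm_mul_le_of_le hAn' le_rfl) le_rfl) le_rfl
    linarith

end Signal

/-! ### Gradient steps in a spectral frame -/

section Frame
variable {m ι k : Type*} [Fintype m] [Fintype ι] [Fintype k]
  [DecidableEq m] [DecidableEq ι] [DecidableEq k]

/-- A spectral frame of `X`: `X = U Dh² Uᵀ` with orthonormal columns `U`, where the eigenvalues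
`Dh²` lie in `[μ, 1]` and `Di` is the inverse of `Dh`. -/
structure SpectralFrame (X : Matrix m m ℝ) (U : Matrix m ι ℝ) (Dh Di : Matrix ι ι ℝ) (μ : ℝ) :
    Prop where
  μ_pos : 0 < μ
  μ_le : μ ≤ 1
  orth : Uᵀ * U = 1
  eq : X = U * (Dh * Dh) * Uᵀ
  Dh_symm : Dhᵀ = Dh
  Di_symm : Diᵀ = Di
  mul_inv : Dh * Di = 1
  inv_mul : Di * Dh = 1
  norm_Dh : ‖Dh‖ ≤ 1
  norm_Di : ‖Di‖ ≤ 1 / μ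
  norm_one_sub : ‖1 - Dh * Dh‖ ≤ 1 - μ

namespace SpectralFrame
variable {X : Matrix m m ℝ} {U : Matrix m ι ℝ} {Dh Di : Matrix ι ι ℝ} {μ : ℝ}
  (h : SpectralFrame X U Dh Di μ)
include h

lemma D_symm : (Dh * Dh)ᵀ = Dh * Dh := by rw [transpose_mul, h.Dh_symm]

lemma norm_D : ‖Dh * Dh‖ ≤ 1 := by
  have : ‖Dh * Dh‖ ≤ 1 * 1 := norm_mul_le_of_le h.norm_Dh h.norm_Dh
  linarith

lemma norm_U : ‖U‖ ≤ 1 := by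
  have h1 := norm_transpose_mul_self U
  rw [h.orth] at h1
  have h2 := norm_one_le (n := ι)
  nlinarith [norm_nonneg U]

lemma norm_Ut : ‖Uᵀ‖ ≤ 1 := by rw [norm_transpose']; exact h.norm_U

lemma X_symm : Xᵀ = X := by
  rw [h.eq]
  simp only [transpose_mul, transpose_transpose, h.Dh_symm, Matrix.mul_assoc]

lemma Ut_mul_X : Uᵀ * X = Dh * Dh * Uᵀ := by
  rw [h.eq, ← Matrix.mul_assoc, ← Matrix.mul_assoc, h.orth, Matrix.one_mul]

lemma proj_symm : (1 - U * Uᵀ)ᵀ = 1 - U * Uᵀ := by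
  simp [transpose_sub, transpose_mul]

lemma proj_mul_U : (1 - U * Uᵀ) * U = 0 := by
  rw [Matrix.sub_mul, Matrix.mul_assoc, h.orth, Matrix.one_mul, Matrix.mul_one, sub_self]

lemma Ut_mul_proj : Uᵀ * (1 - U * Uᵀ) = 0 := by
  rw [Matrix.mul_sub, ← Matrix.mul_assoc, h.orth, Matrix.one_mul, Matrix.mul_one, sub_self]

lemma proj_idem : (1 - U * Uᵀ) * (1 - U * Uᵀ) = 1 - U * Uᵀ := by
  conv_lhs => rw [Matrix.mul_sub, Matrix.mul_one, ← Matrix.mul_assoc, h.proj_mul_U, Matrix.zero_mul,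
    sub_zero]

lemma proj_mul_X : (1 - U * Uᵀ) * X = 0 := by
  rw [h.eq, ← Matrix.mul_assoc, ← Matrix.mul_assoc, h.proj_mul_U, Matrix.zero_mul, Matrix.zero_mul]

lemma norm_proj : ‖1 - U * Uᵀ‖ ≤ 1 := by
  have := norm_transpose_mul_self (1 - U * Uᵀ)
  rw [h.proj_symm, h.proj_idem] at this
  nlinarith [norm_nonneg (1 - U * Uᵀ)]

lemma norm_X : ‖X‖ ≤ 1 := by
  rw [h.eq]
  have : ‖U * (Dh * Dh) * Uᵀ‖ ≤ 1 * 1 * 1 :=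
    norm_mul_le_of_le (norm_mul_le_of_le h.norm_U h.norm_D) h.norm_Ut
  linarith

lemma norm_one_sub_X : ‖1 - X‖ ≤ 1 := by
  refine norm_le_of_abs_dotProduct_mulVec_le _ ?_ zero_le_one (fun x => ?_)
  · simp [IsSymm, transpose_sub, h.X_symm]
  · have e : x ⬝ᵥ (X *ᵥ x) = (Dh *ᵥ (Uᵀ *ᵥ x)) ⬝ᵥ (Dh *ᵥ (Uᵀ *ᵥ x)) := by
      rw [h.eq, dotProduct_congr_mulVec, ← mulVec_mulVec, dotProduct_mulVec _ Dh,
        ← mulVec_transpose, h.Dh_symm]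
    have h1 := dotProduct_mulVec_self_le Dh (Uᵀ *ᵥ x)
    have h2 := dotProduct_mulVec_self_le Uᵀ x
    have h3 : ‖Dh‖ ^ 2 ≤ 1 := pow_le_one₀ (norm_nonneg _) h.norm_Dh
    have h4 : ‖Uᵀ‖ ^ 2 ≤ 1 := pow_le_one₀ (norm_nonneg _) h.norm_Ut
    have h5 := dotProduct_self_nonneg' x
    have h6 := dotProduct_self_nonneg' (Uᵀ *ᵥ x)
    have h7 := dotProduct_self_nonneg' (Dh *ᵥ (Uᵀ *ᵥ x))
    rw [sub_mulVec, dotProduct_sub, one_mulVec, e, abs_le]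
    constructor <;> nlinarith

/-- The step of `Uᵀ R` for an exact gradient step, written in terms of `Uᵀ R`. -/
lemma Ut_mul_step {M : Matrix m m ℝ} (a : ℝ) :
    Uᵀ * ((1 - a • (M - X)) * M * (1 - a • (M - X)) - X) =
      (1 - 2 * a) • (Uᵀ * (M - X)) + a • (Uᵀ * (M - X) * (1 - X)) +
        a • ((1 - Dh * Dh) * (Uᵀ * (M - X))) - (2 * a) • (Uᵀ * (M - X) * (M - X)) +
        a ^ 2 • (Uᵀ * (M - X) * M * (M - X)) := by
  have hX : ∀ W : Matrix m m ℝ, Uᵀ * (X * W) = Dh * (Dh * (Uᵀ * W)) := by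
    intro W
    rw [← Matrix.mul_assoc, h.Ut_mul_X]; simp only [Matrix.mul_assoc]
  have hX' : Uᵀ * X = Dh * (Dh * Uᵀ) := by rw [h.Ut_mul_X, Matrix.mul_assoc]
  simp only [Matrix.mul_sub, Matrix.sub_mul, Matrix.smul_mul, Matrix.mul_smul, Matrix.mul_one,
    Matrix.one_mul, Matrix.mul_assoc, smul_sub, hX, hX', smul_smul]
  module

end SpectralFrame

/-- The effect of an additive error in one gradient step on `F Fᵀ`. -/
lemma step_mul_transpose (F : Matrix m k ℝ) (R E : Matrix m m ℝ) (hR : Rᵀ = R) (a : ℝ) :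
    (F - a • ((R + E) * F)) * (F - a • ((R + E) * F))ᵀ =
      (1 - a • R) * (F * Fᵀ) * (1 - a • R) + (-(a • E * (F * Fᵀ) * (1 - a • R)) -
        (1 - a • R) * (F * Fᵀ) * (a • E)ᵀ + a • E * (F * Fᵀ) * (a • E)ᵀ) := by
  simp only [Matrix.mul_sub, Matrix.sub_mul, Matrix.smul_mul, Matrix.mul_smul, Matrix.mul_one,
    Matrix.one_mul, Matrix.mul_assoc, smul_sub, smul_smul, transpose_sub, transpose_smul,
    transpose_mul, transpose_add, hR, Matrix.add_mul, Matrix.mul_add, smul_add]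
  module

lemma residual_symm {X : Matrix m m ℝ} (hX : Xᵀ = X) (F : Matrix m k ℝ) :
    (F * Fᵀ - X)ᵀ = F * Fᵀ - X := by
  rw [transpose_sub, transpose_mul, transpose_transpose, hX]

namespace SpectralFrame
variable {X : Matrix m m ℝ} {U : Matrix m ι ℝ} {Dh Di : Matrix ι ι ℝ} {μ : ℝ}
  (h : SpectralFrame X U Dh Di μ)
include h

lemma norm_Ut_mul_le (W : Matrix m k ℝ) : ‖Uᵀ * W‖ ≤ ‖W‖ := by
  have : ‖Uᵀ * W‖ ≤ 1 * ‖W‖ := norm_mul_le_of_le h.norm_Ut le_rfl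
  linarith

/-- Contraction of `Uᵀ R` near the ground truth. -/
lemma norm_Ut_mul_residual_step_le (F : Matrix m k ℝ) (E : Matrix m m ℝ) {a : ℝ} (ha : 0 ≤ a)
    (ha2 : a ≤ 1 / 100) (hR : ‖F * Fᵀ - X‖ ≤ μ / 10) (hE : ‖E‖ ≤ 1) :
    ‖Uᵀ * ((F - a • ((F * Fᵀ - X + E) * F)) * (F - a • ((F * Fᵀ - X + E) * F))ᵀ - X)‖ ≤
      (1 - 7 / 10 * a * μ) * ‖Uᵀ * (F * Fᵀ - X)‖ + 6 * a * ‖E‖ := by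
  have hμ := h.μ_pos
  have hμ1 := h.μ_le
  rw [step_mul_transpose F _ E (residual_symm h.X_symm F)]
  set M := F * Fᵀ with hM
  rw [add_sub_right_comm, Matrix.mul_add, h.Ut_mul_step]
  set R := M - X with hRdef
  set Q := Uᵀ * R with hQ
  have hMn : ‖M‖ ≤ 11 / 10 := by
    have : M = R + X := by rw [hRdef]; abel
    rw [this]
    refine (norm_add_le _ _).trans ?_
    linarith [h.norm_X]
  have hW : ‖1 - a • R‖ ≤ 11 / 10 := by
    refine (norm_sub_le _ _).trans ?_
    rw [norm_smul, Real.norm_of_nonneg ha]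
    nlinarith [norm_one_le (n := m), norm_nonneg R]
  have hq := norm_nonneg Q
  have n1 : ‖(1 - 2 * a) • Q‖ = (1 - 2 * a) * ‖Q‖ := by
    rw [norm_smul, Real.norm_of_nonneg (by linarith)]
  have n2 : ‖a • (Q * (1 - X))‖ ≤ a * (‖Q‖ * 1) := by
    rw [norm_smul, Real.norm_of_nonneg ha]
    exact mul_le_mul_of_nonneg_left (norm_mul_le_of_le le_rfl h.norm_one_sub_X) ha
  have n3 : ‖a • ((1 - Dh * Dh) * Q)‖ ≤ a * ((1 - μ) * ‖Q‖) := by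
    rw [norm_smul, Real.norm_of_nonneg ha]
    exact mul_le_mul_of_nonneg_left (norm_mul_le_of_le h.norm_one_sub le_rfl) ha
  have n4 : ‖(2 * a) • (Q * R)‖ ≤ 2 * a * (‖Q‖ * (μ / 10)) := by
    rw [norm_smul, Real.norm_of_nonneg (by linarith)]
    exact mul_le_mul_of_nonneg_left (norm_mul_le_of_le le_rfl hR) (by linarith)
  have n5 : ‖a ^ 2 • (Q * M * R)‖ ≤ a ^ 2 * (‖Q‖ * (11 / 10) * (μ / 10)) := by
    rw [norm_smul, Real.norm_of_nonneg (sq_nonneg a)]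
    exact mul_le_mul_of_nonneg_left
      (norm_mul_le_of_le (norm_mul_le_of_le le_rfl hMn) hR) (sq_nonneg a)
  have hEa : ‖a • E‖ ≤ a * ‖E‖ := by rw [norm_smul, Real.norm_of_nonneg ha]
  have hEa' : ‖(a • E)ᵀ‖ ≤ a * ‖E‖ := by rw [norm_transpose']; exact hEa
  have n6 : ‖-(a • E * M * (1 - a • R)) - (1 - a • R) * M * (a • E)ᵀ + a • E * M * (a • E)ᵀ‖ ≤
      a * ‖E‖ * (11 / 10) * (11 / 10) + 11 / 10 * (11 / 10) * (a * ‖E‖) +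
        a * ‖E‖ * (11 / 10) * (a * ‖E‖) := by
    refine (norm_add_le _ _).trans (add_le_add ((norm_sub_le _ _).trans (add_le_add ?_ ?_)) ?_)
    · rw [norm_neg]
      exact norm_mul_le_of_le (norm_mul_le_of_le hEa hMn) hW
    · exact norm_mul_le_of_le (norm_mul_le_of_le hW hMn) hEa'
    · exact norm_mul_le_of_le (norm_mul_le_of_le hEa hMn) hEa'
  have n7 := (h.norm_Ut_mul_le (-(a • E * M * (1 - a • R)) - (1 - a • R) * M * (a • E)ᵀ +
    a • E * M * (a • E)ᵀ)).trans n6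
  have hE0 := norm_nonneg E
  have b1 : a ^ 2 * (‖Q‖ * (11 / 10) * (μ / 10)) ≤ 1 / 100 * (a * (μ * ‖Q‖)) := by
    have : 0 ≤ a * (μ * ‖Q‖) := by positivity
    nlinarith [mul_le_mul_of_nonneg_right ha2 this]
  have b2 : a * ‖E‖ * (11 / 10) * (a * ‖E‖) ≤ a * ‖E‖ := by
    have h0 : 0 ≤ a * ‖E‖ := by positivity
    have h1 : a * ‖E‖ ≤ 1 / 100 := by nlinarith
    nlinarith
  have b3 : 0 ≤ a * ‖E‖ := by positivity
  have b4 : 0 ≤ a * (μ * ‖Q‖) := by positivity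
  -- The first-order terms add up to 1 - aμ. The terms of second order in R cost about aμ/5 of this,
  -- which leaves room for the factor 7/10.
  refine (norm_add_le _ _).trans ?_
  refine (add_le_add ((norm_add_le _ _).trans (add_le_add ((norm_sub_le _ _).trans
    (add_le_add norm_add₃_le le_rfl)) le_rfl)) le_rfl).trans ?_
  rw [n1]
  nlinarith

lemma proj_residual_proj (F : Matrix m k ℝ) :
    (1 - U * Uᵀ) * (F * Fᵀ - X) * (1 - U * Uᵀ) =
      ((1 - U * Uᵀ) * F) * ((1 - U * Uᵀ) * F)ᵀ := by
  rw [Matrix.mul_sub _ (F * Fᵀ) X, h.proj_mul_X, sub_zero, transpose_mul, h.proj_symm]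
  simp only [Matrix.mul_assoc]

/-- The blocks of R that meet the range of U are controlled by Uᵀ R. The projection kills X, so the
remaining block is (P F)(P F)ᵀ. -/
lemma norm_residual_le (F : Matrix m k ℝ) :
    ‖F * Fᵀ - X‖ ≤ 2 * ‖Uᵀ * (F * Fᵀ - X)‖ + ‖(1 - U * Uᵀ) * F‖ ^ 2 := by
  have hRt := residual_symm h.X_symm F
  rw [← norm_mul_transpose_self, ← h.proj_residual_proj]
  set R := F * Fᵀ - X
  have hid : R = U * (Uᵀ * R) + (1 - U * Uᵀ) * (R * U) * Uᵀ +
      (1 - U * Uᵀ) * R * (1 - U * Uᵀ) := by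
    simp only [Matrix.mul_sub, Matrix.sub_mul, Matrix.mul_one, Matrix.one_mul, Matrix.mul_assoc]
    abel
  have h1 : ‖U * (Uᵀ * R)‖ ≤ 1 * ‖Uᵀ * R‖ := norm_mul_le_of_le h.norm_U le_rfl
  have h3 : ‖R * U‖ = ‖Uᵀ * R‖ := by
    rw [← norm_transpose', transpose_mul, hRt]
  have h2 : ‖(1 - U * Uᵀ) * (R * U) * Uᵀ‖ ≤ 1 * ‖Uᵀ * R‖ * 1 :=
    norm_mul_le_of_le (norm_mul_le_of_le h.norm_proj h3.le) h.norm_Ut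
  calc ‖R‖ ≤ ‖U * (Uᵀ * R)‖ + ‖(1 - U * Uᵀ) * (R * U) * Uᵀ‖ +
      ‖(1 - U * Uᵀ) * R * (1 - U * Uᵀ)‖ := (congrArg norm hid).le.trans norm_add₃_le
    _ ≤ _ := by linarith

/-- The projection kills every multiple of X, so closeness to c X for any c makes the orthogonal
part small; this is used at the initialization. -/
lemma norm_sq_proj_mul_le (F : Matrix m k ℝ) (c : ℝ) :
    ‖(1 - U * Uᵀ) * F‖ ^ 2 ≤ ‖F * Fᵀ - c • X‖ := by
  have e : ((1 - U * Uᵀ) * F) * ((1 - U * Uᵀ) * F)ᵀ =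
      (1 - U * Uᵀ) * (F * Fᵀ - c • X) * (1 - U * Uᵀ) := by
    rw [Matrix.mul_sub _ (F * Fᵀ) (c • X), Matrix.mul_smul, h.proj_mul_X, smul_zero, sub_zero, transpose_mul,
      h.proj_symm]
    simp only [Matrix.mul_assoc]
  rw [← norm_mul_transpose_self, e]
  have : ‖(1 - U * Uᵀ) * (F * Fᵀ - c • X) * (1 - U * Uᵀ)‖ ≤ 1 * ‖F * Fᵀ - c • X‖ * 1 :=
    norm_mul_le_of_le (norm_mul_le_of_le h.norm_proj le_rfl) h.norm_proj
  linarith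

/-- When `F` has as many columns as the rank of `X`, the orthogonal part is controlled by `Uᵀ R`. -/
lemma norm_sq_proj_mul_le_of_square (F : Matrix m ι ℝ) (hQ : ‖Uᵀ * (F * Fᵀ - X)‖ ≤ μ / 20) :
    ‖(1 - U * Uᵀ) * F‖ ^ 2 ≤ 2 * ‖Uᵀ * (F * Fᵀ - X)‖ ^ 2 / μ := by
  have hμ := h.μ_pos
  set S := Uᵀ * F with hS
  set T := (1 - U * Uᵀ) * F with hT
  set Q := Uᵀ * (F * Fᵀ - X) with hQd
  -- S Sᵀ equals D up to the small matrix Q U, so a Neumann series gives it an inverse of norm at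
  -- most 2/μ.
  have hSS : S * Sᵀ = 1 - (1 - Dh * Dh - Q * U) := by
    have : Q * U = S * Sᵀ - Dh * Dh := by
      rw [hQd, hS, Matrix.mul_sub, Matrix.sub_mul, h.Ut_mul_X, Matrix.mul_assoc (Dh * Dh), h.orth,
        transpose_mul, transpose_transpose, Matrix.mul_one]
      simp only [Matrix.mul_assoc]
    rw [this]; abel
  have hQU : ‖Q * U‖ ≤ μ / 20 * 1 := norm_mul_le_of_le hQ h.norm_U
  have hn : ‖1 - Dh * Dh - Q * U‖ ≤ 1 - μ / 2 := by
    refine (norm_sub_le _ _).trans ?_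
    linarith [h.norm_one_sub]
  obtain ⟨A, hA1, hA2, hAn⟩ := exists_inverse_one_sub hn (by linarith)
  rw [← hSS] at hA1 hA2
  -- Here S is square, so its right inverse is also a left inverse. Thus T can be recovered from T
  -- Sᵀ, which is bounded by Q.
  have hinv : (Sᵀ * A) * S = 1 := by
    have : S * (Sᵀ * A) = 1 := by rw [← Matrix.mul_assoc, hA2]
    exact mul_eq_one_comm.1 this
  have hBn : ‖Sᵀ * A‖ ^ 2 ≤ 2 / μ := by
    have hAt : Aᵀ = A := by
      have h5 : Aᵀ * (S * Sᵀ) = 1 := by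
        have := congrArg transpose hA2
        rwa [transpose_mul, transpose_mul, transpose_transpose, transpose_one] at this
      calc Aᵀ = Aᵀ * (S * Sᵀ * A) := by rw [hA2, mul_one]
        _ = A := by rw [← mul_assoc, h5, one_mul]
    have : (Sᵀ * A)ᵀ * (Sᵀ * A) = A := by
      rw [transpose_mul, transpose_transpose, hAt]
      calc A * S * (Sᵀ * A) = A * (S * Sᵀ) * A := by noncomm_ring
        _ = A := by rw [hA1, one_mul]
    rw [← norm_transpose_mul_self, this]
    rwa [sub_sub_cancel, one_div_div] at hAn
  have hTS : T * Sᵀ = (Q * (1 - U * Uᵀ))ᵀ := by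
    have e : Q * (1 - U * Uᵀ) = S * Tᵀ := by
      rw [hQd, hS, hT, transpose_mul, h.proj_symm, Matrix.mul_sub _ (F * Fᵀ) X, Matrix.sub_mul, h.Ut_mul_X,
        Matrix.mul_assoc (Dh * Dh), h.Ut_mul_proj, Matrix.mul_zero, sub_zero]
      simp only [Matrix.mul_assoc]
    rw [e, transpose_mul S, transpose_transpose]
  have hT2 : T = (T * Sᵀ) * (Sᵀ * A)ᵀ := by
    have : Sᵀ * (Sᵀ * A)ᵀ = 1 := by
      have := congrArg transpose hinv
      rwa [transpose_mul, transpose_one] at this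
    rw [Matrix.mul_assoc, this, Matrix.mul_one]
  have hTSn : ‖T * Sᵀ‖ ≤ ‖Q‖ * 1 := by
    rw [hTS, norm_transpose']
    exact norm_mul_le_of_le le_rfl h.norm_proj
  have hTn : ‖T‖ ≤ ‖Q‖ * 1 * ‖Sᵀ * A‖ := by
    have : ‖(T * Sᵀ) * (Sᵀ * A)ᵀ‖ ≤ ‖Q‖ * 1 * ‖Sᵀ * A‖ :=
      norm_mul_le_of_le hTSn (norm_transpose' _).le
    rwa [← hT2] at this
  calc ‖T‖ ^ 2 ≤ (‖Q‖ * 1 * ‖Sᵀ * A‖) ^ 2 := pow_le_pow_left₀ (norm_nonneg _) hTn 2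
    _ = ‖Q‖ ^ 2 * ‖Sᵀ * A‖ ^ 2 := by ring
    _ ≤ ‖Q‖ ^ 2 * (2 / μ) := mul_le_mul_of_nonneg_left hBn (sq_nonneg _)
    _ = _ := by ring

/-! ### The whitened signal part `G = Di Uᵀ F` -/

lemma Ut_mul_eq (F : Matrix m k ℝ) : Uᵀ * F = Dh * (Di * Uᵀ * F) := by
  rw [Matrix.mul_assoc, ← Matrix.mul_assoc, h.mul_inv, Matrix.one_mul]

lemma transpose_mul_self_eq (F : Matrix m k ℝ) :
    Fᵀ * F = (Di * Uᵀ * F)ᵀ * (Dh * Dh) * (Di * Uᵀ * F) +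
      ((1 - U * Uᵀ) * F)ᵀ * ((1 - U * Uᵀ) * F) := by
  have e1 : (Di * Uᵀ * F)ᵀ * (Dh * Dh) * (Di * Uᵀ * F) = (Uᵀ * F)ᵀ * (Uᵀ * F) := by
    rw [h.Ut_mul_eq F, transpose_mul Dh, h.Dh_symm]
    simp only [Matrix.mul_assoc]
  have e2 : ((1 - U * Uᵀ) * F)ᵀ * ((1 - U * Uᵀ) * F) = Fᵀ * ((1 - U * Uᵀ) * F) := by
    rw [transpose_mul, h.proj_symm, Matrix.mul_assoc, ← Matrix.mul_assoc _ _ F, h.proj_idem]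
  rw [e1, e2]
  simp only [Matrix.mul_sub, Matrix.sub_mul, Matrix.one_mul, Matrix.mul_assoc, transpose_mul,
    transpose_transpose]
  abel

lemma norm_sq_le (F : Matrix m k ℝ) :
    ‖F‖ ^ 2 ≤ ‖Di * Uᵀ * F‖ ^ 2 + ‖(1 - U * Uᵀ) * F‖ ^ 2 := by
  rw [← norm_transpose_mul_self, h.transpose_mul_self_eq]
  refine (norm_add_le _ _).trans ?_
  rw [norm_transpose_mul_self ((1 - U * Uᵀ) * F)]
  have : ‖(Di * Uᵀ * F)ᵀ * (Dh * Dh) * (Di * Uᵀ * F)‖ ≤ ‖Di * Uᵀ * F‖ * 1 * ‖Di * Uᵀ * F‖ :=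
    norm_mul_le_of_le (norm_mul_le_of_le (norm_transpose' _).le h.norm_D) le_rfl
  nlinarith

/-- One step of the whitened Gram matrix, with the size of the perturbation. -/
lemma exists_gram_step (F : Matrix m k ℝ) (E : Matrix m m ℝ) {a ν : ℝ} (ha : 0 ≤ a)
    (hν : ‖Di * Uᵀ * F‖ * ‖(1 - U * Uᵀ) * F‖ ^ 2 + 1 / μ * ‖E‖ * ‖F‖ ≤ ν) {Y B : Matrix ι ι ℝ}
    (hY : Y = (Di * Uᵀ * F) * (Di * Uᵀ * F)ᵀ - 1) (hB : B = 1 - Y * a • (Dh * Dh)) :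
    ∃ Ω : Matrix ι ι ℝ,
      (Di * Uᵀ * (F - a • ((F * Fᵀ - X + E) * F))) *
        (Di * Uᵀ * (F - a • ((F * Fᵀ - X + E) * F)))ᵀ = B * (1 + Y) * Bᵀ + Ω ∧
      ‖Ω‖ ≤ a * (2 * ‖B‖ * ‖Di * Uᵀ * F‖ * ν + a * ν ^ 2) := by
  set G := Di * Uᵀ * F with hG
  set T := (1 - U * Uᵀ) * F with hT
  -- Since Fᵀ F = Gᵀ D G + Tᵀ T, the recursion for G closes up to this term: the coupling with the
  -- orthogonal part and the whitened error.
  set N := G * (Tᵀ * T) + Di * Uᵀ * E * F with hN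
  have hNn : ‖N‖ ≤ ν := by
    refine (norm_add_le _ _).trans (le_trans (add_le_add ?_ ?_) hν)
    · exact norm_mul_le_of_le le_rfl (norm_transpose_mul_self T).le
    · refine norm_mul_le_of_le (norm_mul_le_of_le ?_ le_rfl) le_rfl
      have : ‖Di * Uᵀ‖ ≤ 1 / μ * 1 := norm_mul_le_of_le h.norm_Di h.norm_Ut
      linarith
  have hstep : Di * Uᵀ * (F - a • ((F * Fᵀ - X + E) * F)) = B * G - a • N := by
    have e1 : Di * Uᵀ * (F * Fᵀ * F) = G * (Gᵀ * (Dh * Dh) * G + Tᵀ * T) := by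
      rw [← h.transpose_mul_self_eq F, hG]
      simp only [Matrix.mul_assoc]
    have e2 : Di * Uᵀ * (X * F) = Dh * Dh * G := by
      have : Di * Uᵀ * (X * F) = Di * (Uᵀ * X) * F := by simp only [Matrix.mul_assoc]
      rw [this, h.Ut_mul_X]
      have : Di * (Dh * Dh * Uᵀ) * F = (Di * Dh) * (Dh * (Uᵀ * F)) := by
        simp only [Matrix.mul_assoc]
      rw [this, h.inv_mul, Matrix.one_mul, h.Ut_mul_eq F, Matrix.mul_assoc Dh Dh]
    have e3 : Di * Uᵀ * (F - a • ((F * Fᵀ - X + E) * F)) =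
        G - a • (Di * Uᵀ * (F * Fᵀ * F) - Di * Uᵀ * (X * F) + Di * Uᵀ * E * F) := by
      rw [hG]
      simp only [Matrix.mul_sub, Matrix.sub_mul, Matrix.add_mul, Matrix.mul_add, Matrix.mul_smul,
        Matrix.mul_assoc]
    rw [e3, e1, e2, hB, hY, hN]
    simp only [Matrix.sub_mul, Matrix.mul_add, Matrix.mul_smul, Matrix.smul_mul, Matrix.mul_assoc,
      Matrix.one_mul]
    module
  refine ⟨-(a • (B * G * Nᵀ)) - a • (N * (B * G)ᵀ) + (a * a) • (N * Nᵀ), ?_, ?_⟩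
  · have hJ : 1 + Y = G * Gᵀ := by rw [hY]; abel
    rw [hstep, hJ]
    simp only [Matrix.mul_sub, Matrix.sub_mul, Matrix.mul_smul, Matrix.smul_mul, Matrix.mul_assoc,
      transpose_sub, transpose_smul, transpose_mul, smul_sub, smul_smul]
    module
  · have hν0 : 0 ≤ ν := (norm_nonneg _).trans hNn
    have hBG : ‖B * G‖ ≤ ‖B‖ * ‖G‖ := norm_mul_le_of_le le_rfl le_rfl
    have hNt : ‖Nᵀ‖ ≤ ν := (norm_transpose' N).le.trans hNn
    have n1 : ‖B * G * Nᵀ‖ ≤ ‖B‖ * ‖G‖ * ν := norm_mul_le_of_le hBG hNt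
    have n2 : ‖N * (B * G)ᵀ‖ ≤ ν * (‖B‖ * ‖G‖) :=
      norm_mul_le_of_le hNn ((norm_transpose' _).le.trans hBG)
    have n3 : ‖N * Nᵀ‖ ≤ ν * ν := norm_mul_le_of_le hNn hNt
    refine ((norm_add_le _ _).trans (add_le_add_left (norm_sub_le _ _) _)).trans ?_
    rw [norm_neg, norm_smul, norm_smul, norm_smul, Real.norm_of_nonneg ha,
      Real.norm_of_nonneg (mul_nonneg ha ha)]
    nlinarith [mul_le_mul_of_nonneg_left n1 ha, mul_le_mul_of_nonneg_left n2 ha,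
      mul_le_mul_of_nonneg_left n3 (mul_nonneg ha ha)]

/-- Splitting F along U and its complement gives Uᵀ R = Dh (G Gᵀ - 1) Dh Uᵀ + Dh G Tᵀ. This converts
the outcome of the warm phase into the quantity used in the local phase. -/
lemma norm_Ut_mul_residual_le (F : Matrix m k ℝ) :
    ‖Uᵀ * (F * Fᵀ - X)‖ ≤ ‖(Di * Uᵀ * F) * (Di * Uᵀ * F)ᵀ - 1‖ +
      ‖Di * Uᵀ * F‖ * ‖(1 - U * Uᵀ) * F‖ := by
  set G := Di * Uᵀ * F with hG
  set T := (1 - U * Uᵀ) * F with hT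
  have hid : Uᵀ * (F * Fᵀ - X) = Dh * (G * Gᵀ - 1) * Dh * Uᵀ + Dh * G * Tᵀ := by
    have hF : Fᵀ = (Dh * G)ᵀ * Uᵀ + Tᵀ := by
      rw [← h.Ut_mul_eq F, hT, ← transpose_mul, ← transpose_add]
      congr 1
      simp only [Matrix.sub_mul, Matrix.one_mul, Matrix.mul_assoc]
      abel
    rw [Matrix.mul_sub, h.Ut_mul_X, ← Matrix.mul_assoc, h.Ut_mul_eq F, ← hG]
    conv_lhs => rw [hF]
    simp only [Matrix.mul_sub, Matrix.sub_mul, Matrix.mul_add, Matrix.mul_one, Matrix.mul_assoc,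
      transpose_mul, h.Dh_symm]
    abel
  rw [hid]
  refine (norm_add_le _ _).trans (add_le_add ?_ ?_)
  · have : ‖Dh * (G * Gᵀ - 1) * Dh * Uᵀ‖ ≤ 1 * ‖G * Gᵀ - 1‖ * 1 * 1 :=
      norm_mul_le_of_le (norm_mul_le_of_le (norm_mul_le_of_le h.norm_Dh le_rfl) h.norm_Dh)
        h.norm_Ut
    linarith
  · have : ‖Dh * G * Tᵀ‖ ≤ 1 * ‖G‖ * ‖T‖ :=
      norm_mul_le_of_le (norm_mul_le_of_le h.norm_Dh le_rfl) (norm_transpose' _).le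
    linarith

/-- The orthogonal part of one step. -/
lemma norm_sq_proj_step_le (F : Matrix m k ℝ) (E : Matrix m m ℝ) {a : ℝ} (ha : 0 ≤ a)
    (haF : a * ‖F‖ ^ 2 ≤ 1) :
    ‖(1 - U * Uᵀ) * (F - a • ((F * Fᵀ - X + E) * F))‖ ^ 2 ≤
      ‖(1 - U * Uᵀ) * F‖ ^ 2 - a / 2 * (‖(1 - U * Uᵀ) * F‖ ^ 2) ^ 2 + 3 * a * ‖E‖ ^ 2 := by
  have := norm_sq_orthogonal_step_le F (1 - U * Uᵀ) E ha h.proj_symm h.proj_idem haF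
  have e : (1 - U * Uᵀ) * (F - a • ((F * Fᵀ - X + E) * F)) =
      (1 - U * Uᵀ) * F - a • ((1 - U * Uᵀ) * F * (Fᵀ * F)) - a • ((1 - U * Uᵀ) * E * F) := by
    have e1 : (1 - U * Uᵀ) * ((F * Fᵀ - X + E) * F) = (1 - U * Uᵀ) * F * (Fᵀ * F) +
        (1 - U * Uᵀ) * E * F := by
      have : (1 - U * Uᵀ) * ((F * Fᵀ - X + E) * F) = (1 - U * Uᵀ) * (F * Fᵀ * F) -
          (1 - U * Uᵀ) * X * F + (1 - U * Uᵀ) * E * F := by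
        simp only [Matrix.add_mul, Matrix.mul_add, Matrix.mul_sub,
          Matrix.sub_mul (F * Fᵀ), Matrix.mul_assoc]
      rw [this, h.proj_mul_X, Matrix.zero_mul, sub_zero]
      simp only [Matrix.mul_assoc]
    rw [Matrix.mul_sub, Matrix.mul_smul, e1, smul_add, sub_sub]
  rwa [e]

end SpectralFrame
end Frame

/-! ### Scalar recursions of the local phase -/

section LocalPhase

/-- The sublinear rate that dominates the overparametrized part. -/
def slowRate (α μ : ℝ) (t : ℕ) : ℝ := μ ^ 2 / (40 * (1 + α / 320 * μ ^ 3 * t))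

/-- The geometric rate of the signal part. -/
def fastRate (α μ : ℝ) : ℝ := 1 - α * μ ^ 2 / 4

lemma slowRate_pos {α μ : ℝ} (hα : 0 < α) (hμ : 0 < μ) (t : ℕ) : 0 < slowRate α μ t := by
  unfold slowRate; positivity

lemma slowRate_le {α μ : ℝ} (hα : 0 < α) (hμ : 0 < μ) (t : ℕ) : slowRate α μ t ≤ μ ^ 2 / 40 := by
  unfold slowRate
  apply div_le_div_of_nonneg_left (sq_nonneg μ) (by norm_num)
  have : 0 ≤ α / 320 * μ ^ 3 * t := by positivity
  linarith

/-- A discrete form of b' = -(αμ/8) b² with b(0) = μ²/40; the constant 320 in the rate is 8 · 40. -/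
lemma slowRate_sub_succ_le {α μ : ℝ} (hα : 0 < α) (hμ : 0 < μ) (t : ℕ) :
    slowRate α μ t - slowRate α μ (t + 1) ≤ α * μ / 8 * slowRate α μ t ^ 2 := by
  have h0 : 0 ≤ α / 320 * μ ^ 3 * t := by positivity
  have h1 : 0 < α / 320 * μ ^ 3 := by positivity
  unfold slowRate
  push_cast
  set w := 1 + α / 320 * μ ^ 3 * t with hw
  have hw1 : 0 < w := by linarith
  have e : 1 + α / 320 * μ ^ 3 * ((t : ℝ) + 1) = w + α / 320 * μ ^ 3 := by rw [hw]; ring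
  rw [e]
  have e2 : μ ^ 2 / (40 * w) - μ ^ 2 / (40 * (w + α / 320 * μ ^ 3)) =
      α * μ / 8 * (μ ^ 4 / (1600 * (w * (w + α / 320 * μ ^ 3)))) := by
    field_simp
    ring
  rw [e2, div_pow]
  apply mul_le_mul_of_nonneg_left _ (by positivity)
  rw [show (μ ^ 2) ^ 2 = μ ^ 4 by ring]
  apply div_le_div_of_nonneg_left (by positivity) (by positivity)
  nlinarith

/-- Induction from (1 - x)(1 + x(t + 1)) ≤ 1 + x t; it lets the sublinear rate dominate the
geometric one. -/
lemma fastRate_pow_mul_le {α μ : ℝ} (hα : 0 < α) (hα1 : α ≤ 1) (hμ : 0 < μ) (hμ1 : μ ≤ 1) (t : ℕ) :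
    fastRate α μ ^ t * (1 + α * μ ^ 2 / 4 * t) ≤ 1 := by
  have hx : 0 ≤ α * μ ^ 2 / 4 := by positivity
  have hx1 : α * μ ^ 2 / 4 ≤ 1 := by nlinarith [pow_le_one₀ hμ.le hμ1 (n := 2)]
  have hg : 0 ≤ fastRate α μ := by unfold fastRate; linarith
  induction t with
  | zero => simp
  | succ t ih =>
    have ht : (0 : ℝ) ≤ t := t.cast_nonneg
    have hp := pow_nonneg hg t
    calc fastRate α μ ^ (t + 1) * (1 + α * μ ^ 2 / 4 * ((t + 1 : ℕ) : ℝ))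
        = fastRate α μ ^ t * ((1 - α * μ ^ 2 / 4) * (1 + α * μ ^ 2 / 4 * (t + 1))) := by
          rw [pow_succ, fastRate]; push_cast; ring
      _ ≤ fastRate α μ ^ t * (1 + α * μ ^ 2 / 4 * t) := by
          apply mul_le_mul_of_nonneg_left _ hp
          nlinarith [mul_nonneg (mul_nonneg hx hx) ht, mul_nonneg hx hx]
      _ ≤ 1 := ih

lemma fastRate_pow_le_slowRate {α μ : ℝ} (hα : 0 < α) (hα1 : α ≤ 1) (hμ : 0 < μ) (hμ1 : μ ≤ 1)
    (t : ℕ) : fastRate α μ ^ t * μ ^ 2 ≤ 40 * slowRate α μ t := by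
  have h := fastRate_pow_mul_le hα hα1 hμ hμ1 t
  have hx1 : α * μ ^ 2 / 4 ≤ 1 := by nlinarith [pow_le_one₀ hμ.le hμ1 (n := 2)]
  have hg : 0 ≤ fastRate α μ := by unfold fastRate; linarith
  have ht : (0 : ℝ) ≤ t := t.cast_nonneg
  have hw : 0 < 1 + α / 320 * μ ^ 3 * t := by positivity
  have h2 : 1 + α / 320 * μ ^ 3 * t ≤ 1 + α * μ ^ 2 / 4 * t := by
    have : α / 320 * μ ^ 3 ≤ α * μ ^ 2 / 4 := by
      have : 0 ≤ α * μ ^ 2 := by positivity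
      nlinarith
    nlinarith
  have h3 : fastRate α μ ^ t * (1 + α / 320 * μ ^ 3 * t) ≤ 1 :=
    (mul_le_mul_of_nonneg_left h2 (pow_nonneg hg t)).trans h
  have e : 40 * slowRate α μ t = μ ^ 2 / (1 + α / 320 * μ ^ 3 * t) := by
    unfold slowRate; field_simp
  rw [e, le_div_iff₀ hw]
  nlinarith [sq_nonneg μ]

/-- The contraction aμ/2 covers the decay of the geometric part. On the slow part it is halved: aμ/4
absorbs the forcing by τ, and aμ/4 exceeds the relative decrease of b, because b ≤ μ. -/
lemma local_phase_signal_step {α μ a ρ q τ q' γ g b b' : ℝ} (hα : 0 < α)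
    (hμ : 0 < μ) (hμ1 : μ ≤ 1) (ha : α * μ ≤ a) (hamu : a * μ ≤ 1 / 100)
    (hρ : ρ ≤ 1 / 1000) (hγ : 0 ≤ γ) (hg : g = 1 - α * μ ^ 2 / 4) (hb0 : 0 < b)
    (hbμ : b ≤ μ) (hbs : b - b' ≤ α * μ / 8 * b ^ 2)
    (hq : q ≤ μ / 80 * γ + μ * b) (hτ0 : 0 ≤ τ) (hτ : τ ≤ b)
    (hq' : q' ≤ (1 - a * μ / 2) * q + 6 * a * ρ * μ ^ 3 * τ) :
    q' ≤ μ / 80 * (γ * g) + μ * b' := by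
  have hamu2 : α * μ ^ 2 ≤ a * μ := by
    calc α * μ ^ 2 = α * μ * μ := by ring
      _ ≤ a * μ := mul_le_mul_of_nonneg_right ha hμ.le
  have hαμ : 0 < α * μ := mul_pos hα hμ
  have ha0 : 0 < a := hαμ.trans_le ha
  have h1 : (1 - a * μ / 2) * q ≤ (1 - a * μ / 2) * (μ / 80 * γ + μ * b) :=
    mul_le_mul_of_nonneg_left hq (by linarith)
  have h2 : (1 - a * μ / 2) * (μ / 80 * γ) ≤ g * (μ / 80 * γ) := by
    apply mul_le_mul_of_nonneg_right _ (by positivity)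
    have : 0 < a * μ := mul_pos ha0 hμ
    rw [hg]; linarith
  have h3 : 6 * a * ρ * μ ^ 3 * τ ≤ a * μ / 4 * (μ * b) := by
    have e1 : ρ * τ ≤ 1 / 1000 * b := mul_le_mul hρ hτ hτ0 (by norm_num)
    have e2 : 0 ≤ a * μ ^ 2 * b := by positivity
    have e3 : a * μ ^ 3 * (ρ * τ) ≤ a * μ ^ 3 * (1 / 1000 * b) :=
      mul_le_mul_of_nonneg_left e1 (by positivity)
    have e4 : a * μ ^ 2 * b * μ ≤ a * μ ^ 2 * b * 1 := mul_le_mul_of_nonneg_left hμ1 e2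
    calc 6 * a * ρ * μ ^ 3 * τ = 6 * (a * μ ^ 3 * (ρ * τ)) := by ring
      _ ≤ 6 * (a * μ ^ 3 * (1 / 1000 * b)) := by linarith
      _ = 6 / 1000 * (a * μ ^ 2 * b * μ) := by ring
      _ ≤ 1 / 4 * (a * μ ^ 2 * b) := by linarith
      _ = _ := by ring
  have h4 : b * (1 - a * μ / 4) ≤ b' := by
    have e0 : α * μ * b ≤ a * μ := mul_le_mul ha hbμ hb0.le ha0.le
    have e1 : α * μ * b * b ≤ a * μ * b := mul_le_mul_of_nonneg_right e0 hb0.le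
    have e2 : 0 ≤ a * μ * b := by positivity
    nlinarith only [hbs, e1, e2]
  have h5 := mul_le_mul_of_nonneg_left h4 hμ.le
  calc q' ≤ (1 - a * μ / 2) * (μ / 80 * γ + μ * b) + a * μ / 4 * (μ * b) := by linarith
    _ = (1 - a * μ / 2) * (μ / 80 * γ) + μ * (b * (1 - a * μ / 4)) := by ring
    _ ≤ g * (μ / 80 * γ) + μ * b' := by linarith
    _ = _ := by ring

/-- By monotonicity of x ↦ x - (a/4) x², τ may be replaced by b. Half of the gain (a/4) b² absorbs
the forcing, as μ q ≤ (3/2) b, and the other half covers b - b'. -/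
lemma local_phase_orthogonal_step {α μ a ρ q τ τ' γ b b' : ℝ} (ha0 : 0 ≤ a)
    (hμ : 0 < μ) (hμ1 : μ ≤ 1) (ha : α * μ ≤ a) (ha1 : a ≤ 1 / 100)
    (hρ0 : 0 ≤ ρ) (hρ : ρ ≤ 1 / 1000) (hb0 : 0 < b)
    (hb1 : b ≤ 1) (hbs : b - b' ≤ α * μ / 8 * b ^ 2) (hγb : γ * μ ^ 2 ≤ 40 * b) (hq0 : 0 ≤ q)
    (hq : q ≤ μ / 80 * γ + μ * b) (hτ : τ ≤ b)
    (hτ' : τ' ≤ τ - a / 4 * τ ^ 2 + 24 * a * ρ ^ 2 * μ ^ 6 * q ^ 2) :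
    τ' ≤ b' := by
  have h1 : τ - a / 4 * τ ^ 2 ≤ b - a / 4 * b ^ 2 := by
    have e0 : a * (b + τ) ≤ 1 / 100 * 2 :=
      (mul_le_mul_of_nonneg_left (by linarith) ha0).trans
        (mul_le_mul_of_nonneg_right ha1 zero_le_two)
    have e1 := mul_nonneg (sub_nonneg.2 hτ) (show 0 ≤ 4 - a * (b + τ) by linarith)
    nlinarith only [e1]
  have h2 : (μ * q) ^ 2 ≤ 5 / 2 * b ^ 2 := by
    have e1 : μ * q ≤ μ * (μ / 80 * γ + μ * b) := mul_le_mul_of_nonneg_left hq hμ.le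
    have e2 : μ ^ 2 * b ≤ 1 * b := mul_le_mul_of_nonneg_right (pow_le_one₀ hμ.le hμ1) hb0.le
    have e3 : μ * q ≤ 3 / 2 * b := by nlinarith only [e1, e2, hγb]
    have e4 : 0 ≤ μ * q := by positivity
    calc (μ * q) ^ 2 ≤ (3 / 2 * b) ^ 2 := pow_le_pow_left₀ e4 e3 2
      _ ≤ 5 / 2 * b ^ 2 := by nlinarith only [sq_nonneg b]
  have h3 : 24 * a * ρ ^ 2 * μ ^ 6 * q ^ 2 ≤ a / 8 * b ^ 2 := by
    have e1 : ρ ^ 2 ≤ (1 / 1000) ^ 2 := pow_le_pow_left₀ hρ0 hρ 2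
    have e2 : μ ^ 4 ≤ 1 := pow_le_one₀ hμ.le hμ1
    have e3 : ρ ^ 2 * μ ^ 4 ≤ (1 / 1000) ^ 2 * 1 := mul_le_mul e1 e2 (by positivity) (by norm_num)
    have e4 : ρ ^ 2 * μ ^ 4 * (μ * q) ^ 2 ≤ (1 / 1000) ^ 2 * 1 * (5 / 2 * b ^ 2) :=
      mul_le_mul e3 h2 (by positivity) (by norm_num)
    have e5 := mul_le_mul_of_nonneg_left e4 ha0
    have e6 := mul_nonneg ha0 (sq_nonneg b)
    calc 24 * a * ρ ^ 2 * μ ^ 6 * q ^ 2 = 24 * (a * (ρ ^ 2 * μ ^ 4 * (μ * q) ^ 2)) := by ring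
      _ ≤ 24 * (a * ((1 / 1000) ^ 2 * 1 * (5 / 2 * b ^ 2))) := by linarith
      _ ≤ a / 8 * b ^ 2 := by nlinarith only [e6]
  have h4 : α * μ / 8 * b ^ 2 ≤ a / 8 * b ^ 2 := by
    apply mul_le_mul_of_nonneg_right _ (sq_nonneg b); linarith
  linarith

end LocalPhase

/-! ### Local convergence of trajectories -/

section Trajectory
variable {m ι k : Type*} [Fintype m] [Fintype ι] [Fintype k]
  [DecidableEq m] [DecidableEq ι] [DecidableEq k]

/-- Perturbed gradient descent for `F Fᵀ ≈ X`, with step sizes `a` and relative errors `E`. -/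
structure Trajectory (X : Matrix m m ℝ) (F : ℕ → Matrix m k ℝ) (a : ℕ → ℝ) (E : ℕ → Matrix m m ℝ)
    (α μ ρ : ℝ) : Prop where
  step : ∀ t, F (t + 1) = F t - a t • ((F t * (F t)ᵀ - X + E t) * F t)
  lower : ∀ t, α * μ ≤ a t
  upper : ∀ t, a t ≤ μ / 100
  error : ∀ t, ‖E t‖ ≤ ρ * μ ^ 3 * ‖F t * (F t)ᵀ - X‖

lemma Trajectory.shift {X : Matrix m m ℝ} {F : ℕ → Matrix m k ℝ} {a : ℕ → ℝ}
    {E : ℕ → Matrix m m ℝ} {α μ ρ : ℝ} (hT : Trajectory X F a E α μ ρ) (s : ℕ) :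
    Trajectory X (fun t => F (s + t)) (fun t => a (s + t)) (fun t => E (s + t)) α μ ρ where
  step t := hT.step (s + t)
  lower t := hT.lower (s + t)
  upper t := hT.upper (s + t)
  error t := hT.error (s + t)

variable {X : Matrix m m ℝ} {U : Matrix m ι ℝ} {Dh Di : Matrix ι ι ℝ} {α μ ρ : ℝ}
  {a : ℕ → ℝ} {E : ℕ → Matrix m m ℝ}

/-- The error is at most ρμ³(2q + τ). Its share in q lowers the contraction from 7/10 to 1/2, its
share in τ² lowers the gain from a/2 to a/4, and the rest is the coupling. -/
lemma local_phase_step {F : ℕ → Matrix m k ℝ} (h : SpectralFrame X U Dh Di μ)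
    (hT : Trajectory X F a E α μ ρ) (hα : 0 < α)
    (hρ0 : 0 ≤ ρ) (hρ : ρ ≤ 1 / 1000) {t : ℕ}
    (hq : ‖Uᵀ * (F t * (F t)ᵀ - X)‖ ≤ 3 / 80 * μ)
    (hτ : ‖(1 - U * Uᵀ) * F t‖ ^ 2 ≤ μ / 40) :
    ‖Uᵀ * (F (t + 1) * (F (t + 1))ᵀ - X)‖ ≤
      (1 - a t * μ / 2) * ‖Uᵀ * (F t * (F t)ᵀ - X)‖ +
        6 * a t * ρ * μ ^ 3 * ‖(1 - U * Uᵀ) * F t‖ ^ 2 ∧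
    ‖(1 - U * Uᵀ) * F (t + 1)‖ ^ 2 ≤ ‖(1 - U * Uᵀ) * F t‖ ^ 2 -
      a t / 4 * (‖(1 - U * Uᵀ) * F t‖ ^ 2) ^ 2 +
        24 * a t * ρ ^ 2 * μ ^ 6 * ‖Uᵀ * (F t * (F t)ᵀ - X)‖ ^ 2 := by
  have hμ := h.μ_pos
  have hμ1 := h.μ_le
  have ha := hT.lower t
  have ha2 := hT.upper t
  have hE := hT.error t
  have hR := h.norm_residual_le (F t)
  have ha0 : 0 < a t := (mul_pos hα hμ).trans_le ha
  have hF : ‖F t‖ ^ 2 ≤ 11 / 10 := by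
    rw [← norm_mul_transpose_self]
    have : F t * (F t)ᵀ = (F t * (F t)ᵀ - X) + X := by abel
    rw [this]
    refine (norm_add_le _ _).trans ?_
    linarith [h.norm_X]
  set q := ‖Uᵀ * (F t * (F t)ᵀ - X)‖ with hqd
  set τ := ‖(1 - U * Uᵀ) * F t‖ ^ 2 with hτd
  have hq0 : 0 ≤ q := norm_nonneg _
  have hτ0 : 0 ≤ τ := sq_nonneg _
  have hR' : ‖F t * (F t)ᵀ - X‖ ≤ μ / 10 := by linarith
  have hμ3 : μ ^ 3 ≤ 1 := pow_le_one₀ hμ.le hμ1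
  have hμ3' : 0 ≤ μ ^ 3 := by positivity
  have hE2 : ‖E t‖ ≤ ρ * μ ^ 3 * (2 * q + τ) :=
    hE.trans (mul_le_mul_of_nonneg_left hR (by positivity))
  have hE1 : ‖E t‖ ≤ 1 := by
    refine hE2.trans ?_
    have : ρ * μ ^ 3 ≤ 1 * 1 := mul_le_mul (by linarith) hμ3 hμ3' zero_le_one
    have h2 : 2 * q + τ ≤ 1 := by linarith
    nlinarith [mul_nonneg hρ0 hμ3']
  have hμμ : μ ^ 3 ≤ μ := by
    calc μ ^ 3 = μ * μ ^ 2 := by ring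
      _ ≤ μ * 1 := mul_le_mul_of_nonneg_left (pow_le_one₀ hμ.le hμ1) hμ.le
      _ = μ := mul_one μ
  rw [hT.step t]
  constructor
  · refine (h.norm_Ut_mul_residual_step_le (F t) (E t) ha0.le (by linarith) hR' hE1).trans ?_
    rw [← hqd]
    have h1 : 6 * a t * ‖E t‖ ≤ 6 * a t * (ρ * μ ^ 3 * (2 * q + τ)) :=
      mul_le_mul_of_nonneg_left hE2 (by positivity)
    have h2 : 12 * (ρ * μ ^ 3) ≤ μ / 5 := by
      have : ρ * μ ^ 3 ≤ 1 / 1000 * μ := mul_le_mul hρ hμμ hμ3' (by norm_num)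
      linarith
    have h3 := mul_le_mul_of_nonneg_right h2 (mul_nonneg ha0.le hq0)
    nlinarith
  · have haF : a t * ‖F t‖ ^ 2 ≤ 1 := by nlinarith
    refine (h.norm_sq_proj_step_le (F t) (E t) ha0.le haF).trans ?_
    rw [← hτd]
    have h1 : ‖E t‖ ^ 2 ≤ (ρ * μ ^ 3 * (2 * q + τ)) ^ 2 := pow_le_pow_left₀ (norm_nonneg _) hE2 2
    have h2 : (2 * q + τ) ^ 2 ≤ 8 * q ^ 2 + 2 * τ ^ 2 := by nlinarith [sq_nonneg (2 * q - τ)]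
    have h3 : ρ ^ 2 * μ ^ 6 ≤ 1 / 24 := by
      have e1 : ρ ^ 2 ≤ 1 / 1000000 := by nlinarith
      have e2 : μ ^ 6 ≤ 1 := pow_le_one₀ hμ.le hμ1
      calc ρ ^ 2 * μ ^ 6 ≤ 1 / 1000000 * 1 := mul_le_mul e1 e2 (by positivity) (by norm_num)
        _ ≤ 1 / 24 := by norm_num
    have h4 : ‖E t‖ ^ 2 ≤ ρ ^ 2 * μ ^ 6 * (8 * q ^ 2) + 1 / 12 * τ ^ 2 := by
      calc ‖E t‖ ^ 2 ≤ ρ ^ 2 * μ ^ 6 * (2 * q + τ) ^ 2 := by nlinarith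
        _ ≤ ρ ^ 2 * μ ^ 6 * (8 * q ^ 2 + 2 * τ ^ 2) :=
          mul_le_mul_of_nonneg_left h2 (by positivity)
        _ ≤ _ := by nlinarith [mul_le_mul_of_nonneg_right h3 (sq_nonneg τ)]
    nlinarith [mul_le_mul_of_nonneg_left h4 ha0.le]

/-- The two quantities force each other, so their envelopes are propagated together. The envelopes
imply the last two bounds, which keep the one-step estimates applicable. -/
lemma local_phase {F : ℕ → Matrix m k ℝ} (h : SpectralFrame X U Dh Di μ)
    (hT : Trajectory X F a E α μ ρ) (hα : 0 < α) (hα1 : α ≤ 1)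
    (hρ0 : 0 ≤ ρ) (hρ : ρ ≤ 1 / 1000)
    (hq : ‖Uᵀ * (F 0 * (F 0)ᵀ - X)‖ ≤ μ / 80)
    (hτ : ‖(1 - U * Uᵀ) * F 0‖ ^ 2 ≤ μ ^ 2 / 40) (t : ℕ) :
    ‖Uᵀ * (F t * (F t)ᵀ - X)‖ ≤ μ / 80 * fastRate α μ ^ t + μ * slowRate α μ t ∧
      ‖(1 - U * Uᵀ) * F t‖ ^ 2 ≤ slowRate α μ t ∧
      ‖Uᵀ * (F t * (F t)ᵀ - X)‖ ≤ 3 / 80 * μ ∧ ‖(1 - U * Uᵀ) * F t‖ ^ 2 ≤ μ / 40 := by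
  have hμ := h.μ_pos
  have hμ1 := h.μ_le
  have hμ2 : μ ^ 2 ≤ 1 := pow_le_one₀ hμ.le hμ1
  have crude : ∀ {q τ : ℝ} {s : ℕ}, q ≤ μ / 80 * fastRate α μ ^ s + μ * slowRate α μ s →
      τ ≤ slowRate α μ s → q ≤ 3 / 80 * μ ∧ τ ≤ μ / 40 := by
    intro q τ s h1 h2
    have hb := slowRate_le hα hμ s
    have hg0 : 0 ≤ fastRate α μ := by unfold fastRate; nlinarith
    have hg1 : fastRate α μ ≤ 1 := by unfold fastRate; nlinarith [mul_pos hα (pow_pos hμ 2)]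
    have hg := pow_le_one₀ hg0 hg1 (n := s)
    constructor
    · nlinarith [mul_le_mul_of_nonneg_left hb hμ.le, mul_le_mul_of_nonneg_left hg hμ.le]
    · nlinarith
  suffices hs : ‖Uᵀ * (F t * (F t)ᵀ - X)‖ ≤ μ / 80 * fastRate α μ ^ t + μ * slowRate α μ t ∧
      ‖(1 - U * Uᵀ) * F t‖ ^ 2 ≤ slowRate α μ t from ⟨hs.1, hs.2, crude hs.1 hs.2⟩
  induction t with
  | zero =>
    have e : slowRate α μ 0 = μ ^ 2 / 40 := by simp [slowRate]
    rw [e]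
    refine ⟨?_, hτ⟩
    have : 0 ≤ μ * (μ ^ 2 / 40) := by positivity
    rw [pow_zero]; linarith
  | succ t ih =>
    obtain ⟨c1, c2⟩ := crude ih.1 ih.2
    obtain ⟨s1, s2⟩ := local_phase_step h hT hα hρ0 hρ c1 c2
    have hb0 := slowRate_pos hα hμ t
    have hb1 := slowRate_le hα hμ t
    have hbs := slowRate_sub_succ_le hα hμ t
    have ha := hT.lower t
    have ha0 : 0 < a t := (mul_pos hα hμ).trans_le ha
    have ha1 : a t ≤ 1 / 100 := (hT.upper t).trans (by linarith)
    have hg0 : 0 ≤ fastRate α μ := by unfold fastRate; nlinarith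
    have hbμ : slowRate α μ t ≤ μ := by nlinarith only [hb1, hμ, hμ1]
    rw [pow_succ]
    exact ⟨local_phase_signal_step hα hμ hμ1 ha (by nlinarith) hρ (pow_nonneg hg0 t) rfl hb0
      hbμ hbs ih.1 (sq_nonneg _) ih.2 s1,
      local_phase_orthogonal_step ha0.le hμ hμ1 ha ha1 hρ0 hρ hb0 (hbμ.trans hμ1) hbs
      (fastRate_pow_le_slowRate hα hα1 hμ hμ1 t) (norm_nonneg _) ih.1 ih.2 s2⟩

lemma norm_residual_le_of_local_phase {F : ℕ → Matrix m k ℝ} (h : SpectralFrame X U Dh Di μ)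
    (hT : Trajectory X F a E α μ ρ) (hα : 0 < α) (hα1 : α ≤ 1)
    (hρ0 : 0 ≤ ρ) (hρ : ρ ≤ 1 / 1000)
    (hq : ‖Uᵀ * (F 0 * (F 0)ᵀ - X)‖ ≤ μ / 80)
    (hτ : ‖(1 - U * Uᵀ) * F 0‖ ^ 2 ≤ μ ^ 2 / 40) (t : ℕ) :
    ‖F t * (F t)ᵀ - X‖ ≤ fastRate α μ ^ t + 3 * slowRate α μ t := by
  obtain ⟨h1, h2, -, -⟩ := local_phase h hT hα hα1 hρ0 hρ hq hτ t
  have hμ := h.μ_pos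
  have hμ1 := h.μ_le
  have hR := h.norm_residual_le (F t)
  have hμ2 : μ ^ 2 ≤ 1 := pow_le_one₀ hμ.le hμ1
  have hg0 : 0 ≤ fastRate α μ := by unfold fastRate; nlinarith
  have hb := slowRate_pos hα hμ t
  nlinarith [pow_nonneg hg0 t, mul_le_mul_of_nonneg_right hμ1 hb.le,
    mul_le_mul_of_nonneg_right hμ1 (pow_nonneg hg0 t)]

/-- With k = r, τ ≤ 2q²/μ ≤ q, so the forcing of q by τ is absorbed into the contraction and no
sublinear term remains. -/
lemma norm_residual_le_of_local_phase_square {F : ℕ → Matrix m ι ℝ}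
    (h : SpectralFrame X U Dh Di μ)
    (hT : Trajectory X F a E α μ ρ) (hα : 0 < α) (hα1 : α ≤ 1)
    (hρ0 : 0 ≤ ρ) (hρ : ρ ≤ 1 / 1000)
    (hq : ‖Uᵀ * (F 0 * (F 0)ᵀ - X)‖ ≤ μ / 80)
    (hτ : ‖(1 - U * Uᵀ) * F 0‖ ^ 2 ≤ μ ^ 2 / 40) (t : ℕ) :
    ‖F t * (F t)ᵀ - X‖ ≤ fastRate α μ ^ t := by
  have hμ := h.μ_pos
  have hμ1 := h.μ_le
  have hμ2 : μ ^ 2 ≤ 1 := pow_le_one₀ hμ.le hμ1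
  have hg0 : 0 ≤ fastRate α μ := by unfold fastRate; nlinarith
  have hτq : ∀ t, ‖(1 - U * Uᵀ) * F t‖ ^ 2 ≤ ‖Uᵀ * (F t * (F t)ᵀ - X)‖ := by
    intro t
    obtain ⟨-, -, h3, -⟩ := local_phase h hT hα hα1 hρ0 hρ hq hτ t
    refine (h.norm_sq_proj_mul_le_of_square (F t) (by linarith)).trans ?_
    rw [div_le_iff₀ hμ]
    nlinarith [norm_nonneg (Uᵀ * (F t * (F t)ᵀ - X))]
  have hqt : ‖Uᵀ * (F t * (F t)ᵀ - X)‖ ≤ 1 / 80 * fastRate α μ ^ t := by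
    induction t with
    | zero => rw [pow_zero]; linarith
    | succ t ih =>
      obtain ⟨-, -, c1, c2⟩ := local_phase h hT hα hα1 hρ0 hρ hq hτ t
      obtain ⟨s1, -⟩ := local_phase_step h hT hα hρ0 hρ c1 c2
      have hst := hτq t
      have ha := hT.lower t
      have ha0 : 0 < a t := (mul_pos hα hμ).trans_le ha
      set q := ‖Uᵀ * (F t * (F t)ᵀ - X)‖
      have hq0 : 0 ≤ q := norm_nonneg _
      have e1 : 6 * a t * ρ * μ ^ 3 * ‖(1 - U * Uᵀ) * F t‖ ^ 2 ≤ 6 * a t * ρ * μ ^ 3 * q :=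
        mul_le_mul_of_nonneg_left hst (by positivity)
      have e2 : 6 * ρ * μ ^ 3 ≤ μ / 4 := by
        have : ρ * (μ * μ ^ 2) ≤ 1 / 1000 * (μ * 1) :=
          mul_le_mul hρ (mul_le_mul_of_nonneg_left hμ2 hμ.le) (by positivity) (by norm_num)
        nlinarith
      have e3 := mul_le_mul_of_nonneg_right e2 (mul_nonneg ha0.le hq0)
      have e4 : ‖Uᵀ * (F (t + 1) * (F (t + 1))ᵀ - X)‖ ≤ (1 - a t * μ / 4) * q := by nlinarith
      have e5 : (1 - a t * μ / 4) * q ≤ fastRate α μ * q := by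
        apply mul_le_mul_of_nonneg_right _ hq0
        unfold fastRate
        nlinarith
      rw [pow_succ]
      nlinarith [mul_le_mul_of_nonneg_left ih hg0]
  have hR := h.norm_residual_le (F t)
  have := hτq t
  linarith [pow_nonneg hg0 t]

end Trajectory

/-! ### One step of the warm phase -/

section Gram
variable {m ι k : Type*} [Fintype m] [Fintype ι] [Fintype k]
  [DecidableEq m] [DecidableEq ι] [DecidableEq k]

/-- The whitened Gram matrix of the signal part of `F`. -/
def gram (U : Matrix m ι ℝ) (Di : Matrix ι ι ℝ) (F : Matrix m k ℝ) : Matrix ι ι ℝ :=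
  (Di * Uᵀ * F) * (Di * Uᵀ * F)ᵀ

lemma gram_symm (U : Matrix m ι ℝ) (Di : Matrix ι ι ℝ) (F : Matrix m k ℝ) :
    (gram U Di F)ᵀ = gram U Di F := by
  rw [gram, transpose_mul, transpose_transpose]

lemma norm_gram (U : Matrix m ι ℝ) (Di : Matrix ι ι ℝ) (F : Matrix m k ℝ) :
    ‖gram U Di F‖ = ‖Di * Uᵀ * F‖ ^ 2 := norm_mul_transpose_self _

lemma norm_sq_whitened_le (U : Matrix m ι ℝ) (Di : Matrix ι ι ℝ) (F : Matrix m k ℝ) :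
    ‖Di * Uᵀ * F‖ ^ 2 ≤ 1 + ‖gram U Di F - 1‖ := by
  rw [← norm_gram]
  calc ‖gram U Di F‖ = ‖1 + (gram U Di F - 1)‖ := by rw [add_sub_cancel]
    _ ≤ _ := (norm_add_le _ _).trans (add_le_add_left norm_one_le _)

lemma gram_nonneg (U : Matrix m ι ℝ) (Di : Matrix ι ι ℝ) (F : Matrix m k ℝ) (x : ι → ℝ) :
    0 ≤ x ⬝ᵥ (gram U Di F *ᵥ x) := by
  rw [gram, ← mulVec_mulVec, dotProduct_mulVec, ← mulVec_transpose]
  exact dotProduct_self_nonneg' _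

variable {X : Matrix m m ℝ} {U : Matrix m ι ℝ} {Dh Di : Matrix ι ι ℝ} {μ a c C η ρ : ℝ}
  {F : Matrix m k ℝ} {E : Matrix m m ℝ}

/-- A priori bounds during the first phase. -/
structure WarmState (X : Matrix m m ℝ) (U : Matrix m ι ℝ) (Dh Di : Matrix ι ι ℝ) (μ a c C η ρ : ℝ)
    (F : Matrix m k ℝ) (E : Matrix m m ℝ) : Prop where
  frame : SpectralFrame X U Dh Di μ
  a_pos : 0 < a
  a_le : a ≤ μ / 100
  a_mul_le : a * c ≤ 4 / 5 * μ
  c_nonneg : 0 ≤ c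
  c_le : c ≤ C
  one_le : 1 ≤ C
  η_nonneg : 0 ≤ η
  η_le : 38 * C ^ 2 * η ≤ 1
  ρ_nonneg : 0 ≤ ρ
  ρ_le : ρ ≤ η
  gram_le : ‖gram U Di F - 1‖ ≤ 2 + c
  orth_le : ‖(1 - U * Uᵀ) * F‖ ^ 2 ≤ 2 * η * μ ^ 2
  error : ‖E‖ ≤ ρ * μ ^ 3 * ‖F * Fᵀ - X‖

namespace WarmState
variable (h : WarmState X U Dh Di μ a c C η ρ F E)
include h

lemma η_le_one : 38 * η ≤ 1 := by
  have := h.η_le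
  have h1 : 1 ≤ C ^ 2 := one_le_pow₀ h.one_le
  nlinarith [h.η_nonneg]

lemma norm_F_sq : ‖F‖ ^ 2 ≤ 4 + c := by
  have h1 := h.frame.norm_sq_le F
  have h2 := norm_sq_whitened_le U Di F
  have h3 := h.orth_le
  have h4 : μ ^ 2 ≤ 1 := pow_le_one₀ h.frame.μ_pos.le h.frame.μ_le
  have h5 := h.η_le_one
  have h6 := h.gram_le
  have : 2 * η * μ ^ 2 ≤ 2 * η * 1 := mul_le_mul_of_nonneg_left h4 (by linarith [h.η_nonneg])
  linarith

lemma norm_F : ‖F‖ ≤ 5 * C := by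
  have h1 := h.norm_F_sq
  have h2 := h.c_le
  have h3 := h.one_le
  nlinarith [norm_nonneg F]

lemma norm_whitened : ‖Di * Uᵀ * F‖ ≤ 4 * C := by
  have h1 := norm_sq_whitened_le U Di F
  have h2 := h.c_le
  have h3 := h.one_le
  have h4 := h.gram_le
  nlinarith [norm_nonneg (Di * Uᵀ * F)]

lemma norm_residual : ‖F * Fᵀ - X‖ ≤ 6 * C := by
  refine (norm_sub_le _ _).trans ?_
  rw [norm_mul_transpose_self]
  linarith [h.norm_F_sq, h.frame.norm_X, h.c_le, h.one_le]

lemma norm_E : ‖E‖ ≤ ρ * μ ^ 3 * (6 * C) :=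
  h.error.trans (mul_le_mul_of_nonneg_left h.norm_residual
    (mul_nonneg h.ρ_nonneg (pow_nonneg h.frame.μ_pos.le 3)))

lemma a_mul_norm_F_sq : a * ‖F‖ ^ 2 ≤ 1 := by
  have h1 := mul_le_mul_of_nonneg_left h.norm_F_sq h.a_pos.le
  linarith [h.a_le, h.a_mul_le, h.frame.μ_le]

/-- The constant is 2/100 + 4/5. Being below 1, it keeps 1 - a D (J - 1) invertible, however large c
is. -/
lemma a_mul_gram : a * ‖gram U Di F - 1‖ ≤ 82 / 100 * μ := by
  have h1 := mul_le_mul_of_nonneg_left h.gram_le h.a_pos.le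
  linarith [h.a_le, h.a_mul_le, h.frame.μ_le]

/-- The quadratic gain is discarded here; growth of order ρ²μ⁷ per step is harmless over the length
of the warm phase. -/
lemma orth_step : ‖(1 - U * Uᵀ) * (F - a • ((F * Fᵀ - X + E) * F))‖ ^ 2 ≤
    ‖(1 - U * Uᵀ) * F‖ ^ 2 + 2 * C ^ 2 * ρ ^ 2 * μ ^ 7 := by
  refine (h.frame.norm_sq_proj_step_le F E h.a_pos.le h.a_mul_norm_F_sq).trans ?_
  have h1 : ‖E‖ ^ 2 ≤ (ρ * μ ^ 3 * (6 * C)) ^ 2 := pow_le_pow_left₀ (norm_nonneg _) h.norm_E 2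
  have h2 : 3 * a * ‖E‖ ^ 2 ≤ 3 * (μ / 100) * (ρ * μ ^ 3 * (6 * C)) ^ 2 := by
    have := h.frame.μ_pos
    exact mul_le_mul (by linarith [h.a_le]) h1 (sq_nonneg _) (by positivity)
  have h3 : 0 ≤ a / 2 * (‖(1 - U * Uᵀ) * F‖ ^ 2) ^ 2 := by
    have := h.a_pos; positivity
  have h4 : 3 * (μ / 100) * (ρ * μ ^ 3 * (6 * C)) ^ 2 = 108 / 100 * (C ^ 2 * ρ ^ 2 * μ ^ 7) := by
    ring
  have h5 : 0 ≤ C ^ 2 * ρ ^ 2 * μ ^ 7 := by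
    have := h.frame.μ_pos; positivity
  linarith

lemma exists_perturbation : ∃ Ω : Matrix ι ι ℝ,
    gram U Di (F - a • ((F * Fᵀ - X + E) * F)) =
      (1 - (gram U Di F - 1) * a • (Dh * Dh)) * (1 + (gram U Di F - 1)) *
        (1 - (gram U Di F - 1) * a • (Dh * Dh))ᵀ + Ω ∧
      ‖Ω‖ ≤ a * (700 * C ^ 3 * η) * μ ^ 2 := by
  have hμ := h.frame.μ_pos
  have hμ1 := h.frame.μ_le
  have hC := h.one_le
  have hη := h.η_nonneg
  have ha := h.a_pos
  -- 38 = 8 + 30. Whitening costs one power of μ, so an error of order μ³ becomes μ², the order of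
  -- the orthogonal part.
  have hν : ‖Di * Uᵀ * F‖ * ‖(1 - U * Uᵀ) * F‖ ^ 2 + 1 / μ * ‖E‖ * ‖F‖ ≤
      38 * C ^ 2 * η * μ ^ 2 := by
    have e1 : ‖Di * Uᵀ * F‖ * ‖(1 - U * Uᵀ) * F‖ ^ 2 ≤ 4 * C * (2 * η * μ ^ 2) :=
      mul_le_mul h.norm_whitened h.orth_le (sq_nonneg _) (by positivity)
    have e2 : 1 / μ * ‖E‖ * ‖F‖ ≤ 1 / μ * (η * μ ^ 3 * (6 * C)) * (5 * C) := by
      refine mul_le_mul (mul_le_mul_of_nonneg_left (h.norm_E.trans ?_) (by positivity)) h.norm_F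
        (norm_nonneg _) (by positivity)
      exact mul_le_mul_of_nonneg_right (mul_le_mul_of_nonneg_right h.ρ_le (by positivity))
        (by positivity)
    have e3 : 1 / μ * (η * μ ^ 3 * (6 * C)) * (5 * C) = 30 * C ^ 2 * η * μ ^ 2 := by
      field_simp; ring
    have e4 : C * (η * μ ^ 2) ≤ C ^ 2 * (η * μ ^ 2) :=
      mul_le_mul_of_nonneg_right (by nlinarith) (by positivity)
    linarith
  obtain ⟨Ω, h1, h2⟩ := h.frame.exists_gram_step F E ha.le hν
    (Y := gram U Di F - 1) (B := 1 - (gram U Di F - 1) * a • (Dh * Dh)) rfl rfl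
  refine ⟨Ω, h1, h2.trans ?_⟩
  have hB : ‖1 - (gram U Di F - 1) * a • (Dh * Dh)‖ ≤ 2 := by
    refine (norm_sub_le _ _).trans ?_
    have e1 : ‖(gram U Di F - 1) * a • (Dh * Dh)‖ ≤ ‖gram U Di F - 1‖ * (a * 1) := by
      refine norm_mul_le_of_le le_rfl ?_
      rw [norm_smul, Real.norm_of_nonneg ha.le]
      exact mul_le_mul_of_nonneg_left h.frame.norm_D ha.le
    linarith [norm_one_le (n := ι), h.a_mul_gram]
  set ν := 38 * C ^ 2 * η * μ ^ 2 with hνd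
  have hν0 : 0 ≤ ν := by positivity
  have hν1 : ν ≤ 1 := by
    have : μ ^ 2 ≤ 1 := pow_le_one₀ hμ.le hμ1
    calc ν ≤ 1 * 1 := mul_le_mul h.η_le this (sq_nonneg μ) zero_le_one
      _ = 1 := mul_one 1
  have e1 : 2 * ‖1 - (gram U Di F - 1) * a • (Dh * Dh)‖ * ‖Di * Uᵀ * F‖ * ν ≤
      2 * 2 * (4 * C) * ν := by
    apply mul_le_mul_of_nonneg_right _ hν0
    exact mul_le_mul (by linarith) h.norm_whitened (norm_nonneg _) (by norm_num)
  have e2 : a * ν ^ 2 ≤ C * ν := by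
    have : a * ν ≤ 1 := by nlinarith [h.a_le]
    nlinarith
  have e3 : 17 * (C * ν) ≤ 700 * C ^ 3 * η * μ ^ 2 := by
    have : 0 ≤ C ^ 3 * η * μ ^ 2 := by positivity
    rw [hνd]; nlinarith
  calc a * (2 * ‖1 - (gram U Di F - 1) * a • (Dh * Dh)‖ * ‖Di * Uᵀ * F‖ * ν + a * ν ^ 2)
      ≤ a * (700 * C ^ 3 * η * μ ^ 2) := mul_le_mul_of_nonneg_left (by linarith) ha.le
    _ = _ := by ring

lemma gram_step : ‖gram U Di (F - a • ((F * Fᵀ - X + E) * F)) - 1‖ ≤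
    max 1 ((1 - 2 * a * μ) * ‖gram U Di F - 1‖) + a * (700 * C ^ 3 * η) * μ ^ 2 := by
  obtain ⟨Ω, h1, h2⟩ := h.exists_perturbation
  have hμ1 := h.frame.μ_le
  have h3 := norm_congr_sub_one_le (Y := gram U Di F - 1) (a := a) h.a_pos.le
    (by linarith [h.a_le]) h.frame.norm_one_sub h.frame.Dh_symm rfl h.frame.norm_Dh
    (by rw [transpose_sub, gram_symm, transpose_one])
    (fun x => by rw [add_sub_cancel]; exact gram_nonneg U Di F x)
    (by linarith [h.a_mul_gram, h.a_le])
  rw [h1, add_sub_right_comm]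
  exact (norm_add_le _ _).trans (add_le_add h3 h2)

/-- One step of the inverse of the whitened Gram matrix. -/
lemma inverse_step {V : Matrix ι ι ℝ} {q β θ : ℝ} (hVJ : V * gram U Di F = 1)
    (hJV : gram U Di F * V = 1) (hq : a * ‖gram U Di F - 1‖ ≤ q) (hq1 : q < 1)
    (hβ : 1 - 2 * a * μ + a ^ 2 * ‖gram U Di F - 1‖ *
      (2 * (1 / (1 - q)) + (1 / (1 - q)) ^ 2) ≤ β) (hβ1 : β ≤ 2)
    (hθ : 8 * (700 * C ^ 3 * η) * (1 + ‖V - 1‖) ≤ θ) (hθ1 : θ ≤ 1) :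
    ∃ V' : Matrix ι ι ℝ, V' * gram U Di (F - a • ((F * Fᵀ - X + E) * F)) = 1 ∧
      gram U Di (F - a • ((F * Fᵀ - X + E) * F)) * V' = 1 ∧
      ‖V' - 1‖ ≤ β * ‖V - 1‖ + a * θ * μ ^ 2 * (1 + β * ‖V - 1‖) / 2 := by
  obtain ⟨Ω, h1, h2⟩ := h.exists_perturbation
  have hμ := h.frame.μ_pos
  have hμ1 := h.frame.μ_le
  have ha := h.a_pos
  have ha2 := h.a_le
  obtain ⟨W, w1, w2, w3⟩ := exists_inverse_congr (Y := gram U Di F - 1) (V := V) ha.le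
    (by linarith) h.frame.norm_one_sub h.frame.D_symm h.frame.norm_D
    (by rw [transpose_sub, gram_symm, transpose_one]) (by rwa [add_sub_cancel])
    (by rwa [add_sub_cancel]) hq hq1
  set z := ‖V - 1‖ with hz
  have hz0 : 0 ≤ z := norm_nonneg _
  have w4 : ‖W - 1‖ ≤ β * z := w3.trans (mul_le_mul_of_nonneg_right hβ hz0)
  set x := 1 + β * z with hx
  have hWn : ‖W‖ ≤ x := by
    calc ‖W‖ = ‖1 + (W - 1)‖ := by rw [add_sub_cancel]
      _ ≤ ‖(1 : Matrix ι ι ℝ)‖ + ‖W - 1‖ := norm_add_le _ _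
      _ ≤ _ := add_le_add norm_one_le w4
  have hx0 : 0 ≤ x := (norm_nonneg _).trans hWn
  set ω := 700 * C ^ 3 * η with hω
  have hω0 : 0 ≤ ω := by
    have := h.one_le
    have := h.η_nonneg
    positivity
  have hωx : ω * x ≤ θ / 4 := by
    have : x ≤ 2 * (1 + z) := by nlinarith
    nlinarith [mul_le_mul_of_nonneg_left this hω0]
  have hμ2 : μ ^ 2 ≤ 1 := pow_le_one₀ hμ.le hμ1
  have haμ : a * μ ^ 2 ≤ 1 := by nlinarith
  have hΩW : ‖Ω‖ * ‖W‖ ≤ a * μ ^ 2 * (θ / 4) := by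
    calc ‖Ω‖ * ‖W‖ ≤ a * ω * μ ^ 2 * x := mul_le_mul h2 hWn (norm_nonneg _) (by positivity)
      _ = a * μ ^ 2 * (ω * x) := by ring
      _ ≤ _ := mul_le_mul_of_nonneg_left hωx (by positivity)
  have hθ0 : 0 ≤ θ := by
    have : 0 ≤ ω * x := by positivity
    linarith
  obtain ⟨V', v1, v2, v3⟩ := exists_inverse_add w1 w2 (Ω := Ω) (by nlinarith)
  rw [← h1] at v1 v2
  refine ⟨V', v1, v2, ?_⟩
  have e1 : ‖V' - 1‖ ≤ ‖V' - W‖ + ‖W - 1‖ := by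
    rw [← sub_add_sub_cancel V' W 1]; exact norm_add_le _ _
  have e2 : 2 * ‖Ω‖ * ‖W‖ ^ 2 ≤ a * θ * μ ^ 2 * x / 2 := by
    have : ‖Ω‖ * ‖W‖ * ‖W‖ ≤ a * μ ^ 2 * (θ / 4) * x :=
      mul_le_mul hΩW hWn (norm_nonneg _) (by positivity)
    nlinarith
  linarith

/-- The inverse may grow slowly while the Gram matrix is still large. -/
lemma inverse_step_growth {V : Matrix ι ι ℝ} {θ : ℝ} (hVJ : V * gram U Di F = 1)
    (hJV : gram U Di F * V = 1)
    (hθ : 8 * (700 * C ^ 3 * η) * (1 + ‖V - 1‖) ≤ θ) (hθ1 : θ ≤ 1) :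
    ∃ V' : Matrix ι ι ℝ, V' * gram U Di (F - a • ((F * Fᵀ - X + E) * F)) = 1 ∧
      gram U Di (F - a • ((F * Fᵀ - X + E) * F)) * V' = 1 ∧
      1 + ‖V' - 1‖ ≤ (1 + 35 / 100 * μ ^ 2) * (1 + ‖V - 1‖) := by
  have hμ := h.frame.μ_pos
  have hμ1 := h.frame.μ_le
  have ha := h.a_pos
  have ha2 := h.a_le
  have hg := h.a_mul_gram
  have haμ : a * μ ≤ μ ^ 2 / 100 := by nlinarith
  have hμ2 : μ ^ 2 ≤ 1 := pow_le_one₀ hμ.le hμ1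
  -- No contraction is available yet: with a‖J - 1‖ ≤ 0.82 μ, the second-order term is below 35 aμ,
  -- and a ≤ μ/100.
  have hβ : 1 - 2 * a * μ + a ^ 2 * ‖gram U Di F - 1‖ *
      (2 * (1 / (1 - 82 / 100)) + (1 / (1 - 82 / 100)) ^ 2) ≤ 1 + 33 / 100 * μ ^ 2 := by
    have e1 : a * (a * ‖gram U Di F - 1‖) ≤ a * (82 / 100 * μ) :=
      mul_le_mul_of_nonneg_left hg ha.le
    have e2 : a ^ 2 * ‖gram U Di F - 1‖ *
      (2 * (1 / (1 - 82 / 100)) + (1 / (1 - 82 / 100)) ^ 2) =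
      a * (a * ‖gram U Di F - 1‖) * (3400 / 81) := by ring
    rw [e2]
    nlinarith
  obtain ⟨V', v1, v2, v3⟩ := h.inverse_step hVJ hJV (q := 82 / 100) (by linarith) (by norm_num) hβ
    (by linarith) hθ hθ1
  refine ⟨V', v1, v2, ?_⟩
  set z := ‖V - 1‖ with hz
  have hz0 : 0 ≤ z := norm_nonneg _
  have e1 : a * θ * μ ^ 2 ≤ μ ^ 2 / 100 := by
    have : a * θ ≤ 1 / 100 * 1 := by
      have hθ0 : 0 ≤ θ := by
        refine le_trans ?_ hθ
        have := h.one_le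
        have := h.η_nonneg
        positivity
      exact mul_le_mul (by linarith) hθ1 hθ0 (by norm_num)
    nlinarith [sq_nonneg μ]
  have hx0 : 0 ≤ 1 + (1 + 33 / 100 * μ ^ 2) * z := by positivity
  have e2 := mul_le_mul_of_nonneg_right e1 hx0
  have e3 : μ ^ 2 * (μ ^ 2 * z) ≤ 1 * (μ ^ 2 * z) :=
    mul_le_mul_of_nonneg_right hμ2 (by positivity)
  have e4 : 0 ≤ μ ^ 2 * z := by positivity
  nlinarith

/-- The inverse contracts to the identity once the Gram matrix is bounded by a constant. -/
lemma inverse_step_contraction {V : Matrix ι ι ℝ} {θ : ℝ} (hVJ : V * gram U Di F = 1)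
    (hJV : gram U Di F * V = 1) (hy : ‖gram U Di F - 1‖ ≤ 2)
    (hθ : 8 * (700 * C ^ 3 * η) * (1 + ‖V - 1‖) ≤ θ) (hθ1 : θ ≤ 1) :
    ∃ V' : Matrix ι ι ℝ, V' * gram U Di (F - a • ((F * Fᵀ - X + E) * F)) = 1 ∧
      gram U Di (F - a • ((F * Fᵀ - X + E) * F)) * V' = 1 ∧
      ‖V' - 1‖ ≤ (1 - a * μ) * ‖V - 1‖ + a * θ * μ ^ 2 := by
  have hμ := h.frame.μ_pos
  have hμ1 := h.frame.μ_le
  have ha := h.a_pos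
  have ha2 := h.a_le
  -- Now ‖J - 1‖ ≤ 2 makes the second-order term at most (8/100) aμ, so nearly all of 2aμ survives.
  have hβ : 1 - 2 * a * μ + a ^ 2 * ‖gram U Di F - 1‖ *
      (2 * (1 / (1 - 2 / 100)) + (1 / (1 - 2 / 100)) ^ 2) ≤ 1 - 19 / 10 * a * μ := by
    have e1 : a ^ 2 * ‖gram U Di F - 1‖ ≤ a * (μ / 100) * 2 := by
      refine mul_le_mul ?_ hy (norm_nonneg _) (by positivity)
      nlinarith
    have e2 : (2 * (1 / (1 - 2 / 100)) + (1 / (1 - 2 / 100)) ^ 2 : ℝ) ≤ 4 := by norm_num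
    have e3 : a ^ 2 * ‖gram U Di F - 1‖ * (2 * (1 / (1 - 2 / 100)) + (1 / (1 - 2 / 100)) ^ 2) ≤
      a * (μ / 100) * 2 * 4 := mul_le_mul e1 e2 (by norm_num) (by positivity)
    nlinarith [mul_pos ha hμ]
  have haμ : a * μ ≤ 1 / 100 := by nlinarith
  obtain ⟨V', v1, v2, v3⟩ := h.inverse_step hVJ hJV (q := 2 / 100) (by nlinarith) (by norm_num) hβ
    (by nlinarith) hθ hθ1
  refine ⟨V', v1, v2, v3.trans ?_⟩
  set z := ‖V - 1‖ with hz
  have hz0 : 0 ≤ z := norm_nonneg _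
  have hθ0 : 0 ≤ θ := by
    refine le_trans ?_ hθ
    have := h.one_le
    have := h.η_nonneg
    positivity
  have haμ0 : 0 < a * μ := mul_pos ha hμ
  have e1 : (1 - 19 / 10 * a * μ) * z ≤ z := by nlinarith
  have e2 : a * θ * μ ^ 2 * (1 + (1 - 19 / 10 * a * μ) * z) ≤ a * θ * μ ^ 2 * (1 + z) :=
    mul_le_mul_of_nonneg_left (by linarith) (by positivity)
  have e3 : a * θ * μ ^ 2 * z ≤ a * μ * z := by
    have : θ * μ ≤ 1 := by nlinarith
    have := mul_le_mul_of_nonneg_left this (mul_nonneg haμ0.le hz0)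
    nlinarith
  have e4 : 0 ≤ a * θ * μ ^ 2 := by positivity
  have e5 : 0 ≤ a * μ * z := by positivity
  nlinarith

end WarmState
end Gram

/-! ### The warm phase as a whole -/

section Warm
variable {m ι k : Type*} [Fintype m] [Fintype ι] [Fintype k]
  [DecidableEq m] [DecidableEq ι] [DecidableEq k]

/-- The hypotheses under which the first `N` steps are analysed. -/
structure WarmPhase (X : Matrix m m ℝ) (U : Matrix m ι ℝ) (Dh Di : Matrix ι ι ℝ)
    (F : ℕ → Matrix m k ℝ) (a : ℕ → ℝ) (E : ℕ → Matrix m m ℝ)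
    (α μ ρ c C c₀ ε K : ℝ) (N : ℕ) : Prop where
  frame : SpectralFrame X U Dh Di μ
  traj : Trajectory X F a E α μ ρ
  α_pos : 0 < α
  α_le : α ≤ 1
  a_mul_le : ∀ t, a t * c ≤ 4 / 5 * μ
  ε_pos : 0 < ε
  ε_le : ε ≤ 1
  ε_le_c : ε ≤ c
  c_le : c ≤ C
  one_le_C : 1 ≤ C
  one_le_K : 1 ≤ K
  c₀_pos : 0 < c₀
  c₀_le : 33600 * C ^ 3 * K * c₀ ≤ 1 / 1000
  ρ_nonneg : 0 ≤ ρ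
  ρ_le : ρ ≤ c₀ * ε
  length : 2 * C ^ 2 * ρ ^ 2 * μ ^ 5 * N ≤ c₀ * ε
  init : ‖F 0 * (F 0)ᵀ - c • X‖ ≤ c₀ * ε * μ ^ 2

namespace WarmPhase
variable {X : Matrix m m ℝ} {U : Matrix m ι ℝ} {Dh Di : Matrix ι ι ℝ} {F : ℕ → Matrix m k ℝ}
  {a : ℕ → ℝ} {E : ℕ → Matrix m m ℝ} {α μ ρ c C c₀ ε K : ℝ} {N : ℕ}
  (h : WarmPhase X U Dh Di F a E α μ ρ c C c₀ ε K N)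
include h

lemma C3_le : 33600 * (C ^ 3 * c₀) ≤ 1 / 1000 := by
  have h0 : 0 ≤ C ^ 3 * c₀ := mul_nonneg (pow_nonneg (zero_le_one.trans h.one_le_C) 3) h.c₀_pos.le
  have h2 : 33600 * C ^ 3 * K * c₀ = 33600 * (K * (C ^ 3 * c₀)) := by ring
  have h1 := h.c₀_le
  have h3 := mul_le_mul_of_nonneg_right h.one_le_K h0
  linarith

lemma c₀_small : 33600 * c₀ ≤ 1 / 1000 := by
  have h1 : 1 * c₀ ≤ C ^ 3 * c₀ :=
    mul_le_mul_of_nonneg_right (one_le_pow₀ h.one_le_C) h.c₀_pos.le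
  linarith [h.C3_le]

lemma ω_le : 700 * C ^ 3 * (c₀ * ε) ≤ 1 / 2 := by
  have h0 : 0 ≤ C ^ 3 * c₀ := mul_nonneg (pow_nonneg (zero_le_one.trans h.one_le_C) 3) h.c₀_pos.le
  have h1 := mul_le_mul_of_nonneg_left h.ε_le h0
  have h2 := h.C3_le
  linarith

lemma ω_nonneg : 0 ≤ 700 * C ^ 3 * (c₀ * ε) := by
  have := h.one_le_C
  have := h.c₀_pos
  have := h.ε_pos
  positivity

lemma c_pos : 0 < c := h.ε_pos.trans_le h.ε_le_c

lemma a_pos (t : ℕ) : 0 < a t := (mul_pos h.α_pos h.frame.μ_pos).trans_le (h.traj.lower t)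

lemma rate_le (t : ℕ) : α * μ ^ 2 ≤ a t * μ := by
  calc α * μ ^ 2 = α * μ * μ := by ring
    _ ≤ a t * μ := mul_le_mul_of_nonneg_right (h.traj.lower t) h.frame.μ_pos.le

lemma base_nonneg : 0 ≤ 1 - 2 * α * μ ^ 2 := by
  have h1 := h.rate_le 0
  have h2 := h.traj.upper 0
  have h3 := h.frame.μ_pos
  have h4 := h.frame.μ_le
  nlinarith

lemma warmState {t : ℕ} (hy : ‖gram U Di (F t) - 1‖ ≤ 2 + c)
    (hτ : ‖(1 - U * Uᵀ) * F t‖ ^ 2 ≤ 2 * (c₀ * ε) * μ ^ 2) :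
    WarmState X U Dh Di μ (a t) c C (c₀ * ε) ρ (F t) (E t) where
  frame := h.frame
  a_pos := h.a_pos t
  a_le := h.traj.upper t
  a_mul_le := h.a_mul_le t
  c_nonneg := h.c_pos.le
  c_le := h.c_le
  one_le := h.one_le_C
  η_nonneg := mul_nonneg h.c₀_pos.le h.ε_pos.le
  η_le := by
    have h1 : C ^ 2 * (c₀ * ε) ≤ C ^ 3 * (c₀ * ε) :=
      mul_le_mul_of_nonneg_right (pow_le_pow_right₀ h.one_le_C (by norm_num))
        (mul_nonneg h.c₀_pos.le h.ε_pos.le)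
    linarith [h.ω_le, h.ω_nonneg]
  ρ_nonneg := h.ρ_nonneg
  ρ_le := h.ρ_le
  gram_le := hy
  orth_le := hτ
  error := h.traj.error t

/-- Whitening sends c X to c · 1 and costs at most μ⁻², which cancels the μ² in the initialization.
-/
lemma gram_init : ‖gram U Di (F 0) - c • (1 : Matrix ι ι ℝ)‖ ≤ c₀ * ε := by
  have hμ := h.frame.μ_pos
  have hid : gram U Di (F 0) - c • (1 : Matrix ι ι ℝ) =
      Di * Uᵀ * (F 0 * (F 0)ᵀ - c • X) * (Di * Uᵀ)ᵀ := by
    have e : Di * Uᵀ * X * (Di * Uᵀ)ᵀ = 1 := by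
      have e1 : Di * Uᵀ * X = Dh * Uᵀ := by
        rw [Matrix.mul_assoc, h.frame.Ut_mul_X, Matrix.mul_assoc, ← Matrix.mul_assoc Di,
          h.frame.inv_mul, Matrix.one_mul]
      rw [e1, transpose_mul, transpose_transpose, h.frame.Di_symm, Matrix.mul_assoc,
        ← Matrix.mul_assoc Uᵀ, h.frame.orth, Matrix.one_mul, h.frame.mul_inv]
    rw [Matrix.mul_sub, Matrix.sub_mul, Matrix.mul_smul, Matrix.smul_mul, e, gram,
      transpose_mul (Di * Uᵀ)]
    simp only [Matrix.mul_assoc]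
  have hDU : ‖Di * Uᵀ‖ ≤ 1 / μ * 1 := norm_mul_le_of_le h.frame.norm_Di h.frame.norm_Ut
  rw [hid]
  refine (norm_mul_le_of_le (norm_mul_le_of_le hDU h.init)
    ((norm_transpose' _).le.trans hDU)).trans (le_of_eq ?_)
  field_simp

/-- With ω = 700 C³ c₀ ε, the excess of ‖J - 1‖ over the floor 1 + ω decays geometrically. Each
perturbation aωμ² is paid for by the contraction of the floor itself. These bounds give the
`WarmState` that the next step requires. -/
lemma bounds {t : ℕ} (ht : t ≤ N) :
    ‖gram U Di (F t) - 1‖ ≤ 1 + 700 * C ^ 3 * (c₀ * ε) + c * (1 - 2 * α * μ ^ 2) ^ t ∧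
      ‖(1 - U * Uᵀ) * F t‖ ^ 2 ≤ c₀ * ε * μ ^ 2 + 2 * C ^ 2 * ρ ^ 2 * μ ^ 7 * t ∧
      WarmState X U Dh Di μ (a t) c C (c₀ * ε) ρ (F t) (E t) := by
  have hμ := h.frame.μ_pos
  have hb0 := h.base_nonneg
  have hb1 : 1 - 2 * α * μ ^ 2 ≤ 1 := by nlinarith [mul_pos h.α_pos (pow_pos hμ 2)]
  have hω := h.ω_le
  have hω0 := h.ω_nonneg
  have hη : 0 < c₀ * ε := mul_pos h.c₀_pos h.ε_pos
  have state : ∀ {t : ℕ}, t ≤ N →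
      ‖gram U Di (F t) - 1‖ ≤ 1 + 700 * C ^ 3 * (c₀ * ε) + c * (1 - 2 * α * μ ^ 2) ^ t →
      ‖(1 - U * Uᵀ) * F t‖ ^ 2 ≤ c₀ * ε * μ ^ 2 + 2 * C ^ 2 * ρ ^ 2 * μ ^ 7 * t →
      WarmState X U Dh Di μ (a t) c C (c₀ * ε) ρ (F t) (E t) := by
    intro t ht h1 h2
    refine h.warmState ?_ ?_
    · have : c * (1 - 2 * α * μ ^ 2) ^ t ≤ c * 1 :=
        mul_le_mul_of_nonneg_left (pow_le_one₀ hb0 hb1) h.c_pos.le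
      linarith
    · have e1 : (t : ℝ) ≤ N := by exact_mod_cast ht
      have e2 : 2 * C ^ 2 * ρ ^ 2 * μ ^ 7 * t ≤ c₀ * ε * μ ^ 2 := by
        calc 2 * C ^ 2 * ρ ^ 2 * μ ^ 7 * t ≤ 2 * C ^ 2 * ρ ^ 2 * μ ^ 7 * N :=
              mul_le_mul_of_nonneg_left e1 (by positivity)
          _ = (2 * C ^ 2 * ρ ^ 2 * μ ^ 5 * N) * μ ^ 2 := by ring
          _ ≤ _ := mul_le_mul_of_nonneg_right h.length (sq_nonneg μ)
      linarith
  suffices hs : ‖gram U Di (F t) - 1‖ ≤ 1 + 700 * C ^ 3 * (c₀ * ε) + c * (1 - 2 * α * μ ^ 2) ^ t ∧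
      ‖(1 - U * Uᵀ) * F t‖ ^ 2 ≤ c₀ * ε * μ ^ 2 + 2 * C ^ 2 * ρ ^ 2 * μ ^ 7 * t from
    ⟨hs.1, hs.2, state ht hs.1 hs.2⟩
  induction t with
  | zero =>
    constructor
    · have e1 : gram U Di (F 0) - 1 = (gram U Di (F 0) - c • (1 : Matrix ι ι ℝ)) +
          (c - 1) • (1 : Matrix ι ι ℝ) := by module
      have e2 : ‖(c - 1) • (1 : Matrix ι ι ℝ)‖ ≤ (1 + c) * 1 := by
        rw [norm_smul]
        refine mul_le_mul ?_ norm_one_le (norm_nonneg _) (by linarith [h.c_pos])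
        rw [Real.norm_eq_abs, abs_le]
        constructor <;> linarith [h.c_pos]
      have e3 : 1 * (c₀ * ε) ≤ C ^ 3 * (c₀ * ε) :=
        mul_le_mul_of_nonneg_right (one_le_pow₀ h.one_le_C) hη.le
      rw [e1, pow_zero]
      refine (norm_add_le _ _).trans ?_
      linarith [h.gram_init]
    · have := h.frame.norm_sq_proj_mul_le (F 0) c
      simp only [Nat.cast_zero, mul_zero, add_zero]
      exact this.trans h.init
  | succ t ih =>
    obtain ⟨h1, h2⟩ := ih (by omega)
    have hs := state (by omega) h1 h2
    have hr := h.rate_le t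
    have ha := h.a_pos t
    have hau := h.traj.upper t
    have hμ1 := h.frame.μ_le
    constructor
    · rw [h.traj.step t]
      refine hs.gram_step.trans ?_
      set ω := 700 * C ^ 3 * (c₀ * ε)
      set p := c * (1 - 2 * α * μ ^ 2) ^ t with hp
      have hp0 : 0 ≤ p := mul_nonneg h.c_pos.le (pow_nonneg hb0 t)
      have e1 : c * (1 - 2 * α * μ ^ 2) ^ (t + 1) = p * (1 - 2 * α * μ ^ 2) := by
        rw [hp, pow_succ]; ring
      rw [e1]
      have haμ : a t * μ ≤ 1 / 100 := by nlinarith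
      have haμ2 : a t * μ ^ 2 ≤ a t * μ := by
        have := mul_le_mul_of_nonneg_left hμ1 (mul_pos ha hμ).le
        nlinarith
      have e2 : a t * ω * μ ^ 2 ≤ a t * μ * ω := by nlinarith
      have haμ0 := mul_pos ha hμ
      have e3 : max 1 ((1 - 2 * a t * μ) * ‖gram U Di (F t) - 1‖) ≤
          1 + ω - a t * ω * μ ^ 2 + p * (1 - 2 * α * μ ^ 2) := by
        apply max_le
        · have := mul_nonneg hp0 hb0
          nlinarith
        · have e4 : (1 - 2 * a t * μ) * ‖gram U Di (F t) - 1‖ ≤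
              (1 - 2 * a t * μ) * (1 + ω + p) := mul_le_mul_of_nonneg_left h1 (by linarith)
          have e5 : (1 - 2 * a t * μ) * p ≤ p * (1 - 2 * α * μ ^ 2) := by nlinarith
          have e6 := mul_nonneg haμ0.le hω0
          nlinarith
      linarith
    · rw [h.traj.step t]
      refine hs.orth_step.trans ?_
      push_cast
      linarith

lemma inverse_init : ∃ V : Matrix ι ι ℝ, V * gram U Di (F 0) = 1 ∧ gram U Di (F 0) * V = 1 ∧
    1 + ‖V - 1‖ ≤ 4 / ε := by
  have hc := h.c_pos
  have hε := h.ε_pos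
  have hc₀ := h.c₀_small
  have hg := h.gram_init
  set M := -(c⁻¹ • (gram U Di (F 0) - c • (1 : Matrix ι ι ℝ))) with hM
  have hMn : ‖M‖ ≤ 1 / 2 := by
    rw [hM, norm_neg, norm_smul, Real.norm_of_nonneg (inv_pos.2 hc).le, inv_mul_le_iff₀ hc]
    have : c₀ * ε ≤ 1 / 2 * ε := mul_le_mul_of_nonneg_right (by linarith [h.c₀_pos]) hε.le
    linarith [h.ε_le_c]
  obtain ⟨A, hA1, hA2, hAn⟩ := exists_inverse_one_sub hMn (by norm_num)
  have hJ : gram U Di (F 0) = c • (1 - M) := by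
    rw [hM, smul_sub, smul_neg, smul_smul, mul_inv_cancel₀ hc.ne', one_smul]
    abel
  refine ⟨c⁻¹ • A, ?_, ?_, ?_⟩
  · rw [hJ, smul_mul_smul_comm, inv_mul_cancel₀ hc.ne', hA1, one_smul]
  · rw [hJ, smul_mul_smul_comm, mul_inv_cancel₀ hc.ne', hA2, one_smul]
  · have e1 : ‖c⁻¹ • A‖ ≤ 2 / ε := by
      rw [norm_smul, Real.norm_of_nonneg (inv_pos.2 hc).le]
      have : c⁻¹ ≤ ε⁻¹ := inv_anti₀ hε h.ε_le_c
      calc c⁻¹ * ‖A‖ ≤ ε⁻¹ * 2 :=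
            mul_le_mul this (by norm_num at hAn; exact hAn) (norm_nonneg _) (inv_pos.2 hε).le
        _ = 2 / ε := by ring
    have e2 : 1 ≤ 1 / ε := by rw [le_div_iff₀ hε]; linarith [h.ε_le]
    have e3 := norm_sub_le (c⁻¹ • A) 1
    have e4 := norm_one_le (n := ι)
    have e5 : 4 / ε = 2 / ε + 2 * (1 / ε) := by ring
    rw [e5]
    linarith

/-- The origin of 33600 = 8 · 700 · 6: the factor ε in the initialization compensates an inverse of
size 1/ε. -/
lemma θ_le {x : ℝ} (hx : x ≤ 6 * K / ε) : 8 * (700 * C ^ 3 * (c₀ * ε)) * x ≤ 1 / 1000 := by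
  have hε := h.ε_pos
  have hω := h.ω_nonneg
  calc 8 * (700 * C ^ 3 * (c₀ * ε)) * x ≤ 8 * (700 * C ^ 3 * (c₀ * ε)) * (6 * K / ε) :=
        mul_le_mul_of_nonneg_left hx (by linarith)
    _ = 33600 * C ^ 3 * K * c₀ := by field_simp; ring
    _ ≤ 1 / 1000 := h.c₀_le

lemma inverse_growth {NA : ℕ} (hNA : NA ≤ N) (hK : (1 + 35 / 100 * μ ^ 2) ^ NA ≤ K) {t : ℕ}
    (ht : t ≤ NA) : ∃ V : Matrix ι ι ℝ, V * gram U Di (F t) = 1 ∧ gram U Di (F t) * V = 1 ∧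
      1 + ‖V - 1‖ ≤ 4 / ε * (1 + 35 / 100 * μ ^ 2) ^ t := by
  have hε := h.ε_pos
  have hb : 1 ≤ 1 + 35 / 100 * μ ^ 2 := by nlinarith [sq_nonneg μ]
  induction t with
  | zero => simpa using h.inverse_init
  | succ t ih =>
    obtain ⟨V, v1, v2, v3⟩ := ih (by omega)
    have hpow : (1 + 35 / 100 * μ ^ 2) ^ t ≤ K := (pow_le_pow_right₀ hb (by omega)).trans hK
    have hx : 1 + ‖V - 1‖ ≤ 6 * K / ε := by
      refine v3.trans ?_
      have : 4 / ε * (1 + 35 / 100 * μ ^ 2) ^ t ≤ 4 / ε * K :=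
        mul_le_mul_of_nonneg_left hpow (by positivity)
      refine this.trans ?_
      rw [div_mul_eq_mul_div]
      exact div_le_div_of_nonneg_right (by linarith [h.one_le_K]) hε.le
    obtain ⟨W, w1, w2, w3⟩ := (h.bounds (by omega : t ≤ N)).2.2.inverse_step_growth v1 v2
      (h.θ_le hx) (by norm_num)
    rw [h.traj.step t]
    refine ⟨W, w1, w2, w3.trans ?_⟩
    rw [pow_succ _ t]
    have := mul_le_mul_of_nonneg_left v3 (zero_le_one.trans hb)
    linarith

/-- After NA steps ‖J - 1‖ ≤ 2, so the inverse contracts. With θ = 1/1000 the perturbation is aμ ·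
μ/1000, which fixes the floor μ/1000. -/
lemma inverse_contraction {NA : ℕ} (hK : (1 + 35 / 100 * μ ^ 2) ^ NA ≤ K)
    (hNA1 : c * (1 - 2 * α * μ ^ 2) ^ NA ≤ 1 / 2) {s : ℕ} (hs : NA + s ≤ N) :
    ∃ V : Matrix ι ι ℝ, V * gram U Di (F (NA + s)) = 1 ∧ gram U Di (F (NA + s)) * V = 1 ∧
      ‖V - 1‖ ≤ 4 * K / ε * (1 - α * μ ^ 2) ^ s + 1 / 1000 * μ := by
  have hε := h.ε_pos
  have hμ := h.frame.μ_pos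
  have hμ1 := h.frame.μ_le
  have hb0 := h.base_nonneg
  have hαμ := mul_pos h.α_pos (pow_pos hμ 2)
  have hg0 : 0 ≤ 1 - α * μ ^ 2 := by linarith
  have hg1 : 1 - α * μ ^ 2 ≤ 1 := by linarith
  have hKε : 0 ≤ 4 * K / ε := by
    have := h.one_le_K
    positivity
  induction s with
  | zero =>
    obtain ⟨V, v1, v2, v3⟩ := h.inverse_growth (by omega) hK le_rfl
    refine ⟨V, v1, v2, ?_⟩
    have e1 : 4 / ε * (1 + 35 / 100 * μ ^ 2) ^ NA ≤ 4 / ε * K :=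
      mul_le_mul_of_nonneg_left hK (by positivity)
    have e2 : 4 / ε * K = 4 * K / ε := by ring
    rw [pow_zero]
    linarith
  | succ s ih =>
    obtain ⟨V, v1, v2, v3⟩ := ih (by omega)
    have hst := h.bounds (by omega : NA + s ≤ N)
    have hp : 4 * K / ε * (1 - α * μ ^ 2) ^ s ≤ 4 * K / ε * 1 :=
      mul_le_mul_of_nonneg_left (pow_le_one₀ hg0 hg1) hKε
    have hx : 1 + ‖V - 1‖ ≤ 6 * K / ε := by
      have e1 : 6 * K / ε = 4 * K / ε + 2 * (K / ε) := by ring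
      have e2 : 1 ≤ K / ε := by
        rw [le_div_iff₀ hε]; linarith [h.ε_le, h.one_le_K]
      rw [e1]; linarith
    have hy : ‖gram U Di (F (NA + s)) - 1‖ ≤ 2 := by
      have e1 : c * (1 - 2 * α * μ ^ 2) ^ (NA + s) ≤ c * (1 - 2 * α * μ ^ 2) ^ NA :=
        mul_le_mul_of_nonneg_left (pow_le_pow_of_le_one hb0 (by linarith) (by omega)) h.c_pos.le
      linarith [hst.1, h.ω_le]
    obtain ⟨W, w1, w2, w3⟩ := hst.2.2.inverse_step_contraction v1 v2 hy (h.θ_le hx) (by norm_num)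
    rw [← add_assoc, h.traj.step (NA + s)]
    refine ⟨W, w1, w2, w3.trans ?_⟩
    have hr := h.rate_le (NA + s)
    have haμ : a (NA + s) * μ ≤ 1 / 100 := by nlinarith [h.traj.upper (NA + s)]
    have hp0 : 0 ≤ 4 * K / ε * (1 - α * μ ^ 2) ^ s := mul_nonneg hKε (pow_nonneg hg0 s)
    rw [pow_succ _ s, ← mul_assoc]
    set p := 4 * K / ε * (1 - α * μ ^ 2) ^ s
    have e1 : (1 - a (NA + s) * μ) * ‖V - 1‖ ≤ (1 - a (NA + s) * μ) * (p + 1 / 1000 * μ) :=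
      mul_le_mul_of_nonneg_left v3 (by linarith)
    have e2 : (1 - a (NA + s) * μ) * p ≤ p * (1 - α * μ ^ 2) := by nlinarith
    linarith

/-- After the warm phase the iterates are in the basin of local convergence. -/
theorem conclusion {NA NB : ℕ} (hN : N = NA + NB) (hK : (1 + 35 / 100 * μ ^ 2) ^ NA ≤ K)
    (hNA1 : C * (1 - 2 * α * μ ^ 2) ^ NA ≤ 1 / 2)
    (hNB : 4 * K / ε * (1 - α * μ ^ 2) ^ NB ≤ μ / 1200) :
    (∀ t ≤ N, ‖F t * (F t)ᵀ - X‖ ≤ 6 * C) ∧ ‖Uᵀ * (F N * (F N)ᵀ - X)‖ ≤ μ / 80 ∧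
      ‖(1 - U * Uᵀ) * F N‖ ^ 2 ≤ μ ^ 2 / 40 := by
  have hμ := h.frame.μ_pos
  have hb0 := h.base_nonneg
  have hNA1' : c * (1 - 2 * α * μ ^ 2) ^ NA ≤ 1 / 2 :=
    (mul_le_mul_of_nonneg_right h.c_le (pow_nonneg hb0 _)).trans hNA1
  refine ⟨fun t ht => (h.bounds ht).2.2.norm_residual, ?_⟩
  obtain ⟨V, v1, v2, v3⟩ := h.inverse_contraction hK hNA1' (s := NB) (by omega)
  rw [← hN] at v1 v2
  obtain ⟨h1, -, hst⟩ := h.bounds (le_refl N)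
  have hαμ := mul_pos h.α_pos (pow_pos hμ 2)
  have hy : ‖gram U Di (F N) - 1‖ ≤ 2 := by
    have e1 : c * (1 - 2 * α * μ ^ 2) ^ N ≤ c * (1 - 2 * α * μ ^ 2) ^ NA :=
      mul_le_mul_of_nonneg_left (pow_le_pow_of_le_one hb0 (by linarith) (by omega)) h.c_pos.le
    linarith [h.ω_le]
  have hG := norm_sq_whitened_le U Di (F N)
  -- 11/6000 = 1/1200 + 1/1000. The bound passes back to J by J - 1 = -J (V - 1) and ‖J‖ ≤ 3.
  have hz : ‖V - 1‖ ≤ 11 / 6000 * μ := by linarith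
  have hY : ‖gram U Di (F N) - 1‖ ≤ 3 * (11 / 6000 * μ) := by
    have e1 : gram U Di (F N) - 1 = -(gram U Di (F N) * (V - 1)) := by
      rw [mul_sub, v2, mul_one, neg_sub]
    rw [e1, norm_neg]
    refine norm_mul_le_of_le ?_ hz
    rw [norm_gram]; linarith
  have hτ := hst.orth_le
  have hc₀ := h.c₀_small
  have hτ2 : ‖(1 - U * Uᵀ) * F N‖ ^ 2 ≤ (μ / 500) ^ 2 := by
    have e1 : c₀ * ε ≤ c₀ * 1 := mul_le_mul_of_nonneg_left h.ε_le h.c₀_pos.le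
    have e2 : 2 * (c₀ * ε) * μ ^ 2 ≤ (1 / 500) ^ 2 * μ ^ 2 :=
      mul_le_mul_of_nonneg_right (by linarith) (sq_nonneg μ)
    calc _ ≤ _ := hτ
      _ ≤ _ := e2
      _ = _ := by ring
  have hT : ‖(1 - U * Uᵀ) * F N‖ ≤ μ / 500 := le_of_sq_le_sq hτ2 (by positivity)
  have hGn : ‖Di * Uᵀ * F N‖ ≤ 2 := le_of_sq_le_sq (by linarith) (by norm_num)
  constructor
  · refine (h.frame.norm_Ut_mul_residual_le (F N)).trans ?_
    have e1 : ‖Di * Uᵀ * F N‖ * ‖(1 - U * Uᵀ) * F N‖ ≤ 2 * (μ / 500) :=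
      mul_le_mul hGn hT (norm_nonneg _) (by norm_num)
    change ‖gram U Di (F N) - 1‖ + _ ≤ _
    linarith
  · refine hτ2.trans ?_
    nlinarith [sq_nonneg μ]

end WarmPhase
end Warm

/-! ### Phase lengths and comparison of rates -/

section Lengths

lemma one_sub_pow_le_exp {x : ℝ} (hx : x ≤ 1) (n : ℕ) : (1 - x) ^ n ≤ Real.exp (-(x * n)) := by
  calc (1 - x) ^ n ≤ Real.exp (-x) ^ n :=
        pow_le_pow_left₀ (by linarith) (Real.one_sub_le_exp_neg x) n
    _ = Real.exp (-(x * n)) := by rw [← Real.exp_nat_mul]; congr 1; ring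

lemma exp_le_one_sub_pow {x : ℝ} (hx0 : 0 ≤ x) (hx : x ≤ 1 / 2) (n : ℕ) :
    Real.exp (-(2 * x * n)) ≤ (1 - x) ^ n := by
  have h1 : Real.exp (-(2 * x)) ≤ 1 - x := by
    have h2 : (1 - x) * (1 + 2 * x) ≥ 1 := by nlinarith
    have h3 := Real.add_one_le_exp (2 * x)
    rw [Real.exp_neg, inv_le_comm₀ (Real.exp_pos _) (by linarith)]
    refine le_trans ?_ h3
    rw [inv_le_iff_one_le_mul₀ (by linarith)]
    linarith
  calc Real.exp (-(2 * x * n)) = Real.exp (-(2 * x)) ^ n := by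
        rw [← Real.exp_nat_mul]; congr 1; ring
    _ ≤ (1 - x) ^ n := pow_le_pow_left₀ (Real.exp_pos _).le h1 n

/-- A number of steps that makes `(1 - x μ²)ⁿ` smaller than `1 / y`, with an upper bound. -/
lemma exists_length {x y μ : ℝ} (hx : 0 < x) (hy : 1 ≤ y) (hμ : 0 < μ) (hμ1 : μ ≤ 1)
    (hxμ : x * μ ^ 2 ≤ 1) :
    ∃ n : ℕ, y * (1 - x * μ ^ 2) ^ n ≤ 1 ∧ n * μ ^ 2 ≤ Real.log y / x + 1 := by
  have hμ2 : 0 < μ ^ 2 := by positivity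
  have hlog : 0 ≤ Real.log y := Real.log_nonneg hy
  refine ⟨⌈Real.log y / x / μ ^ 2⌉₊, ?_, ?_⟩
  · have h1 := Nat.le_ceil (Real.log y / x / μ ^ 2)
    set n := ⌈Real.log y / x / μ ^ 2⌉₊
    have h2 : Real.log y ≤ x * μ ^ 2 * n := by
      rw [div_div, div_le_iff₀ (by positivity)] at h1
      linarith
    calc y * (1 - x * μ ^ 2) ^ n ≤ y * Real.exp (-(x * μ ^ 2 * n)) :=
          mul_le_mul_of_nonneg_left (one_sub_pow_le_exp hxμ n) (by linarith)
      _ ≤ y * Real.exp (-Real.log y) :=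
          mul_le_mul_of_nonneg_left (Real.exp_le_exp.2 (by linarith)) (by linarith)
      _ = 1 := by
          rw [Real.exp_neg, Real.exp_log (by linarith), mul_inv_cancel₀ (by linarith)]
  · have h1 := (Nat.ceil_lt_add_one (show 0 ≤ Real.log y / x / μ ^ 2 by positivity)).le
    have h2 := mul_le_mul_of_nonneg_right h1 hμ2.le
    have h3 : μ ^ 2 ≤ 1 := pow_le_one₀ hμ.le hμ1
    have h4 : (Real.log y / x / μ ^ 2 + 1) * μ ^ 2 = Real.log y / x + μ ^ 2 := by
      field_simp
    linarith

/-- Reducing the excess of J takes O(μ⁻²) steps, with a constant free of ε; hence K, the growth of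
the inverse meanwhile, can be fixed before ε, as c₀ requires. Only the contraction from 4K/ε to
order μ costs a logarithm of μ⁻¹. -/
lemma exists_warm_lengths {α C : ℝ} (hα : 0 < α) (hα1 : α ≤ 1 / 2) (hC : 1 ≤ C) :
    ∃ K : ℝ, 1 ≤ K ∧ ∀ ε : ℝ, 0 < ε → ε ≤ 1 → ∃ L : ℝ, 0 < L ∧ ∀ μ : ℝ, 0 < μ → μ ≤ 1 →
      ∃ NA NB : ℕ, (1 + 35 / 100 * μ ^ 2) ^ NA ≤ K ∧ C * (1 - 2 * α * μ ^ 2) ^ NA ≤ 1 / 2 ∧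
        4 * K / ε * (1 - α * μ ^ 2) ^ NB ≤ μ / 1200 ∧
        ((NA + NB : ℕ) : ℝ) * μ ^ 2 ≤ L * (1 + Real.log μ⁻¹) := by
  have hlA : 0 ≤ Real.log (2 * C) / (2 * α) :=
    div_nonneg (Real.log_nonneg (by linarith)) (by linarith)
  set LA := Real.log (2 * C) / (2 * α) + 1 with hLA
  have hK : 1 ≤ Real.exp LA := Real.one_le_exp (by linarith)
  refine ⟨Real.exp LA, hK, fun ε hε hε1 => ?_⟩
  set K := Real.exp LA
  have hKε : 1 ≤ 4800 * K / ε := by rw [le_div_iff₀ hε]; linarith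
  have hlK := Real.log_nonneg hKε
  refine ⟨LA + Real.log (4800 * K / ε) / α + 1 / α + 1, ?_, fun μ hμ hμ1 => ?_⟩
  · have : 0 ≤ Real.log (4800 * K / ε) / α := by positivity
    positivity
  have hμ2 : μ ^ 2 ≤ 1 := pow_le_one₀ hμ.le hμ1
  have hμi : 1 ≤ μ⁻¹ := (one_le_inv₀ hμ).2 hμ1
  have hlμ := Real.log_nonneg hμi
  obtain ⟨NA, a1, a2⟩ := exists_length (x := 2 * α) (y := 2 * C) (by linarith) (by linarith) hμ hμ1
    (by nlinarith)
  obtain ⟨NB, b1, b2⟩ := exists_length (x := α) (y := 4800 * K / ε * μ⁻¹) hα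
    (one_le_mul_of_one_le_of_one_le hKε hμi) hμ hμ1 (by nlinarith)
  refine ⟨NA, NB, ?_, by linarith, ?_, ?_⟩
  · calc (1 + 35 / 100 * μ ^ 2) ^ NA ≤ Real.exp (μ ^ 2) ^ NA := by
          refine pow_le_pow_left₀ (by positivity) ?_ NA
          have := Real.add_one_le_exp (μ ^ 2)
          nlinarith [sq_nonneg μ]
      _ = Real.exp (NA * μ ^ 2) := by rw [← Real.exp_nat_mul]
      _ ≤ K := Real.exp_le_exp.2 a2
  · have e : 4800 * K / ε * μ⁻¹ * (1 - α * μ ^ 2) ^ NB =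
        (4 * K / ε * (1 - α * μ ^ 2) ^ NB) * 1200 / μ := by
      field_simp
      ring
    rw [e, div_le_one hμ] at b1
    linarith
  · rw [Real.log_mul (by positivity) (by positivity)] at b2
    push_cast
    have e1 : (Real.log (4800 * K / ε) + Real.log μ⁻¹) / α =
        Real.log (4800 * K / ε) / α + 1 / α * Real.log μ⁻¹ := by ring
    rw [e1] at b2
    have e2 : 0 ≤ (LA + Real.log (4800 * K / ε) / α + 1) * Real.log μ⁻¹ := by
      apply mul_nonneg _ hlμ
      have : 0 ≤ Real.log (4800 * K / ε) / α := by positivity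
      linarith
    have e3 : 0 < 1 / α := by positivity
    linarith

/-- With this prefactor the geometric rate stays above 1 through the whole warm phase, so it
dominates the constant bound valid there. -/
lemma fastRate_inv_pow_le {α μ L : ℝ} (hα : 0 < α) (hα1 : α ≤ 1 / 2) (hμ : 0 < μ) (hμ1 : μ ≤ 1)
    {N : ℕ} (hN : N * μ ^ 2 ≤ L * (1 + Real.log μ⁻¹)) :
    1 ≤ Real.exp (L * (1 + Real.log μ⁻¹)) * fastRate α μ ^ N := by
  have hμ2 : μ ^ 2 ≤ 1 := pow_le_one₀ hμ.le hμ1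
  have h1 := exp_le_one_sub_pow (x := α * μ ^ 2 / 4) (by positivity) (by nlinarith) N
  have h2 : Real.exp (-(L * (1 + Real.log μ⁻¹))) ≤ fastRate α μ ^ N := by
    refine le_trans (Real.exp_le_exp.2 ?_) h1
    have : 0 ≤ N * μ ^ 2 := by positivity
    nlinarith
  calc 1 = Real.exp (L * (1 + Real.log μ⁻¹)) * Real.exp (-(L * (1 + Real.log μ⁻¹))) := by
        rw [← Real.exp_add, add_neg_cancel, Real.exp_zero]
    _ ≤ _ := mul_le_mul_of_nonneg_left h2 (Real.exp_pos _).le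

lemma fastRate_nonneg {α μ : ℝ} (hα1 : α ≤ 1 / 2) (hμ : 0 < μ) (hμ1 : μ ≤ 1) :
    0 ≤ fastRate α μ := by
  have hμ2 : μ ^ 2 ≤ 1 := pow_le_one₀ hμ.le hμ1
  unfold fastRate; nlinarith [sq_nonneg μ]

lemma fastRate_le_one {α μ : ℝ} (hα : 0 < α) : fastRate α μ ≤ 1 := by
  unfold fastRate
  have : 0 ≤ α * μ ^ 2 := by positivity
  linarith

/-- The burn-in time gains the factor `μ²` over the length of the warm phase. -/
lemma fastRate_burnIn_le {α μ L : ℝ} (hα : 0 < α) (hα1 : α ≤ 1 / 2) (hμ : 0 < μ) (hμ1 : μ ≤ 1) :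
    Real.exp (L * (1 + Real.log μ⁻¹)) * fastRate α μ ^ burnIn (4 * (L + 2) / α) μ⁻¹ ≤
      Real.exp L * μ ^ 2 := by
  have hμ2 : μ ^ 2 ≤ 1 := pow_le_one₀ hμ.le hμ1
  have h1 := one_sub_pow_le_exp (x := α * μ ^ 2 / 4) (by nlinarith) (burnIn (4 * (L + 2) / α) μ⁻¹)
  have h2 : 4 * (L + 2) / α * μ⁻¹ ^ 2 * Real.log μ⁻¹ ≤ (burnIn (4 * (L + 2) / α) μ⁻¹ : ℕ) :=
    Nat.le_ceil _
  set T := burnIn (4 * (L + 2) / α) μ⁻¹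
  -- Of L + 2, the summand L cancels the power μ⁻ᴸ in the prefactor and 2 produces μ².
  have h3 : (L + 2) * Real.log μ⁻¹ ≤ α * μ ^ 2 / 4 * T := by
    calc (L + 2) * Real.log μ⁻¹ =
          α * μ ^ 2 / 4 * (4 * (L + 2) / α * μ⁻¹ ^ 2 * Real.log μ⁻¹) := by field_simp
      _ ≤ _ := mul_le_mul_of_nonneg_left h2 (by positivity)
  calc Real.exp (L * (1 + Real.log μ⁻¹)) * fastRate α μ ^ T
      ≤ Real.exp (L * (1 + Real.log μ⁻¹)) * Real.exp (-((L + 2) * Real.log μ⁻¹)) :=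
        mul_le_mul_of_nonneg_left (h1.trans (Real.exp_le_exp.2 (by linarith))) (Real.exp_pos _).le
    _ = Real.exp L * Real.exp (Real.log μ + Real.log μ) := by
        rw [← Real.exp_add, ← Real.exp_add, Real.log_inv]; congr 1; ring
    _ = Real.exp L * μ ^ 2 := by rw [Real.exp_add, Real.exp_log hμ, sq]

lemma slowRate_le_div {α μ : ℝ} (hα : 0 < α) (hα1 : α ≤ 1 / 2) (hμ : 0 < μ) (s : ℕ) :
    40 * slowRate α μ s ≤ 320 / α * (μ ^ 2 / (1 + μ ^ 3 * s)) := by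
  have h0 : 0 ≤ μ ^ 3 * s := by positivity
  have e : 40 * slowRate α μ s = μ ^ 2 / (1 + α / 320 * μ ^ 3 * s) := by
    unfold slowRate; field_simp
  have e2 : 320 / α * (μ ^ 2 / (1 + μ ^ 3 * s)) = μ ^ 2 / (α / 320 * (1 + μ ^ 3 * s)) := by
    field_simp
  rw [e, e2]
  apply div_le_div_of_nonneg_left (sq_nonneg μ) (by positivity)
  nlinarith

/-- As 1 + log μ⁻¹ ≤ μ⁻¹, the warm phase has μ³N ≤ L, so starting the clock N steps late costs only
a factor 1 + L. -/
lemma slowRate_shift_le {α μ L : ℝ} (hα : 0 < α) (hα1 : α ≤ 1 / 2) (hμ : 0 < μ)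
    (hL : 0 < L) {N s : ℕ} (hN : N * μ ^ 2 ≤ L * (1 + Real.log μ⁻¹)) :
    slowRate α μ s ≤ 8 * (1 + L) / α * (μ ^ 2 / (1 + μ ^ 3 * (N + s : ℕ))) := by
  have h1 := slowRate_le_div hα hα1 hμ s
  have hlog : 1 + Real.log μ⁻¹ ≤ μ⁻¹ := by linarith [Real.log_le_sub_one_of_pos (inv_pos.2 hμ)]
  have h2 : μ ^ 3 * N ≤ L := by
    calc μ ^ 3 * N = μ * (N * μ ^ 2) := by ring
      _ ≤ μ * (L * (1 + Real.log μ⁻¹)) := mul_le_mul_of_nonneg_left hN hμ.le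
      _ ≤ μ * (L * μ⁻¹) :=
        mul_le_mul_of_nonneg_left (mul_le_mul_of_nonneg_left hlog hL.le) hμ.le
      _ = L := by field_simp
  have h0 : 0 ≤ μ ^ 3 * s := by positivity
  have h3 : μ ^ 2 / (1 + μ ^ 3 * s) ≤ (1 + L) * (μ ^ 2 / (1 + μ ^ 3 * (N + s : ℕ))) := by
    rw [← mul_div_assoc, div_le_div_iff₀ (by positivity) (by positivity)]
    push_cast
    have : 1 + μ ^ 3 * (N + s) ≤ (1 + L) * (1 + μ ^ 3 * s) := by nlinarith
    nlinarith [mul_le_mul_of_nonneg_left this (sq_nonneg μ)]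
  have h4 : 320 / α * (μ ^ 2 / (1 + μ ^ 3 * s)) ≤
      320 / α * ((1 + L) * (μ ^ 2 / (1 + μ ^ 3 * (N + s : ℕ)))) :=
    mul_le_mul_of_nonneg_left h3 (by positivity)
  calc slowRate α μ s ≤ (320 / α * ((1 + L) * (μ ^ 2 / (1 + μ ^ 3 * (N + s : ℕ))))) / 40 := by
        linarith
    _ = _ := by ring

end Lengths

/-! ### Joining the two phases -/

section Core

/-- Convergence of perturbed gradient descent, normalized so that the largest singular value of
`X` is at most one. -/
theorem exists_convergence_constants {α C : ℝ} (hα : 0 < α) (hα1 : α ≤ 1 / 2) (hC : 1 ≤ C) :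
    ∃ c₀ : ℝ, 0 < c₀ ∧ ∀ ε : ℝ, 0 < ε → ε ≤ 1 → ∃ ρ c₄ B : ℝ, 0 < ρ ∧ 0 < c₄ ∧ 0 < B ∧
    ∀ (d r k : ℕ) (X : Matrix (Fin d) (Fin d) ℝ) (U : Matrix (Fin d) (Fin r) ℝ)
      (Dh Di : Matrix (Fin r) (Fin r) ℝ) (F : ℕ → Matrix (Fin d) (Fin k) ℝ) (a : ℕ → ℝ)
      (E : ℕ → Matrix (Fin d) (Fin d) ℝ) (μ c : ℝ),
      SpectralFrame X U Dh Di μ → Trajectory X F a E α μ ρ → (∀ t, a t * c ≤ 4 / 5 * μ) →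
      ε ≤ c → c ≤ C → ‖F 0 * (F 0)ᵀ - c • X‖ ≤ c₀ * ε * μ ^ 2 →
      (∀ t : ℕ, ‖F (t + burnIn c₄ μ⁻¹) * (F (t + burnIn c₄ μ⁻¹))ᵀ - X‖ ≤
        B * (μ ^ 2 / (1 + μ ^ 3 * t))) ∧
      (k = r → ∀ t : ℕ, ‖F (t + burnIn c₄ μ⁻¹) * (F (t + burnIn c₄ μ⁻¹))ᵀ - X‖ ≤
        B * μ ^ 2 * fastRate α μ ^ t) := by
  obtain ⟨K, hK, hlen⟩ := exists_warm_lengths hα hα1 hC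
  have hC3 : 0 < 33600 * C ^ 3 * K := by positivity
  refine ⟨1 / 1000 / (33600 * C ^ 3 * K), by positivity, fun ε hε hε1 => ?_⟩
  set c₀ := 1 / 1000 / (33600 * C ^ 3 * K) with hc₀
  have hc₀0 : 0 < c₀ := by positivity
  obtain ⟨L, hL, hlenε⟩ := hlen ε hε hε1
  -- In order: smallness for the local phase, smallness for the warm phase, and control of the
  -- accumulated growth of the orthogonal part.
  set ρ := min (1 / 1000) (min (c₀ * ε) (c₀ * ε / (2 * C ^ 2 * L))) with hρ
  have hρ0 : 0 < ρ := lt_min (by norm_num) (lt_min (by positivity) (by positivity))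
  have hρ1 : ρ ≤ 1 / 1000 := min_le_left _ _
  have hρ2 : ρ ≤ c₀ * ε := (min_le_right _ _).trans (min_le_left _ _)
  have hρ3 : ρ ≤ c₀ * ε / (2 * C ^ 2 * L) := (min_le_right _ _).trans (min_le_right _ _)
  refine ⟨ρ, 4 * (L + 2) / α, 6 * C * Real.exp L * (320 / α) + 24 * (1 + L) / α, hρ0, by positivity,
    by positivity, ?_⟩
  intro d r k X U Dh Di F a E μ c hU hT hac hεc hcC hinit
  have hμ := hU.μ_pos
  have hμ1 := hU.μ_le
  have hμ2 : μ ^ 2 ≤ 1 := pow_le_one₀ hμ.le hμ1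
  obtain ⟨NA, NB, n1, n2, n3, n4⟩ := hlenε μ hμ hμ1
  obtain ⟨N, hN⟩ : ∃ N, N = NA + NB := ⟨_, rfl⟩
  rw [← hN] at n4
  have hlog : 1 + Real.log μ⁻¹ ≤ μ⁻¹ := by linarith [Real.log_le_sub_one_of_pos (inv_pos.2 hμ)]
  have hNL : μ ^ 3 * N ≤ L := by
    calc μ ^ 3 * N = μ * (N * μ ^ 2) := by ring
      _ ≤ μ * (L * (1 + Real.log μ⁻¹)) := mul_le_mul_of_nonneg_left n4 hμ.le
      _ ≤ μ * (L * μ⁻¹) :=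
        mul_le_mul_of_nonneg_left (mul_le_mul_of_nonneg_left hlog hL.le) hμ.le
      _ = L := by field_simp
  have hW : WarmPhase X U Dh Di F a E α μ ρ c C c₀ ε K N :=
    { frame := hU
      traj := hT
      α_pos := hα
      α_le := by linarith
      a_mul_le := hac
      ε_pos := hε
      ε_le := hε1
      ε_le_c := hεc
      c_le := hcC
      one_le_C := hC
      one_le_K := hK
      c₀_pos := hc₀0
      c₀_le := by rw [hc₀, mul_div_cancel₀ _ hC3.ne']
      ρ_nonneg := hρ0.le
      ρ_le := hρ2
      init := hinit
      length := by
        have e1 : ρ * (2 * C ^ 2 * L) ≤ c₀ * ε := by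
          rwa [le_div_iff₀ (by positivity)] at hρ3
        have e2 : μ ^ 2 * (μ ^ 3 * N) ≤ 1 * L := mul_le_mul hμ2 hNL (by positivity) zero_le_one
        have e3 : ρ * ρ ≤ ρ * 1 := mul_le_mul_of_nonneg_left (by linarith) hρ0.le
        calc 2 * C ^ 2 * ρ ^ 2 * μ ^ 5 * N = 2 * C ^ 2 * (ρ * ρ) * (μ ^ 2 * (μ ^ 3 * N)) := by ring
          _ ≤ 2 * C ^ 2 * (ρ * 1) * (1 * L) :=
            mul_le_mul (mul_le_mul_of_nonneg_left e3 (by positivity)) e2 (by positivity)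
              (by positivity)
          _ = ρ * (2 * C ^ 2 * L) := by ring
          _ ≤ _ := e1 }
  obtain ⟨w1, w2, w3⟩ := hW.conclusion hN n1 n2 n3
  have hg0 := fastRate_nonneg hα1 hμ hμ1
  have hg1 : fastRate α μ ≤ 1 := fastRate_le_one hα
  have hgN := fastRate_inv_pow_le hα hα1 hμ hμ1 n4
  have hburn := fastRate_burnIn_le (L := L) hα hα1 hμ hμ1
  set T := burnIn (4 * (L + 2) / α) μ⁻¹ with hTd
  set W := Real.exp (L * (1 + Real.log μ⁻¹)) with hWd
  have hW0 : 0 < W := Real.exp_pos _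
  -- The burn-in T need not reach N (for μ = 1 it is 0), so times before N need a bound of the same
  -- geometric shape.
  have early : ∀ t ≤ N, ‖F t * (F t)ᵀ - X‖ ≤ 6 * C * (W * fastRate α μ ^ t) := by
    intro t ht
    refine (w1 t ht).trans ?_
    have e1 : fastRate α μ ^ N ≤ fastRate α μ ^ t := pow_le_pow_of_le_one hg0 hg1 ht
    have e2 := mul_le_mul_of_nonneg_left e1 hW0.le
    nlinarith
  have late : ∀ s : ℕ, fastRate α μ ^ s ≤ 6 * C * (W * fastRate α μ ^ (N + s)) := by
    intro s
    have hs := pow_nonneg hg0 s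
    have e1 := mul_le_mul_of_nonneg_right hgN hs
    rw [pow_add, ← mul_assoc W]
    nlinarith [mul_nonneg hW0.le (pow_nonneg hg0 N)]
  have decay : ∀ t : ℕ, 6 * C * (W * fastRate α μ ^ (t + T)) ≤
      6 * C * Real.exp L * (fastRate α μ ^ t * μ ^ 2) := by
    intro t
    have e1 := mul_le_mul_of_nonneg_right hburn (pow_nonneg hg0 t)
    rw [pow_add]
    nlinarith [Real.exp_pos L]
  constructor
  · intro t
    have hden : 0 ≤ μ ^ 2 / (1 + μ ^ 3 * t) := by positivity
    have hfast : 6 * C * (W * fastRate α μ ^ (t + T)) ≤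
        6 * C * Real.exp L * (320 / α) * (μ ^ 2 / (1 + μ ^ 3 * t)) := by
      refine (decay t).trans ?_
      rw [mul_assoc (6 * C * Real.exp L)]
      apply mul_le_mul_of_nonneg_left _ (by positivity)
      exact (fastRate_pow_le_slowRate hα (by linarith) hμ hμ1 t).trans
        (slowRate_le_div hα hα1 hμ t)
    have hextra : 0 ≤ 24 * (1 + L) / α * (μ ^ 2 / (1 + μ ^ 3 * t)) := by positivity
    rw [add_mul]
    rcases le_total (t + T) N with hle | hle
    · linarith [early (t + T) hle]
    · obtain ⟨s, hs⟩ := Nat.exists_eq_add_of_le hle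
      have h1 := norm_residual_le_of_local_phase hU (hT.shift N) hα (by linarith) hρ0.le hρ1 w2 w3 s
      have h2 := late s
      have h3 := slowRate_shift_le hα hα1 hμ hL (s := s) n4
      rw [← hs] at h1 h2 h3
      have h4 : μ ^ 2 / (1 + μ ^ 3 * (t + T : ℕ)) ≤ μ ^ 2 / (1 + μ ^ 3 * t) := by
        apply div_le_div_of_nonneg_left (sq_nonneg μ) (by positivity)
        have : (t : ℝ) ≤ (t + T : ℕ) := by exact_mod_cast Nat.le_add_right t T
        have := mul_le_mul_of_nonneg_left this (pow_nonneg hμ.le 3)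
        linarith
      have h5 : 8 * (1 + L) / α * (μ ^ 2 / (1 + μ ^ 3 * (t + T : ℕ))) ≤
          8 * (1 + L) / α * (μ ^ 2 / (1 + μ ^ 3 * t)) :=
        mul_le_mul_of_nonneg_left h4 (by positivity)
      have h6 : 24 * (1 + L) / α * (μ ^ 2 / (1 + μ ^ 3 * t)) =
          3 * (8 * (1 + L) / α * (μ ^ 2 / (1 + μ ^ 3 * t))) := by ring
      rw [h6]
      linarith
  · rintro rfl t
    have hfast : 6 * C * (W * fastRate α μ ^ (t + T)) ≤
        (6 * C * Real.exp L * (320 / α) + 24 * (1 + L) / α) * μ ^ 2 * fastRate α μ ^ t := by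
      refine (decay t).trans ?_
      have e0 : 0 ≤ fastRate α μ ^ t * μ ^ 2 := mul_nonneg (pow_nonneg hg0 t) (sq_nonneg μ)
      have e1 : 6 * C * Real.exp L ≤ 6 * C * Real.exp L * (320 / α) + 24 * (1 + L) / α := by
        have h1 : 1 ≤ 320 / α := by rw [le_div_iff₀ hα]; linarith
        have h2 : 0 ≤ 24 * (1 + L) / α := by positivity
        have h3 : 0 ≤ 6 * C * Real.exp L := by positivity
        linarith [le_mul_of_one_le_right h3 h1]
      have e2 := mul_le_mul_of_nonneg_right e1 e0
      exact e2.trans_eq (by ring)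
    refine le_trans ?_ hfast
    rcases le_total (t + T) N with hle | hle
    · exact early (t + T) hle
    · obtain ⟨s, hs⟩ := Nat.exists_eq_add_of_le hle
      have h1 := norm_residual_le_of_local_phase_square hU (hT.shift N) hα (by linarith) hρ0.le hρ1
        w2 w3 s
      have h2 := late s
      rw [← hs] at h1 h2
      exact h1.trans h2

end Core

/-! ### Singular values, eigenvalues and the spectral frame -/

section Spectrum
variable {d : ℕ}

lemma finrank_range_toEuclideanLin (X : Matrix (Fin d) (Fin d) ℝ) :
    Module.finrank ℝ (toEuclideanLin X).range = X.rank :=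
  (X.rank_eq_finrank_range_toLin (EuclideanSpace.basisFun (Fin d) ℝ).toBasis
    (EuclideanSpace.basisFun (Fin d) ℝ).toBasis).symm

lemma sigma_rank_pos {X : Matrix (Fin d) (Fin d) ℝ} {r : ℕ} (hr : 1 ≤ r) (h : X.rank = r) :
    0 < sigma X r := by
  rw [sigma, LinearMap.singularValues_pos_iff_lt_finrank_range, finrank_range_toEuclideanLin, h]
  omega

lemma sigma_le_sigma_one (X : Matrix (Fin d) (Fin d) ℝ) (r : ℕ) : sigma X r ≤ sigma X 1 :=
  (toEuclideanLin X).singularValues_antitone (by simp)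

/-- An eigenvector of X for λ is one of the squared operator for λ². Some index suffices: singular
values are antitone, and a positive one has index below the rank. -/
lemma exists_singularValues_eq_abs_eigenvalues {X : Matrix (Fin d) (Fin d) ℝ} (hX : X.IsHermitian)
    (i : Fin d) : ∃ j : ℕ, (toEuclideanLin X).singularValues j = |hX.eigenvalues i| := by
  have hd : Module.finrank ℝ (EuclideanSpace ℝ (Fin d)) = d := finrank_euclideanSpace_fin
  set T := toEuclideanLin X
  have hT : T.adjoint = T := by
    rw [← toEuclideanLin_conjTranspose_eq_adjoint, hX.eq]
  have hv : T (hX.eigenvectorBasis i) = hX.eigenvalues i • hX.eigenvectorBasis i := by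
    apply PiLp.ext
    intro j
    exact congrFun (hX.mulVec_eigenvectorBasis i) j
  have he : Module.End.HasEigenvalue (T.adjoint ∘ₗ T) (hX.eigenvalues i ^ 2) := by
    refine Module.End.hasEigenvalue_of_hasEigenvector (x := hX.eigenvectorBasis i) ⟨?_, ?_⟩
    · rw [Module.End.mem_eigenspace_iff, hT, LinearMap.comp_apply, hv, map_smul, hv, smul_smul, sq]
    · exact hX.eigenvectorBasis.orthonormal.ne_zero i
  obtain ⟨j, hj⟩ := T.isSymmetric_adjoint_comp_self.exists_eigenvalues_eq hd he
  refine ⟨j, ?_⟩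
  rw [T.singularValues_fin hd j]
  have : T.isSymmetric_adjoint_comp_self.eigenvalues hd j = hX.eigenvalues i ^ 2 := by
    exact_mod_cast hj
  rw [this, Real.sqrt_sq_eq_abs]

lemma eigenvalues_le_sigma_one {X : Matrix (Fin d) (Fin d) ℝ} (hX : X.IsHermitian) (i : Fin d) :
    hX.eigenvalues i ≤ sigma X 1 := by
  obtain ⟨j, hj⟩ := exists_singularValues_eq_abs_eigenvalues hX i
  refine (le_abs_self _).trans (hj ▸ ?_)
  exact (toEuclideanLin X).singularValues_antitone (by simp)

lemma sigma_rank_le_abs_eigenvalues {X : Matrix (Fin d) (Fin d) ℝ} (hX : X.IsHermitian) {r : ℕ}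
    (hr : X.rank = r) {i : Fin d} (hi : hX.eigenvalues i ≠ 0) : sigma X r ≤ |hX.eigenvalues i| := by
  obtain ⟨j, hj⟩ := exists_singularValues_eq_abs_eigenvalues hX i
  have hpos : 0 < (toEuclideanLin X).singularValues j := hj ▸ abs_pos.2 hi
  rw [LinearMap.singularValues_pos_iff_lt_finrank_range, finrank_range_toEuclideanLin, hr] at hpos
  rw [← hj]
  exact (toEuclideanLin X).singularValues_antitone (by omega)

lemma abs_eigenvalues_le_norm {X : Matrix (Fin d) (Fin d) ℝ} (hX : X.IsHermitian) (i : Fin d) :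
    |hX.eigenvalues i| ≤ ‖X‖ := by
  have h := (toEuclideanCLM (n := Fin d) (𝕜 := ℝ) X).le_opNorm (hX.eigenvectorBasis i)
  have hv : toEuclideanCLM (n := Fin d) (𝕜 := ℝ) X (hX.eigenvectorBasis i) =
      hX.eigenvalues i • hX.eigenvectorBasis i := by
    apply PiLp.ext
    intro j
    exact congrFun (hX.mulVec_eigenvectorBasis i) j
  rw [hv, norm_smul, hX.eigenvectorBasis.orthonormal.1 i, mul_one, mul_one] at h
  exact h

lemma sum_sq_eq_sum_eigenvalues_sq {X : Matrix (Fin d) (Fin d) ℝ} (hX : X.IsHermitian) :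
    ∑ i, ∑ j, X i j ^ 2 = ∑ i, hX.eigenvalues i ^ 2 := by
  have h1 : ∑ i, ∑ j, X i j ^ 2 = (X * X).trace := by
    simp only [trace, diag_apply, mul_apply]
    refine Finset.sum_congr rfl fun i _ => Finset.sum_congr rfl fun j _ => ?_
    rw [sq]
    congr 1
    simpa using (hX.apply i j).symm
  have h2 : X * X = Unitary.conjStarAlgAut ℝ _ hX.eigenvectorUnitary
      (diagonal hX.eigenvalues * diagonal hX.eigenvalues) := by
    rw [map_mul]
    have := hX.spectral_theorem
    conv_lhs => rw [this]
    rfl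
  rw [h1, h2, Unitary.conjStarAlgAut_apply, trace_mul_cycle, ← mul_assoc]
  simp [diagonal_mul_diagonal, trace_diagonal, sq]

/-- At most rank-many eigenvalues contribute. This converts the Frobenius scale in RDPP to the
spectral norm and accounts for the √k in δ. -/
lemma frobNorm_le_sqrt_rank_mul_norm {X : Matrix (Fin d) (Fin d) ℝ} (hX : X.IsHermitian) :
    frobNorm X ≤ √(X.rank : ℝ) * ‖X‖ := by
  rw [frobNorm, ← Real.sqrt_sq (norm_nonneg X), ← Real.sqrt_mul (Nat.cast_nonneg _)]
  apply Real.sqrt_le_sqrt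
  rw [sum_sq_eq_sum_eigenvalues_sq hX, hX.rank_eq_card_non_zero_eigs, Fintype.card_subtype]
  rw [← Finset.sum_filter_add_sum_filter_not Finset.univ (fun i => hX.eigenvalues i ≠ 0),
    Finset.sum_eq_zero (s := Finset.univ.filter fun i => ¬ hX.eigenvalues i ≠ 0), add_zero,
    ← nsmul_eq_mul]
  · refine Finset.sum_le_card_nsmul _ _ _ fun i _ => ?_
    rw [← sq_abs]
    exact pow_le_pow_left₀ (abs_nonneg _) (abs_eigenvalues_le_norm hX i) 2
  · intro i hi
    simp at hi
    simp [hi]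

lemma rank_sub_le (X Y : Matrix (Fin d) (Fin d) ℝ) : (X - Y).rank ≤ X.rank + Y.rank := by
  have h : (X - Y).mulVecLin.range ≤ X.mulVecLin.range ⊔ Y.mulVecLin.range := by
    rintro _ ⟨v, rfl⟩
    rw [mulVecLin_apply, sub_mulVec]
    exact Submodule.sub_mem _ (Submodule.mem_sup_left ⟨v, rfl⟩) (Submodule.mem_sup_right ⟨v, rfl⟩)
  exact (Submodule.finrank_mono h).trans (Submodule.finrank_add_le_finrank_add_finrank _ _)

lemma rank_mul_transpose_sub_le {k : ℕ} (F : Matrix (Fin d) (Fin k) ℝ)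
    (X : Matrix (Fin d) (Fin d) ℝ) : (F * Fᵀ - X).rank ≤ X.rank + k := by
  have h1 := rank_sub_le (F * Fᵀ) X
  have h2 := (rank_mul_le_left F Fᵀ).trans (rank_le_width F)
  omega

lemma frobNorm_pos {X : Matrix (Fin d) (Fin d) ℝ} (hX : X ≠ 0) : 0 < frobNorm X := by
  rw [frobNorm, Real.sqrt_pos]
  by_contra! h
  have h0 : ∀ i, ∀ j, 0 ≤ X i j ^ 2 := fun i j => sq_nonneg _
  have h1 := (Finset.sum_eq_zero_iff_of_nonneg
    (fun i _ => Finset.sum_nonneg fun j _ => h0 i j)).1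
    (le_antisymm h (Finset.sum_nonneg fun i _ => Finset.sum_nonneg fun j _ => h0 i j))
  apply hX
  ext i j
  have h2 := (Finset.sum_eq_zero_iff_of_nonneg fun j _ => h0 i j).1 (h1 i (Finset.mem_univ _)) j
    (Finset.mem_univ _)
  simpa using h2

lemma frobNorm_zero : frobNorm (0 : Matrix (Fin d) (Fin d) ℝ) = 0 := by simp [frobNorm]

lemma specNorm_eq_norm (X : Matrix (Fin d) (Fin d) ℝ) : specNorm X = ‖X‖ := rfl

lemma mul_diagonal_mul_transpose_apply {n p : Type*} [Fintype p] [DecidableEq p]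
    (U : Matrix n p ℝ) (w : p → ℝ) (i j : n) :
    (U * diagonal w * Uᵀ) i j = ∑ q, U i q * w q * U j q := by
  rw [mul_apply]
  exact Finset.sum_congr rfl fun q _ => by rw [mul_diagonal, transpose_apply]

/-- The columns of U are the eigenvectors with nonzero eigenvalue; the scaled eigenvalues lie in [μ,
1]. -/
lemma exists_spectralFrame {X : Matrix (Fin d) (Fin d) ℝ} (hX : X.PosSemidef) {r : ℕ} (hr : 1 ≤ r)
    (h : X.rank = r) : ∃ (U : Matrix (Fin d) (Fin r) ℝ) (Dh Di : Matrix (Fin r) (Fin r) ℝ),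
      SpectralFrame ((sigma X 1)⁻¹ • X) U Dh Di (sigma X r / sigma X 1) := by
  have hsr := sigma_rank_pos hr h
  have hs := hsr.trans_le (sigma_le_sigma_one X r)
  set s := sigma X 1
  set sr := sigma X r
  have hcard : Fintype.card {i // hX.1.eigenvalues i ≠ 0} = Fintype.card (Fin r) := by
    rw [← hX.1.rank_eq_card_non_zero_eigs, h, Fintype.card_fin]
  let e := Fintype.equivOfCardEq hcard
  let l : Fin r → ℝ := fun j => hX.1.eigenvalues (e.symm j).1 / s
  have hl0 : ∀ j, 0 < hX.1.eigenvalues (e.symm j).1 := fun j =>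
    lt_of_le_of_ne (hX.eigenvalues_nonneg _) (e.symm j).2.symm
  have hlpos : ∀ j, 0 < l j := fun j => div_pos (hl0 j) hs
  have hl1 : ∀ j, l j ≤ 1 := fun j => by
    rw [div_le_one hs]; exact eigenvalues_le_sigma_one hX.1 _
  have hlr : ∀ j, sr / s ≤ l j := fun j => by
    have := sigma_rank_le_abs_eigenvalues hX.1 h (e.symm j).2
    rw [abs_of_pos (hl0 j)] at this
    exact div_le_div_of_nonneg_right this hs.le
  have hμ1 : sr / s ≤ 1 := by rw [div_le_one hs]; exact sigma_le_sigma_one X r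
  have hμ : 0 < sr / s := div_pos hsr hs
  have hsq : ∀ j, √(l j) * √(l j) = l j := fun j => Real.mul_self_sqrt (hlpos j).le
  have hsp : ∀ j, 0 < √(l j) := fun j => Real.sqrt_pos.2 (hlpos j)
  let V : Matrix (Fin d) (Fin d) ℝ := hX.1.eigenvectorUnitary
  have hV : Vᵀ * V = 1 := by
    have := (Matrix.mem_unitaryGroup_iff').1 hX.1.eigenvectorUnitary.2
    rwa [star_eq_conjTranspose, conjTranspose_eq_transpose_of_trivial] at this
  refine ⟨V.submatrix id (fun j => (e.symm j).1), diagonal fun j => √(l j),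
    diagonal fun j => (√(l j))⁻¹, hμ, hμ1, ?_, ?_, diagonal_transpose _, diagonal_transpose _,
    ?_, ?_, ?_, ?_, ?_⟩
  · ext i j
    have := congrFun (congrFun hV (e.symm i).1) (e.symm j).1
    simp only [mul_apply, transpose_apply, submatrix_apply, id, one_apply] at this ⊢
    rw [this]
    simp [Subtype.ext_iff.symm]
  · have hspec : X = V * diagonal hX.1.eigenvalues * Vᵀ := by
      have := hX.1.spectral_theorem
      rw [Unitary.conjStarAlgAut_apply] at this
      rw [← conjTranspose_eq_transpose_of_trivial, ← star_eq_conjTranspose]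
      exact this
    ext i j
    rw [diagonal_mul_diagonal, mul_diagonal_mul_transpose_apply, Matrix.smul_apply]
    conv_lhs => rw [hspec]
    rw [mul_diagonal_mul_transpose_apply, smul_eq_mul, Finset.mul_sum]
    have hsub := Finset.sum_subtype (F := inferInstance) (Finset.univ.filter fun p => hX.1.eigenvalues p ≠ 0)
      (p := fun p => hX.1.eigenvalues p ≠ 0) (by simp)
      (fun p => s⁻¹ * (V i p * hX.1.eigenvalues p * V j p))
    rw [Finset.sum_filter_of_ne] at hsub
    · rw [hsub, ← e.symm.sum_comp]
      refine Finset.sum_congr rfl fun q _ => ?_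
      simp only [hsq, submatrix_apply, id, l]
      ring
    · intro p _ hp h0
      simp [h0] at hp
  · rw [diagonal_mul_diagonal, ← diagonal_one]
    congr 1; ext j
    exact mul_inv_cancel₀ (hsp j).ne'
  · rw [diagonal_mul_diagonal, ← diagonal_one]
    congr 1; ext j
    exact inv_mul_cancel₀ (hsp j).ne'
  · rw [l2_opNorm_diagonal, pi_norm_le_iff_of_nonneg zero_le_one]
    intro j
    rw [Real.norm_of_nonneg (hsp j).le]
    exact Real.sqrt_le_one.2 (hl1 j)
  · rw [l2_opNorm_diagonal, pi_norm_le_iff_of_nonneg (by positivity)]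
    intro j
    rw [Real.norm_of_nonneg (inv_nonneg.2 (hsp j).le), one_div]
    apply inv_anti₀ hμ
    -- Only the crude bound 1/μ on the inverse square root is needed, so l ≤ √l for l ≤ 1 is enough.
    refine (hlr j).trans ?_
    rw [Real.le_sqrt' (hlpos j)]
    nlinarith [hl1 j, hlpos j]
  · rw [diagonal_mul_diagonal, ← diagonal_one, diagonal_sub, l2_opNorm_diagonal,
      pi_norm_le_iff_of_nonneg (by linarith)]
    intro j
    rw [hsq, Real.norm_of_nonneg (by linarith [hl1 j])]
    linarith [hlr j]

end Spectrum

/-! ### From the subgradient method to perturbed gradient descent -/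

lemma one_third_le_sqrt : 1 / 3 ≤ √(1 / (2 * Real.pi)) := by
  apply Real.le_sqrt_of_sq_le
  rw [le_div_iff₀ (by positivity)]
  nlinarith [Real.pi_lt_d2]

lemma sqrt_le_four_fifths : √(2 / Real.pi) ≤ 4 / 5 := by
  rw [Real.sqrt_le_left (by norm_num), div_le_iff₀ Real.pi_pos]
  nlinarith [Real.pi_gt_d2]

section Reduction
variable {d k m : ℕ}

lemma mul_transpose_inv_sqrt_smul {s : ℝ} (hs : 0 < s) (F : Matrix (Fin d) (Fin k) ℝ) :
    ((√s)⁻¹ • F) * ((√s)⁻¹ • F)ᵀ = s⁻¹ • (F * Fᵀ) := by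
  rw [transpose_smul, Matrix.smul_mul, Matrix.mul_smul, smul_smul, ← mul_inv, Real.mul_self_sqrt hs.le]

/-- RDPP says D ≈ (p/n) R with p = ψ(R) and n = ‖R‖_F. Factoring out p s/n leaves the scaled
residual plus the rescaled deviation, which serves as E. -/
lemma subgradient_step_eq {s p n η : ℝ} (hs : s ≠ 0) (hp : p ≠ 0) (hn : n ≠ 0)
    (R D : Matrix (Fin d) (Fin d) ℝ) (F : Matrix (Fin d) (Fin k) ℝ) :
    η • (D * F) = (η * p * s / n) • ((s⁻¹ • R + (n / (p * s)) • (D - (p / n) • R)) * F) := by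
  rw [← smul_mul, ← smul_mul]
  congr 1
  rw [smul_add, smul_smul, smul_smul, smul_sub, smul_smul]
  have e1 : η * p * s / n * (n / (p * s)) = η := by field_simp
  have e2 : η * p * s / n * s⁻¹ = η * (p / n) := by field_simp
  rw [e1, e2]
  abel

lemma isSymm_residual {X : Matrix (Fin d) (Fin d) ℝ} (hX : X.IsSymm)
    (F : Matrix (Fin d) (Fin k) ℝ) : (F * Fᵀ - X).IsSymm := by
  rw [IsSymm, transpose_sub, transpose_mul, transpose_transpose, hX.eq]

/-- One step of the subgradient method is a perturbed gradient step for the normalized problem. -/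
lemma exists_normalized_step {X : Matrix (Fin d) (Fin d) ℝ} (hX : X.IsSymm) {r : ℕ}
    (hr : 1 ≤ r) (hrk : r ≤ k) (hrank : X.rank = r) (A : Fin m → Matrix (Fin d) (Fin d) ℝ)
    (b : Fin m → ℝ) {ψ : Matrix (Fin d) (Fin d) ℝ → ℝ}
    (hψ : ∀ X, √(1 / (2 * Real.pi)) ≤ ψ X ∧ ψ X ≤ √(2 / Real.pi))
    {δ ρ s sr c₁ c₂ c α η : ℝ} (hD : RDPP A b (r + k) δ ψ) (hs : 0 < s) (hsr : 0 < sr)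
    (hδ : δ ≤ ρ / 5 / ((s / sr) ^ 3 * √(k : ℝ))) (hρ : 0 < ρ) (hα : 0 < α) (hα1 : α ≤ c₁ / 3)
    (hc₁ : c₁ < c₂) (hc₂ : c₂ ≤ 1 / 100) (hc : 0 < c) (hcc : c₂ * c ≤ 1)
    (F : Matrix (Fin d) (Fin k) ℝ)
    (h1 : c₁ * (sr / s ^ 2) * frobNorm (F * Fᵀ - X) ≤ η)
    (h2 : η ≤ c₂ * (sr / s ^ 2) * frobNorm (F * Fᵀ - X)) :
    ∃ (a : ℝ) (E : Matrix (Fin d) (Fin d) ℝ),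
      η • (subgradD A b (F * Fᵀ - X) * F) = a • ((s⁻¹ • (F * Fᵀ - X) + E) * F) ∧
      α * (sr / s) ≤ a ∧ a ≤ sr / s / 100 ∧ a * c ≤ 4 / 5 * (sr / s) ∧
      ‖E‖ ≤ ρ * (sr / s) ^ 3 * ‖s⁻¹ • (F * Fᵀ - X)‖ := by
  have hμ : 0 < sr / s := div_pos hsr hs
  have hrk' : (F * Fᵀ - X).rank ≤ r + k := hrank ▸ rank_mul_transpose_sub_le F X
  have hsymm := isSymm_residual hX F
  set R := F * Fᵀ - X
  by_cases hR : R = 0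
  -- At R = 0 RDPP is silent, but the stepsize is forced to be 0, so any admissible a with E = 0
  -- will do.
  · rw [hR, frobNorm_zero, mul_zero] at h1 h2
    have hη : η = 0 := le_antisymm h2 h1
    refine ⟨α * (sr / s), 0, by simp [hR, hη], le_rfl, ?_, ?_, ?_⟩
    · nlinarith
    · have : α * c ≤ 4 / 5 := by nlinarith
      calc α * (sr / s) * c = α * c * (sr / s) := by ring
        _ ≤ _ := mul_le_mul_of_nonneg_right this hμ.le
    · rw [norm_zero]; positivity
  · have hn := frobNorm_pos hR
    have hnle : frobNorm R ≤ √((r + k : ℕ) : ℝ) * ‖R‖ := by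
      refine (frobNorm_le_sqrt_rank_mul_norm
        (by rwa [IsHermitian, conjTranspose_eq_transpose_of_trivial])).trans ?_
      gcongr
    have hDR := hD R hsymm hrk' hR
    rw [specNorm_eq_norm] at hDR
    set n := frobNorm R
    obtain ⟨hp1, hp2⟩ := hψ R
    set p := ψ R
    replace hp1 := one_third_le_sqrt.trans hp1
    replace hp2 := hp2.trans sqrt_le_four_fifths
    have hp : 0 < p := by linarith
    have ha : ∀ x, x * (sr / s ^ 2) * n * (p * s / n) = x * p * (sr / s) := fun x => by field_simp
    have hpos : 0 ≤ p * s / n := by positivity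
    have h1' := mul_le_mul_of_nonneg_right h1 hpos
    have h2' := mul_le_mul_of_nonneg_right h2 hpos
    rw [ha] at h1' h2'
    have haeq : η * p * s / n = η * (p * s / n) := by ring
    refine ⟨η * p * s / n, (n / (p * s)) • (subgradD A b R - (p / n) • R),
      subgradient_step_eq hs.ne' hp.ne' hn.ne' _ _ _, ?_, ?_, ?_, ?_⟩
    · rw [haeq]
      refine le_trans (mul_le_mul_of_nonneg_right ?_ hμ.le) h1'
      nlinarith
    · rw [haeq]
      refine h2'.trans ?_
      have : c₂ * p ≤ 1 / 100 := by nlinarith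
      nlinarith
    · rw [haeq]
      refine (mul_le_mul_of_nonneg_right h2' hc.le).trans ?_
      have : c₂ * c * p ≤ 4 / 5 := by nlinarith [mul_le_mul_of_nonneg_right hcc hp.le]
      calc c₂ * p * (sr / s) * c = c₂ * c * p * (sr / s) := by ring
        _ ≤ _ := mul_le_mul_of_nonneg_right this hμ.le
    · have hk : (0 : ℝ) < k := by exact_mod_cast (by omega : 0 < k)
      have hsk : 0 < √(k : ℝ) := Real.sqrt_pos.2 hk
      have hδ' : δ * √(k : ℝ) ≤ ρ / 5 * (sr / s) ^ 3 := by
        refine (mul_le_mul_of_nonneg_right hδ hsk.le).trans_eq ?_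
        field_simp
      have hsum : √((r + k : ℕ) : ℝ) ≤ 3 / 2 * √(k : ℝ) := by
        rw [Real.sqrt_le_left (by positivity), mul_pow, Real.sq_sqrt hk.le]
        have : (r : ℝ) ≤ k := by exact_mod_cast hrk
        push_cast
        linarith
      have hδ0 : 0 ≤ δ := (norm_nonneg _).trans hDR
      rw [norm_smul, norm_smul, Real.norm_of_nonneg (by positivity : 0 ≤ n / (p * s)),
        Real.norm_of_nonneg (by positivity : 0 ≤ s⁻¹)]
      have e1 : n / (p * s) ≤ 3 * (n * s⁻¹) := by
        rw [div_le_iff₀ (by positivity)]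
        have : 3 * (n * s⁻¹) * (p * s) = n * (3 * p) := by field_simp
        rw [this]
        nlinarith
      have e2 : n ≤ 3 / 2 * √(k : ℝ) * ‖R‖ :=
        hnle.trans (mul_le_mul_of_nonneg_right hsum (norm_nonneg _))
      have hsi : 0 ≤ s⁻¹ * ‖R‖ := by positivity
      -- The factor 3 is from ψ ≥ 1/3 and 3/2 from √(r + k) ≤ (3/2)√k; their product 9/2 is absorbed
      -- by the 1/5 in the bound on δ.
      calc n / (p * s) * ‖subgradD A b R - (p / n) • R‖ ≤ 3 * (n * s⁻¹) * δ := by gcongr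
        _ ≤ 3 * ((3 / 2 * √(k : ℝ) * ‖R‖) * s⁻¹) * δ := by gcongr
        _ = 9 / 2 * (δ * √(k : ℝ)) * (s⁻¹ * ‖R‖) := by ring
        _ ≤ 9 / 2 * (ρ / 5 * (sr / s) ^ 3) * (s⁻¹ * ‖R‖) := by gcongr
        _ ≤ ρ * (sr / s) ^ 3 * (s⁻¹ * ‖R‖) := by
          apply mul_le_mul_of_nonneg_right _ hsi
          have : 0 < ρ * (sr / s) ^ 3 := by positivity
          linarith

end Reduction

end RobustMatrixRecovery
end

/-! ### The main theorem -/

open RobustMatrixRecovery in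
open scoped Matrix.Norms.L2Operator in
theorem mainTheorem2 : 
    ∀ c₁ : ℝ, 0 < c₁ → ∃ c₀' : ℝ, 0 < c₀' ∧
    ∀ ε : ℝ, 0 < ε → ε < 1 →
    ∃ c₃ c₄ c₅ c₆ c₇ : ℝ, 0 < c₃ ∧ 0 < c₄ ∧ 0 < c₅ ∧ 0 < c₆ ∧ 0 < c₇ ∧ c₇ < 1 ∧
    ∀ (d r k m : ℕ), 1 ≤ r → r ≤ k →
    ∀ (Xnat : Matrix (Fin d) (Fin d) ℝ), Xnat.PosSemidef → Xnat.rank = r →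
    ∀ (A : Fin m → Matrix (Fin d) (Fin d) ℝ) (s : Fin m → ℝ)
      (F₀ : Matrix (Fin d) (Fin k) ℝ) (η : ℕ → ℝ) (cstar c₂ δ : ℝ)
      (ψ : Matrix (Fin d) (Fin d) ℝ → ℝ),
      -- (i) initialization
      ε ≤ cstar → cstar ≤ 1 / ε →
      RobustMatrixRecovery.specNorm (F₀ * F₀.transpose - cstar • Xnat) ≤
        c₀' * ε * RobustMatrixRecovery.sigma Xnat r / RobustMatrixRecovery.condNumber Xnat r →
      -- (ii) stepsizes
      c₁ < c₂ → c₂ ≤ 0.01 → c₂ * cstar ≤ 1 →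
      (∀ t : ℕ,
        c₁ * (RobustMatrixRecovery.sigma Xnat r / RobustMatrixRecovery.sigma Xnat 1 ^ 2) *
            RobustMatrixRecovery.frobNorm (RobustMatrixRecovery.residual A s Xnat η F₀ t) ≤ η t ∧
        η t ≤ c₂ * (RobustMatrixRecovery.sigma Xnat r / RobustMatrixRecovery.sigma Xnat 1 ^ 2) *
            RobustMatrixRecovery.frobNorm (RobustMatrixRecovery.residual A s Xnat η F₀ t)) →
      -- (iii) RDPP
      δ ≤ c₃ / (RobustMatrixRecovery.condNumber Xnat r ^ 3 * √(k : ℝ)) →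
      (∀ X, √(1 / (2 * Real.pi)) ≤ ψ X ∧ ψ X ≤ √(2 / Real.pi)) →
      RobustMatrixRecovery.RDPP A s (r + k) δ ψ →
      (∀ t : ℕ,
        RobustMatrixRecovery.specNorm (RobustMatrixRecovery.residual A s Xnat η F₀
            (t + RobustMatrixRecovery.burnIn c₄ (RobustMatrixRecovery.condNumber Xnat r))) ≤
          c₅ * RobustMatrixRecovery.sigma Xnat 1 *
            (RobustMatrixRecovery.condNumber Xnat r /
              (RobustMatrixRecovery.condNumber Xnat r ^ 3 + t))) ∧
      (k = r → ∀ t : ℕ,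
        RobustMatrixRecovery.specNorm (RobustMatrixRecovery.residual A s Xnat η F₀
            (t + RobustMatrixRecovery.burnIn c₄ (RobustMatrixRecovery.condNumber Xnat r))) ≤
          c₆ * RobustMatrixRecovery.sigma Xnat r / RobustMatrixRecovery.condNumber Xnat r *
            (1 - c₇ / RobustMatrixRecovery.condNumber Xnat r ^ 2) ^ t) := by
  intro c₁ hc₁
  -- The factor 1/3 is the lower bound on ψ.
  have hα : 0 < min (c₁ / 3) (1 / 2) := by positivity
  -- From c₂ c* ≤ 1 and c₁ < c₂ one gets c* ≤ 1/c₁, so the bound C on c*, and with it c₀, depends on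
  -- c₁ alone.
  obtain ⟨c₀, hc₀, H⟩ := exists_convergence_constants hα (min_le_right _ _)
    (le_max_left 1 (1 / c₁))
  refine ⟨c₀, hc₀, fun ε hε hε1 => ?_⟩
  obtain ⟨ρ, c₄, B, hρ, hc₄, hB, H⟩ := H ε hε hε1.le
  set α := min (c₁ / 3) (1 / 2) with hαdef
  have hαh : α ≤ 1 / 2 := min_le_right _ _
  refine ⟨ρ / 5, c₄, B, B, α / 4, by positivity, hc₄, hB, hB, by positivity, by linarith, ?_⟩
  intro d r k m hr hrk X hX hrank A b F₀ η c c₂ δ ψ hεc _ hinit hc₁₂ hc₂ hcc hη hδ hψ hD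
  obtain ⟨U, Dh, Di, hU⟩ := exists_spectralFrame hX hr hrank
  have hsr := sigma_rank_pos hr hrank
  have hs := hsr.trans_le (sigma_le_sigma_one X r)
  have hcond : condNumber X r = (sigma X r / sigma X 1)⁻¹ := by rw [inv_div]; rfl
  have hc : 0 < c := hε.trans_le hεc
  have hsymm : X.IsSymm := by
    have := hX.1
    rwa [Matrix.IsHermitian, Matrix.conjTranspose_eq_transpose_of_trivial] at this
  have hstep := fun t => exists_normalized_step hsymm hr hrk hrank A b hψ hD hs hsr hδ hρ hα
    (min_le_left _ _) hc₁₂ (by norm_num at hc₂ ⊢; exact hc₂) hc hcc (iterates A b X η F₀ t)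
    (hη t).1 (hη t).2
  choose a E ha1 ha2 ha3 ha4 ha5 using hstep
  have hres : ∀ t, ((√(sigma X 1))⁻¹ • iterates A b X η F₀ t) *
      ((√(sigma X 1))⁻¹ • iterates A b X η F₀ t).transpose - (sigma X 1)⁻¹ • X =
      (sigma X 1)⁻¹ • residual A b X η F₀ t := fun t => by
    rw [mul_transpose_inv_sqrt_smul hs, ← smul_sub]; rfl
  have hnorm : ∀ M : Matrix (Fin d) (Fin d) ℝ, specNorm M = sigma X 1 * ‖(sigma X 1)⁻¹ • M‖ :=
    fun M => by
      rw [norm_smul, Real.norm_of_nonneg (inv_nonneg.2 hs.le), mul_inv_cancel_left₀ hs.ne']; rfl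
  have hT : Trajectory ((sigma X 1)⁻¹ • X)
      (fun t => (√(sigma X 1))⁻¹ • iterates A b X η F₀ t) a E α
      (sigma X r / sigma X 1) ρ := by
    refine ⟨fun t => ?_, ha2, ha3, fun t => ?_⟩
    · rw [hres, iterates, smul_sub]
      congr 1
      rw [Matrix.mul_smul, smul_comm (a t)]
      exact congrArg _ (ha1 t)
    · rw [hres]; exact ha5 t
  have hF0 : ‖((√(sigma X 1))⁻¹ • F₀) * ((√(sigma X 1))⁻¹ • F₀).transpose -
      c • (sigma X 1)⁻¹ • X‖ ≤ c₀ * ε * (sigma X r / sigma X 1) ^ 2 := by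
    rw [mul_transpose_inv_sqrt_smul hs, smul_comm c, ← smul_sub, norm_smul,
      Real.norm_of_nonneg (inv_nonneg.2 hs.le)]
    refine (mul_le_mul_of_nonneg_left hinit (inv_nonneg.2 hs.le)).trans_eq ?_
    rw [hcond]
    field_simp
  have hcC : c ≤ max 1 (1 / c₁) := by
    refine le_trans ?_ (le_max_right _ _)
    rw [le_div_iff₀ hc₁]
    nlinarith
  obtain ⟨h1, h2⟩ := H d r k _ U Dh Di _ a E _ c hU hT ha4 hεc hcC hF0
  simp only [hres] at h1 h2
  have hμ := div_pos hsr hs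
  refine ⟨fun t => ?_, fun hkr t => ?_⟩
  · rw [hnorm, hcond]
    refine (mul_le_mul_of_nonneg_left (h1 t) hs.le).trans_eq ?_
    have h3 : 0 < 1 + (sigma X r / sigma X 1) ^ 3 * t := by positivity
    have h4 : 0 < (sigma X r / sigma X 1)⁻¹ ^ 3 + t := by positivity
    generalize sigma X r / sigma X 1 = μ at *
    have h5 : μ ^ 2 / (1 + μ ^ 3 * t) = μ⁻¹ / (μ⁻¹ ^ 3 + t) := by
      rw [div_eq_div_iff h3.ne' h4.ne']
      field_simp
    rw [h5]
    ring
  · rw [hnorm, hcond]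
    refine (mul_le_mul_of_nonneg_left (h2 hkr t) hs.le).trans_eq ?_
    have h3 : sigma X r = sigma X r / sigma X 1 * sigma X 1 := by field_simp
    rw [fastRate]
    generalize sigma X r / sigma X 1 = μ at *
    rw [h3, inv_pow, div_inv_eq_mul, div_inv_eq_mul, mul_div_right_comm]
    ring
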